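/- Let $\mathcal G$ be a connected compact metric graph: finitely many vertices and edges, each edge $e$ being identified with an interval $[0,l_e]$ of finite length $l_e>0$; loops and multiple edges are allowed, and the degree of a vertex is the number of edge ends at it. Suppose that $\mathcal G$ has $m\ge1$ vertices of degree $1$, let $p>1$, and let $v_1,\dots,v_k$ be distinct vertices of degree $1$, $1\le k\le m$. Let $I_i$ be the terminal edge ending at $v_i$ and $l_i$ its length; the coordinate on $I_i\cong[0,l_i]$ used below for the index $i$ is the distance from $v_i$ along $I_i$. Let $$U(x)=\Big(\frac{p+1}{2}\Big)^{\frac1{p-1}}\Big[\cosh\Big(\frac{p-1}{2}x\Big)\Big]^{-\frac{2}{p-1}},$$ the even positive solution in $H^1(\mathbb R)$ of $-U''+U=U^p$. Fix $0<l<\min_i l_i$ and, for each $i$, a smooth cut-off function $\chi_i$ on $I_i$ with $\chi_i(x)=1$ for $0\le x\le l/2$ and $\chi_i(x)=0$ for $x\ge l$, and set $$U_{\lambda,i}(x)=\begin{cases}\lambda^{\frac1{p-1}}U(\sqrt\lambda\,x)&\text{on } I_i,\\ 0&\text{on }\mathcal G\setminus I_i,\end{cases}\qquad W_\lambda=\sum_{i=1}^k\chi_iU_{\lambda,i}.$$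 Let $H^1(\mathcal G)$ be the space of continuous functions on $\mathcal G$ whose restriction to each edge $e$ is in $H^1(0,l_e)$, and let $\|\phi\|_\lambda^2=\int_{\mathcal G}|\phi'|^2\,dx+\lambda\int_{\mathcal G}\phi^2\,dx$. Then there is $\lambda_0>0$ such that for every $\lambda>\lambda_0$ there is a $k$-peaked solution $u_\lambda$ with a single peak at each $v_i$, that is, a function $u_\lambda\in H^1(\mathcal G)$, of class $C^2$ on each closed edge, of the form $$u_\lambda=W_\lambda+\phi_\lambda,\qquad \phi_\lambda\in H^1(\mathcal G),$$ with $u_\lambda>0$ on $\mathcal G$, $-u_\lambda''+\lambda u_\lambda=|u_\lambda|^{p-1}u_\lambda$ on every edge, and the Kirchhoff condition at every vertex (the sum of the derivatives in the directions leaving the vertex is $0$). Moreover, as $\lambda\to\infty$, $$\|\phi_\lambda\|_\lambda=O(\lambda^{-\alpha})\quad\text{for every }\alpha>0,$$ and $$\rho_\lambda^2:=|u_\lambda|_{L^2(\mathcal G)}^2=C\lambda^{\frac{5-p}{2(p-1)}}+o\big(\lambda^{\frac{5-p}{2(p-1)}}\big),\qquad C=k\int_0^{\infty}U(x)^2\,dx>0.$$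 -/

import Mathlib

open Set Filter Asymptotics MeasureTheory
open scoped ContDiff

/-- A compact metric graph: finitely many vertices and edges (the finiteness is carried by
`Fintype` instances on `V` and `E`), loops and multiple edges allowed. The edge `e` is identified
with the interval `[0, len e]`, the vertex `src e` being at the coordinate `0` and `tgt e` at the
coordinate `len e`. -/
structure MetricGraph (V E : Type*) where
  src : E → V
  tgt : E → V
  len : E → ℝ
  len_pos : ∀ e, 0 < len e

noncomputable section

/-! ### The Sobolev space `H¹(0, l)` -/

/-- `g` is a weak derivative of `f` on `(0, l)`. -/
def IsWeakDeriv (l : ℝ) (f g : ℝ → ℝ) : Prop :=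
  ∀ η : ℝ → ℝ, ContDiff ℝ ∞ η → HasCompactSupport η → tsupport η ⊆ Ioo 0 l →
    ∫ x in (0 : ℝ)..l, f x * deriv η x = -∫ x in (0 : ℝ)..l, g x * η x

/-- `f` has a weak derivative in `L²(0, l)`. -/
def HasL2WeakDeriv (l : ℝ) (f : ℝ → ℝ) : Prop :=
  ∃ g : ℝ → ℝ, MemLp g 2 (volume.restrict (Icc 0 l)) ∧ IsWeakDeriv l f g

/-- `f ∈ H¹(0, l)`. -/
def MemH1Interval (l : ℝ) (f : ℝ → ℝ) : Prop :=
  MemLp f 2 (volume.restrict (Icc 0 l)) ∧ HasL2WeakDeriv l f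

open Classical in
/-- The weak derivative in `L²(0, l)` (unique almost everywhere) of a function of `H¹(0, l)`. -/
def weakDeriv (l : ℝ) (f : ℝ → ℝ) : ℝ → ℝ :=
  if h : HasL2WeakDeriv l f then h.choose else 0

/-! ### The model profile and the cut-off functions -/

/-- The positive even solution `U ∈ H¹(ℝ)` of `-U'' + U = U ^ p`. -/
def soliton (p x : ℝ) : ℝ :=
  ((p + 1) / 2) ^ (1 / (p - 1)) * Real.cosh ((p - 1) / 2 * x) ^ (-(2 / (p - 1)))

/-- The rescaled profile `λ ^ (1 / (p - 1)) U(√λ x)`, which solves `-w'' + λ w = w ^ p`. -/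
def scaledSoliton (p lam x : ℝ) : ℝ :=
  lam ^ (1 / (p - 1)) * soliton p (Real.sqrt lam * x)

/-- A smooth cut-off function of the variable `x ≥ 0`, supported in `[0, δ]` and equal to `1` on
`[0, δ / 2]`. -/
def IsCutoff (δ : ℝ) (χ : ℝ → ℝ) : Prop :=
  ContDiff ℝ ∞ χ ∧ (∀ x, 0 ≤ x → x ≤ δ / 2 → χ x = 1) ∧ ∀ x, δ ≤ x → χ x = 0

namespace MetricGraph

variable {V E : Type*}

/-- The degree of a vertex: the number of edge ends at `v` (a loop counts twice). -/
def degree (G : MetricGraph V E) (v : V) : ℕ :=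
  Nat.card {e : E // G.src e = v} + Nat.card {e : E // G.tgt e = v}

/-- The graph is connected. -/
def Connected (G : MetricGraph V E) : Prop :=
  (SimpleGraph.fromRel fun v w : V => ∃ e, G.src e = v ∧ G.tgt e = w).Connected

/-! A function on the graph is a family `u = (u_e)` with `u e : ℝ → ℝ`, of which only the values
on `[0, len e]` matter. -/

/-- `u ∈ C⁰(G)`: continuous on every edge, with a well defined value at every vertex. -/
def IsContinuous (G : MetricGraph V E) (u : E → ℝ → ℝ) : Prop :=
  (∀ e, ContinuousOn (u e) (Icc 0 (G.len e))) ∧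
    ∃ c : V → ℝ, ∀ e, u e 0 = c (G.src e) ∧ u e (G.len e) = c (G.tgt e)

/-- `u ∈ H¹(G)`. -/
def MemH1 (G : MetricGraph V E) (u : E → ℝ → ℝ) : Prop :=
  G.IsContinuous u ∧ ∀ e, MemH1Interval (G.len e) (u e)

/-- The norm of `L²(G)`. -/
def l2Norm [Fintype E] (G : MetricGraph V E) (u : E → ℝ → ℝ) : ℝ :=
  Real.sqrt (∑ e, ∫ x in (0 : ℝ)..G.len e, u e x ^ 2)

/-- The scalar product `⟨u, v⟩_λ = ∫ u' v' + λ ∫ u v` of `H¹(G)`. -/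
def innerLam [Fintype E] (G : MetricGraph V E) (lam : ℝ) (u v : E → ℝ → ℝ) : ℝ :=
  (∑ e, ∫ x in (0 : ℝ)..G.len e, weakDeriv (G.len e) (u e) x * weakDeriv (G.len e) (v e) x) +
    lam * ∑ e, ∫ x in (0 : ℝ)..G.len e, u e x * v e x

/-- The norm `‖u‖_λ` of `H¹(G)`. -/
def normLam [Fintype E] (G : MetricGraph V E) (lam : ℝ) (u : E → ℝ → ℝ) : ℝ :=
  Real.sqrt (G.innerLam lam u u)

/-- The Kirchhoff condition at `v`: the derivatives in the directions leaving `v` add up to `0`. -/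
def Kirchhoff [Fintype E] [DecidableEq V] (G : MetricGraph V E) (u : E → ℝ → ℝ) (v : V) : Prop :=
  ∑ e, ((if G.src e = v then derivWithin (u e) (Icc 0 (G.len e)) 0 else 0) +
    (if G.tgt e = v then -derivWithin (u e) (Icc 0 (G.len e)) (G.len e) else 0)) = 0

/-- `u` is a positive (classical, `C²` up to the ends of every edge) solution in `H¹(G)` of
`-u'' + λ u = |u| ^ (p - 1) u` with Kirchhoff conditions and with `|u|_{L²(G)} = ρ`. -/
structure IsPositiveSolution [Fintype E] [DecidableEq V] (G : MetricGraph V E) (p lam ρ : ℝ)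
    (u : E → ℝ → ℝ) : Prop where
  memH1 : G.MemH1 u
  contDiffOn : ∀ e, ContDiffOn ℝ 2 (u e) (Icc 0 (G.len e))
  equation : ∀ e, ∀ x ∈ Ioo 0 (G.len e),
    -deriv (deriv (u e)) x + lam * u e x = |u e x| ^ (p - 1) * u e x
  kirchhoff : ∀ v, G.Kirchhoff u v
  mass : G.l2Norm u = ρ
  pos : ∀ e, ∀ x ∈ Icc 0 (G.len e), 0 < u e x

/-- For a vertex `v` of degree one, the function `χ U_λ` on the graph: it is
`χ(t) λ ^ (1 / (p - 1)) U(√λ t)` on the terminal edge ending at `v`, where `t` is the distance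
from `v` along this edge, and `0` on every other edge. -/
def peak [DecidableEq V] (G : MetricGraph V E) (p lam : ℝ) (χ : ℝ → ℝ) (v : V) : E → ℝ → ℝ :=
  fun e x =>
    (if G.src e = v then χ x * scaledSoliton p lam x else 0) +
    (if G.tgt e = v then χ (G.len e - x) * scaledSoliton p lam (G.len e - x) else 0)

end MetricGraph

end

/-! Rescaling by `√λ` turns the equation into `-w'' + w = |w| ^ (p - 1) w` on long intervals. Each
edge is cut at its midpoint into two half-edges, each with the distance from its vertex as
coordinate, of rescaled length `M s ≥ m`, where `m` grows like `√λ`. The first guess is the soliton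
`U` on the half-edge at each `v i` and `0` on all the others. It satisfies the equation and all
vertex conditions (`U'(0) = 0` is the Kirchhoff condition at a vertex of degree one), and fails only
at the midpoints, by `O(e ^ (-m))`.

Write `w = U + φ`. Then `-φ'' + (1 - p U ^ (p - 1)) φ = h`, where `h` is the Taylor remainder of the
nonlinearity. Variation of parameters solves this explicitly from a decaying solution `f` and a
growing solution `g` of the linearised equation (`Profile`). What is left is one coefficient of `f`
at the vertex, fixed by the vertex conditions, and one coefficient of `g` at the midpoint, fixed by
`C¹` matching with the other half of the edge. Each influences the other end only through a factor
`e ^ (-m)`, so the two problems almost decouple (`HalfEdges.next_le`). They are solvable because the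
soliton is nondegenerate on the half-line with Neumann condition: the translation mode `f ∼ U'` has
`f'(0) ≠ 0`, while the solution `g` with `g'(0) = 0` grows, together with `g'`, like `e ^ x` with a
positive factor (`exists_solitonProfile_isBdd`). This positivity also bounds the midpoint
determinant below (`HalfEdges.midDet_ge`). Since the remainder has a small Lipschitz constant near
`0`, the two coefficients and `φ` are the fixed point of a contraction, of size `O(e ^ (-m))`
(`HalfEdges.exists_solution`).

Undoing the scaling and gluing the halves gives the solution on the graph. It is larger than `-λ ^
(1 / (p - 1))`, which excludes a negative minimum; ODE uniqueness and connectedness then exclude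
zeros (`MetricGraph.pos_of_solution`). Cutting off the soliton also costs only an exponentially
small error, so `φ_λ` is `O(e ^ (-d √λ))` up to powers of `λ`. The mass is `λ ^ (2 / (p - 1) - 1 /
2)` times a rescaled mass that converges to `k ∫ U²` (`MetricGraph.tendsto_mass`). -/

noncomputable section

/-! ### The nonlinearity and its Taylor remainder. -/

/-- The nonlinearity `y ↦ |y| ^ (p - 1) y`. -/
def powNL (p y : ℝ) : ℝ := |y| ^ (p - 1) * y

/-- Homogeneity of degree `p`; it lets the amplitude `λ ^ (1 / (p - 1))` absorb the factor `λ` when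
the scaling is undone. -/
lemma powNL_mul {p s : ℝ} (hs : 0 ≤ s) (y : ℝ) :
    powNL p (s * y) = s ^ (p - 1) * s * powNL p y := by
  unfold powNL
  rw [abs_mul, abs_of_nonneg hs, Real.mul_rpow hs (abs_nonneg y)]
  ring

/-- At `0` the slope is `|z| ^ (p - 1)`, which tends to `0` because `p > 1`; elsewhere this is the
usual power rule. -/
lemma hasDerivAt_powNL {p : ℝ} (hp : 1 < p) (y : ℝ) :
    HasDerivAt (powNL p) (p * |y| ^ (p - 1)) y := by
  rcases lt_trichotomy y 0 with h | h | h
  · have h1 : HasDerivAt (fun z : ℝ => -((-z) ^ p)) (p * |y| ^ (p - 1)) y := by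
      have := ((hasDerivAt_id y).neg.rpow_const (p := p) (Or.inl (by simpa using h.ne))).neg
      refine this.congr_deriv ?_
      simp [abs_of_neg h]
    refine h1.congr_of_eventuallyEq ?_
    filter_upwards [Iio_mem_nhds h] with z hz
    have hz' : 0 < -z := by simpa using hz
    have hz0 : z ≠ 0 := (show z < 0 from hz).ne
    unfold powNL
    rw [abs_of_neg hz, Real.rpow_sub_one hz'.ne']
    field_simp
  · subst h
    rw [abs_zero, Real.zero_rpow (by linarith), mul_zero, hasDerivAt_iff_tendsto_slope]
    have h1 : Tendsto (fun z : ℝ => |z| ^ (p - 1)) (nhdsWithin 0 {0}ᶜ) (nhds 0) := by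
      have : ContinuousAt (fun z : ℝ => |z| ^ (p - 1)) 0 :=
        continuous_abs.continuousAt.rpow_const (Or.inr (by linarith))
      have h2 := this.tendsto.mono_left (nhdsWithin_le_nhds (s := {0}ᶜ))
      simpa [Real.zero_rpow (show p - 1 ≠ 0 by linarith)] using h2
    refine h1.congr' ?_
    filter_upwards [self_mem_nhdsWithin] with z hz
    have : z ≠ 0 := hz
    simp [slope_def_field, powNL, this]
  · have h1 : HasDerivAt (fun z : ℝ => z ^ p) (p * |y| ^ (p - 1)) y := by
      have := Real.hasDerivAt_rpow_const (x := y) (p := p) (Or.inl h.ne')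
      simpa [abs_of_pos h] using this
    refine h1.congr_of_eventuallyEq ?_
    filter_upwards [Ioi_mem_nhds h] with z hz
    have hz' : 0 < z := hz
    unfold powNL
    rw [abs_of_pos hz', Real.rpow_sub_one hz'.ne']
    field_simp

lemma continuous_powNL {p : ℝ} (hp : 1 < p) : Continuous (powNL p) :=
  continuous_iff_continuousAt.2 fun y => (hasDerivAt_powNL hp y).continuousAt

/-- The remainder of the first order Taylor expansion of `powNL p` at `c`. -/
def taylorRem (p c y : ℝ) : ℝ := powNL p (c + y) - powNL p c - p * |c| ^ (p - 1) * y

lemma taylorRem_zero (p c : ℝ) : taylorRem p c 0 = 0 := by simp [taylorRem]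

/-- The Taylor remainder is Lipschitz near `0` with a small constant. -/
lemma exists_taylorRem_lipschitz {p : ℝ} (hp : 1 < p) (K : ℝ) {η : ℝ} (hη : 0 < η) :
    ∃ r : ℝ, 0 < r ∧ r < 1 ∧ ∀ c y z : ℝ, |c| ≤ K → |y| ≤ r → |z| ≤ r →
      |taylorRem p c y - taylorRem p c z| ≤ η * |y - z| := by
  -- The derivative of the remainder at `y` is `p |c + y| ^ (p - 1) - p |c| ^ (p - 1)`. Uniform
  -- continuity on a compact interval makes it small, which also covers `p < 2`, where there is no
  -- second derivative at `0`.
  have hcont : Continuous (fun y : ℝ => p * |y| ^ (p - 1)) :=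
    continuous_const.mul (continuous_abs.rpow_const fun _ => Or.inr (by linarith))
  have huc := (isCompact_Icc (a := -(K + 1)) (b := K + 1)).uniformContinuousOn_of_continuous
    hcont.continuousOn
  rw [Metric.uniformContinuousOn_iff] at huc
  obtain ⟨d, hd, H⟩ := huc η hη
  refine ⟨min (d / 2) (1 / 2), by positivity, by
    have := min_le_right (d / 2) (1 / 2 : ℝ); linarith, fun c y z hc hy hz => ?_⟩
  set r := min (d / 2) (1 / 2) with hr
  have hr1 : r ≤ d / 2 := min_le_left _ _
  have hr2 : r ≤ 1 / 2 := min_le_right _ _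
  have hder : ∀ x ∈ Icc (-r) r, HasDerivWithinAt (taylorRem p c)
      (p * |c + x| ^ (p - 1) - p * |c| ^ (p - 1)) (Icc (-r) r) x := fun x _ => by
    have h1 : HasDerivAt (fun x => powNL p (c + x)) (p * |c + x| ^ (p - 1)) x := by
      simpa using (hasDerivAt_powNL hp (c + x)).comp_const_add c x
    have h2 := (h1.sub_const (powNL p c)).sub ((hasDerivAt_id x).const_mul (p * |c| ^ (p - 1)))
    exact (h2.congr_deriv (by simp)).hasDerivWithinAt
  have := (convex_Icc (-r) r).norm_image_sub_le_of_norm_hasDerivWithin_le (C := η) hder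
    (fun x hx => ?_) (abs_le.1 hz) (abs_le.1 hy)
  · simpa [Real.norm_eq_abs] using this
  · have hx' := abs_le.2 hx
    have := H (c + x) (abs_le.1 ((abs_add_le c x).trans (by linarith))) c
      (abs_le.1 (hc.trans (by linarith))) (by
        rw [Real.dist_eq]; simp only [add_sub_cancel_left]; linarith)
    rw [Real.dist_eq] at this
    exact this.le

/-! ### Profiles and fundamental systems of the linearised equation. -/

/-- A solution `U` of `-U'' + U = |U| ^ (p - 1) U` together with a normalised fundamental system
`f`, `g` of the equation linearised at `U`. -/
structure Profile (p : ℝ) where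
  U : ℝ → ℝ
  dU : ℝ → ℝ
  f : ℝ → ℝ
  df : ℝ → ℝ
  g : ℝ → ℝ
  dg : ℝ → ℝ
  hU : ∀ x, HasDerivAt U (dU x) x
  hdU : ∀ x, HasDerivAt dU (U x - powNL p (U x)) x
  hf : ∀ x, HasDerivAt f (df x) x
  hdf : ∀ x, HasDerivAt df ((1 - p * |U x| ^ (p - 1)) * f x) x
  hg : ∀ x, HasDerivAt g (dg x) x
  hdg : ∀ x, HasDerivAt dg ((1 - p * |U x| ^ (p - 1)) * g x) x
  wronskian : ∀ x, f x * dg x - df x * g x = 1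

/-- Bounds for a profile in terms of a single constant. -/
structure Profile.IsBdd {p : ℝ} (P : Profile p) (C : ℝ) : Prop where
  one_le : 1 ≤ C
  U_nonneg : ∀ x, 0 ≤ P.U x
  U_le : ∀ x, P.U x ≤ C
  U_exp : ∀ x, 0 ≤ x → |P.U x| ≤ C * Real.exp (-x)
  dU_exp : ∀ x, 0 ≤ x → |P.dU x| ≤ C * Real.exp (-x)
  f_exp : ∀ x, 0 ≤ x → |P.f x| ≤ C * Real.exp (-x)
  df_exp : ∀ x, 0 ≤ x → |P.df x| ≤ C * Real.exp (-x)
  g_exp : ∀ x, 0 ≤ x → |P.g x| ≤ C * Real.exp x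
  dg_exp : ∀ x, 0 ≤ x → |P.dg x| ≤ C * Real.exp x
  g_lower : ∀ x, C ≤ x → Real.exp x ≤ C * P.g x
  dg_lower : ∀ x, C ≤ x → Real.exp x ≤ C * P.dg x

lemma Profile.IsBdd.mono {p : ℝ} {P : Profile p} {C D : ℝ} (h : P.IsBdd C) (hCD : C ≤ D) :
    P.IsBdd D where
  one_le := h.one_le.trans hCD
  U_nonneg := h.U_nonneg
  U_le x := (h.U_le x).trans hCD
  U_exp x hx := (h.U_exp x hx).trans (by gcongr)
  dU_exp x hx := (h.dU_exp x hx).trans (by gcongr)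
  f_exp x hx := (h.f_exp x hx).trans (by gcongr)
  df_exp x hx := (h.df_exp x hx).trans (by gcongr)
  g_exp x hx := (h.g_exp x hx).trans (by gcongr)
  dg_exp x hx := (h.dg_exp x hx).trans (by gcongr)
  g_lower x hx := by
    have h1 := h.g_lower x (hCD.trans hx)
    have h2 := h.one_le
    have h3 : 0 < P.g x := by
      have := Real.exp_pos x
      by_contra hn
      nlinarith
    nlinarith
  dg_lower x hx := by
    have h1 := h.dg_lower x (hCD.trans hx)
    have h2 := h.one_le
    have h3 : 0 < P.dg x := by
      have := Real.exp_pos x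
      by_contra hn
      nlinarith
    nlinarith

/-- The trivial profile `U = 0`. -/
def zeroProfile {p : ℝ} (hp : 1 < p) : Profile p where
  U := 0
  dU := 0
  f x := Real.exp (-x)
  df x := -Real.exp (-x)
  g x := Real.exp x / 2
  dg x := Real.exp x / 2
  hU x := hasDerivAt_const x 0
  hdU x := (hasDerivAt_const x (0 : ℝ)).congr_deriv (by simp [powNL])
  hf x := by simpa using (hasDerivAt_neg x).exp
  hdf x := by
    simpa [Real.zero_rpow (show p - 1 ≠ 0 by linarith)] using (hasDerivAt_neg x).exp.fun_neg
  hg x := (Real.hasDerivAt_exp x).div_const 2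
  hdg x := by
    simpa [Real.zero_rpow (show p - 1 ≠ 0 by linarith)] using (Real.hasDerivAt_exp x).div_const 2
  wronskian x := by
    have : Real.exp (-x) * Real.exp x = 1 := by rw [← Real.exp_add]; simp
    linear_combination this

lemma zeroProfile_isBdd {p : ℝ} (hp : 1 < p) : (zeroProfile hp).IsBdd 2 where
  one_le := by norm_num
  U_nonneg x := le_rfl
  U_le x := by simp [zeroProfile]
  U_exp x hx := by simp [zeroProfile, Real.exp_nonneg]
  dU_exp x hx := by simp [zeroProfile, Real.exp_nonneg]
  f_exp x hx := by simp [zeroProfile]; linarith [Real.exp_pos (-x)]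
  df_exp x hx := by simp [zeroProfile]; linarith [Real.exp_pos (-x)]
  g_exp x hx := by
    simp only [zeroProfile, abs_of_pos (half_pos (Real.exp_pos x))]; linarith [Real.exp_pos x]
  dg_exp x hx := by
    simp only [zeroProfile, abs_of_pos (half_pos (Real.exp_pos x))]; linarith [Real.exp_pos x]
  g_lower x hx := by simp only [zeroProfile]; linarith [Real.exp_pos x]
  dg_lower x hx := by simp only [zeroProfile]; linarith [Real.exp_pos x]

/-! ### The soliton and the growth of its linearised solutions. -/

/-- `cosh (a x) ^ (-1 / a)` with `a = (p - 1) / 2`, a multiple of the soliton. -/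
def coshPow (p x : ℝ) : ℝ := Real.cosh ((p - 1) / 2 * x) ^ (-(2 / (p - 1)))

/-- `∫₀ˣ coshPow p ^ (-2)`. -/
def coshPowInt (p x : ℝ) : ℝ := ∫ y in (0 : ℝ)..x, (coshPow p y ^ 2)⁻¹

/-- `tanh (a x)` with `a = (p - 1) / 2`. -/
def tanhScaled (p x : ℝ) : ℝ := Real.tanh ((p - 1) / 2 * x)

lemma coshPow_pos (p x : ℝ) : 0 < coshPow p x := Real.rpow_pos_of_pos (Real.cosh_pos _) _

lemma coshPow_zero (p : ℝ) : coshPow p 0 = 1 := by simp [coshPow]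

lemma soliton_eq (p x : ℝ) : soliton p x = ((p + 1) / 2) ^ (1 / (p - 1)) * coshPow p x := rfl

lemma tanhScaled_zero (p : ℝ) : tanhScaled p 0 = 0 := by simp [tanhScaled]

lemma one_sub_tanhScaled_sq (p x : ℝ) :
    1 - tanhScaled p x ^ 2 = (Real.cosh ((p - 1) / 2 * x) ^ 2)⁻¹ := by
  have h := Real.cosh_pos ((p - 1) / 2 * x)
  rw [tanhScaled, Real.tanh_eq_sinh_div_cosh]
  generalize (p - 1) / 2 * x = z at *
  field_simp
  linarith [Real.cosh_sq z]

lemma tanhScaled_lt_one (p x : ℝ) : tanhScaled p x < 1 := Real.tanh_lt_one _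

lemma abs_tanhScaled_le_one (p x : ℝ) : |tanhScaled p x| ≤ 1 :=
  abs_le.2 ⟨(Real.neg_one_lt_tanh _).le, (Real.tanh_lt_one _).le⟩

lemma hasDerivAt_tanhScaled (p x : ℝ) :
    HasDerivAt (tanhScaled p) ((p - 1) / 2 * (1 - tanhScaled p x ^ 2)) x := by
  have h := Real.cosh_pos ((p - 1) / 2 * x)
  have h0 : HasDerivAt (fun x : ℝ => (p - 1) / 2 * x) ((p - 1) / 2) x := by
    simpa using (hasDerivAt_id x).const_mul ((p - 1) / 2)
  have h1 := (h0.sinh).div h0.cosh h.ne'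
  have h2 : (fun x : ℝ => Real.sinh ((p - 1) / 2 * x)) / (fun x => Real.cosh ((p - 1) / 2 * x))
      = tanhScaled p := by
    ext y
    simp [tanhScaled, Real.tanh_eq_sinh_div_cosh]
  rw [h2] at h1
  refine h1.congr_deriv ?_
  rw [one_sub_tanhScaled_sq, div_eq_mul_inv]
  congr 1
  linear_combination (p - 1) / 2 * Real.cosh_sq ((p - 1) / 2 * x)

/-- With `t = tanhScaled` and `σ = coshPow`, the rules `t' = a (1 - t²)` and `σ' = -t σ` reduce
every later differential identity for the soliton to algebra in `t` and `σ`. -/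
lemma hasDerivAt_coshPow {p : ℝ} (hp : 1 < p) (x : ℝ) :
    HasDerivAt (coshPow p) (-(tanhScaled p x * coshPow p x)) x := by
  have h := Real.cosh_pos ((p - 1) / 2 * x)
  have h0 : HasDerivAt (fun x : ℝ => (p - 1) / 2 * x) ((p - 1) / 2) x := by
    simpa using (hasDerivAt_id x).const_mul ((p - 1) / 2)
  have h1 := h0.cosh.rpow_const (p := -(2 / (p - 1))) (Or.inl h.ne')
  refine h1.congr_deriv ?_
  rw [Real.rpow_sub_one h.ne', tanhScaled, Real.tanh_eq_sinh_div_cosh, coshPow]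
  have : p - 1 ≠ 0 := by linarith
  field_simp

lemma continuous_coshPow {p : ℝ} (hp : 1 < p) : Continuous (coshPow p) :=
  continuous_iff_continuousAt.2 fun x => (hasDerivAt_coshPow hp x).continuousAt

lemma hasDerivAt_coshPowInt {p : ℝ} (hp : 1 < p) (x : ℝ) :
    HasDerivAt (coshPowInt p) ((coshPow p x ^ 2)⁻¹) x := by
  have hc : Continuous fun y => (coshPow p y ^ 2)⁻¹ :=
    ((continuous_coshPow hp).pow 2).inv₀ fun y => (pow_pos (coshPow_pos p y) 2).ne'
  exact (hc.integral_hasStrictDerivAt 0 x).hasDerivAt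

lemma coshPow_le_one {p : ℝ} (hp : 1 < p) (x : ℝ) : coshPow p x ≤ 1 :=
  Real.rpow_le_one_of_one_le_of_nonpos (Real.one_le_cosh _)
    (neg_nonpos.2 (div_nonneg zero_le_two (by linarith)))

lemma exp_neg_le_coshPow {p x : ℝ} (hp : 1 < p) (hx : 0 ≤ x) : Real.exp (-x) ≤ coshPow p x := by
  have hp' : 0 < p - 1 := by linarith
  have h1 : Real.cosh ((p - 1) / 2 * x) ≤ Real.exp ((p - 1) / 2 * x) := by
    rw [Real.cosh_eq]
    have : Real.exp (-((p - 1) / 2 * x)) ≤ Real.exp ((p - 1) / 2 * x) :=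
      Real.exp_le_exp.2 (by have : 0 ≤ (p - 1) / 2 * x := by positivity
                            linarith)
    linarith
  have h2 := Real.rpow_le_rpow_of_nonpos (Real.cosh_pos _) h1
    (neg_nonpos.2 (div_nonneg zero_le_two hp'.le))
  refine le_trans (le_of_eq ?_) h2
  rw [← Real.exp_mul]
  congr 1
  field_simp

lemma coshPow_le_exp_neg {p : ℝ} (hp : 1 < p) (x : ℝ) :
    coshPow p x ≤ 2 ^ (2 / (p - 1)) * Real.exp (-x) := by
  have hp' : 0 < p - 1 := by linarith
  have h1 : Real.exp ((p - 1) / 2 * x) / 2 ≤ Real.cosh ((p - 1) / 2 * x) := by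
    rw [Real.cosh_eq]
    have := Real.exp_pos (-((p - 1) / 2 * x))
    linarith
  have h2 := Real.rpow_le_rpow_of_nonpos (by positivity) h1
    (neg_nonpos.2 (div_nonneg zero_le_two hp'.le))
  refine h2.trans (le_of_eq ?_)
  rw [Real.div_rpow (Real.exp_nonneg _) zero_le_two, Real.rpow_neg zero_le_two, div_inv_eq_mul,
    ← Real.exp_mul, mul_comm]
  congr 2
  field_simp

lemma coshPowInt_nonneg {p x : ℝ} (hx : 0 ≤ x) : 0 ≤ coshPowInt p x :=
  intervalIntegral.integral_nonneg hx fun y _ => by positivity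

/-- The integrand is at most `e ^ (2 y)`, since `σ ≥ e ^ (-y)`; comparing derivatives gives the
bound. -/
lemma coshPowInt_le {p x : ℝ} (hp : 1 < p) (hx : 0 ≤ x) :
    coshPowInt p x ≤ Real.exp x * Real.exp x := by
  have hd : ∀ y, HasDerivAt (fun y => Real.exp y * Real.exp y - coshPowInt p y)
      (Real.exp y * Real.exp y + Real.exp y * Real.exp y - (coshPow p y ^ 2)⁻¹) y := fun y =>
    ((Real.hasDerivAt_exp y).mul (Real.hasDerivAt_exp y)).sub (hasDerivAt_coshPowInt hp y)
  have hm : MonotoneOn (fun y => Real.exp y * Real.exp y - coshPowInt p y) (Ici 0) := by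
    refine monotoneOn_of_hasDerivWithinAt_nonneg (convex_Ici 0)
      (fun y _ => (hd y).continuousAt.continuousWithinAt) (fun y _ => (hd y).hasDerivWithinAt)
      fun y hy => ?_
    have hy' : 0 ≤ y := interior_subset hy
    have h1 := exp_neg_le_coshPow hp hy'
    have h2 : (coshPow p y ^ 2)⁻¹ ≤ Real.exp y * Real.exp y := by
      have : Real.exp y * Real.exp y = (Real.exp (-y) ^ 2)⁻¹ := by
        rw [Real.exp_neg, inv_pow, inv_inv, sq]
      rw [this]
      exact inv_anti₀ (by positivity) (by gcongr)
    have := Real.exp_pos y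
    nlinarith
  have := hm (mem_Ici.2 le_rfl) (mem_Ici.2 hx) hx
  simp [coshPowInt] at this
  simp only [coshPowInt]
  linarith

lemma tendsto_tanhScaled {p : ℝ} (hp : 1 < p) :
    Tendsto (tanhScaled p) atTop (nhds 1) := by
  have hp' : 0 < (p - 1) / 2 := by linarith
  have h1 : Tendsto (fun x : ℝ => Real.exp (-(2 * ((p - 1) / 2 * x)))) atTop (nhds 0) :=
    Real.tendsto_exp_neg_atTop_nhds_zero.comp
      ((tendsto_id.const_mul_atTop hp').const_mul_atTop two_pos)
  have h2 : Tendsto (fun x : ℝ => (1 - Real.exp (-(2 * ((p - 1) / 2 * x)))) /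
      (1 + Real.exp (-(2 * ((p - 1) / 2 * x))))) atTop (nhds ((1 - 0) / (1 + 0))) :=
    (h1.const_sub 1).div (h1.const_add 1) (by norm_num)
  norm_num at h2
  refine h2.congr fun x => ?_
  rw [tanhScaled, Real.tanh_eq_sinh_div_cosh, Real.sinh_eq, Real.cosh_eq]
  set z := (p - 1) / 2 * x
  have e1 : Real.exp (-(2 * z)) = Real.exp (-z) * Real.exp (-z) := by
    rw [← Real.exp_add]; ring_nf
  have e2 : Real.exp z * Real.exp (-z) = 1 := by rw [← Real.exp_add]; simp
  rw [e1]
  have := Real.exp_pos z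
  have := Real.exp_pos (-z)
  rw [div_eq_div_iff (by positivity) (by positivity)]
  linear_combination (-(Real.exp (-z))) * e2

lemma tendsto_coshPow {p : ℝ} (hp : 1 < p) : Tendsto (coshPow p) atTop (nhds 0) := by
  refine squeeze_zero (fun x => (coshPow_pos p x).le) (coshPow_le_exp_neg hp) ?_
  simpa using Real.tendsto_exp_neg_atTop_nhds_zero.const_mul ((2 : ℝ) ^ (2 / (p - 1)))

lemma hasDerivAt_inv_coshPow_sq {p : ℝ} (hp : 1 < p) (x : ℝ) :
    HasDerivAt (fun x => (coshPow p x ^ 2)⁻¹) (2 * tanhScaled p x * (coshPow p x ^ 2)⁻¹) x := by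
  have h := coshPow_pos p x
  refine (((hasDerivAt_coshPow hp x).fun_pow 2).fun_inv (by positivity)).congr_deriv ?_
  field_simp
  simp
  ring

/-- An l'Hôpital argument: `σ⁻²` has derivative `2 t σ⁻²` with `t → 1`, so its integral is
asymptotic to `σ⁻² / 2`. The lower bound uses `t < 1`, the upper one `(1 / 2 + ε) 2 t > 1` for large
`x`. -/
lemma tendsto_coshPow_sq_mul_int {p : ℝ} (hp : 1 < p) :
    Tendsto (fun x => coshPow p x ^ 2 * coshPowInt p x) atTop (nhds (1 / 2)) := by
  have hσ : Tendsto (fun x => coshPow p x ^ 2) atTop (nhds 0) := by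
    simpa using (tendsto_coshPow hp).pow 2
  have hS : ∀ x, coshPow p x ^ 2 * (coshPow p x ^ 2)⁻¹ = 1 := fun x =>
    mul_inv_cancel₀ (pow_pos (coshPow_pos p x) 2).ne'
  have hd : ∀ θ y, HasDerivAt (fun y => θ * (coshPow p y ^ 2)⁻¹ - coshPowInt p y)
      (θ * (2 * tanhScaled p y * (coshPow p y ^ 2)⁻¹) - (coshPow p y ^ 2)⁻¹) y := fun θ y =>
    ((hasDerivAt_inv_coshPow_sq hp y).const_mul θ).sub (hasDerivAt_coshPowInt hp y)
  rw [tendsto_order]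
  constructor
  · intro c hc
    have hanti : Antitone (fun y => 1 / 2 * (coshPow p y ^ 2)⁻¹ - coshPowInt p y) := by
      refine antitone_of_hasDerivAt_nonpos (fun y => hd (1 / 2) y) fun y => ?_
      have h1 := tanhScaled_lt_one p y
      have h2 : 0 < (coshPow p y ^ 2)⁻¹ := by have := coshPow_pos p y; positivity
      simp only [Pi.zero_apply]
      nlinarith
    filter_upwards [hσ.eventually (gt_mem_nhds (show (0 : ℝ) < 1 - 2 * c by linarith)),
      eventually_ge_atTop 0] with x hx hx0
    have h3 := hanti hx0
    simp [coshPowInt, coshPow_zero] at h3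
    simp only [coshPowInt] at *
    have h4 := hS x
    have h5 := pow_pos (coshPow_pos p x) 2
    nlinarith
  · intro c hc
    set ε := (c - 1 / 2) / 2 with hε
    have hε0 : 0 < ε := by rw [hε]; linarith
    have ht : Tendsto (fun x => (1 / 2 + ε) * (2 * tanhScaled p x)) atTop
        (nhds ((1 / 2 + ε) * (2 * 1))) := ((tendsto_tanhScaled hp).const_mul 2).const_mul _
    obtain ⟨x₀, hx₀⟩ := eventually_atTop.1
      (ht.eventually (lt_mem_nhds (show (1 : ℝ) < (1 / 2 + ε) * (2 * 1) by linarith)))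
    have hmono : MonotoneOn (fun y => (1 / 2 + ε) * (coshPow p y ^ 2)⁻¹ - coshPowInt p y)
        (Ici x₀) := by
      refine monotoneOn_of_hasDerivWithinAt_nonneg (convex_Ici x₀)
        (fun y _ => (hd _ y).continuousAt.continuousWithinAt)
        (fun y _ => (hd _ y).hasDerivWithinAt) fun y hy => ?_
      have h1 := hx₀ y (interior_subset hy)
      have h2 : 0 < (coshPow p y ^ 2)⁻¹ := by have := coshPow_pos p y; positivity
      nlinarith
    set D := (1 / 2 + ε) * (coshPow p x₀ ^ 2)⁻¹ - coshPowInt p x₀ with hD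
    have hDσ : Tendsto (fun x => coshPow p x ^ 2 * D) atTop (nhds 0) := by
      simpa using hσ.mul_const D
    filter_upwards [hDσ.eventually (lt_mem_nhds (show (-ε : ℝ) < 0 by linarith)),
      eventually_ge_atTop x₀] with x hx hx0
    have h3 := hmono (mem_Ici.2 le_rfl) (mem_Ici.2 hx0) hx0
    have h4 := hS x
    have h5 := pow_pos (coshPow_pos p x) 2
    simp only at h3
    rw [← hD] at h3
    have h6 := mul_le_mul_of_nonneg_left h3 h5.le
    have : coshPow p x ^ 2 * ((1 / 2 + ε) * (coshPow p x ^ 2)⁻¹ - coshPowInt p x)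
      = 1 / 2 + ε - coshPow p x ^ 2 * coshPowInt p x := by linear_combination (1 / 2 + ε) * h4
    linarith

lemma coeff_rpow {p : ℝ} (hp : 1 < p) :
    (((p + 1) / 2) ^ (1 / (p - 1))) ^ (p - 1) = (p + 1) / 2 := by
  rw [← Real.rpow_mul (by linarith), one_div, inv_mul_cancel₀ (by linarith), Real.rpow_one]

lemma soliton_pos {p : ℝ} (hp : 1 < p) (x : ℝ) : 0 < soliton p x :=
  mul_pos (Real.rpow_pos_of_pos (by linarith) _) (coshPow_pos p x)

/-- The potential of the linearised equation is polynomial in `t`; this is what makes its solutions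
explicit. -/
lemma soliton_rpow {p : ℝ} (hp : 1 < p) (x : ℝ) :
    |soliton p x| ^ (p - 1) = (p + 1) / 2 * (1 - tanhScaled p x ^ 2) := by
  have hc := Real.cosh_pos ((p - 1) / 2 * x)
  rw [abs_of_pos (soliton_pos hp x), soliton_eq,
    Real.mul_rpow (Real.rpow_nonneg (by linarith) _) (coshPow_pos p x).le, coeff_rpow hp, coshPow,
    ← Real.rpow_mul hc.le, one_sub_tanhScaled_sq]
  congr 1
  rw [show -(2 / (p - 1)) * (p - 1) = -((2 : ℕ) : ℝ) by
    have : p - 1 ≠ 0 := by linarith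
    push_cast; field_simp, Real.rpow_neg hc.le, Real.rpow_natCast]

/-- The profile given by the soliton. -/
def solitonProfile {p : ℝ} (hp : 1 < p) : Profile p where
  U := soliton p
  dU x := -(tanhScaled p x * soliton p x)
  -- A multiple of `U'`, hence a solution by translation invariance, scaled so that `f 0 = 0` and
  -- `df 0 = 1`.
  f x := 2 / (p - 1) * (tanhScaled p x * coshPow p x)
  df x := 2 / (p - 1) * (((p - 1) / 2 - (p + 1) / 2 * tanhScaled p x ^ 2) * coshPow p x)
  -- Reduction of order `f ∫ f⁻²`, integrated by parts to remove the singularity at the zero of `f`.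
  -- The result has `g 0 = -1` and `dg 0 = 0`.
  g x := (p + 3) / 2 * (tanhScaled p x * coshPow p x * coshPowInt p x) - (coshPow p x)⁻¹
  dg x := (p + 3) / 2 * (((p - 1) / 2 - (p + 1) / 2 * tanhScaled p x ^ 2) * coshPow p x *
    coshPowInt p x) + (p + 1) / 2 * tanhScaled p x * (coshPow p x)⁻¹
  hU x := ((hasDerivAt_coshPow hp x).const_mul _).congr_deriv (by rw [soliton_eq]; ring)
  hdU x := by
    have h1 : HasDerivAt (soliton p) (-(tanhScaled p x * soliton p x)) x :=
      ((hasDerivAt_coshPow hp x).const_mul _).congr_deriv (by rw [soliton_eq]; ring)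
    refine (((hasDerivAt_tanhScaled p x).mul h1).neg).congr_deriv ?_
    rw [powNL, soliton_rpow hp]
    ring
  hf x := by
    refine (((hasDerivAt_tanhScaled p x).mul (hasDerivAt_coshPow hp x)).const_mul _).congr_deriv ?_
    ring
  hdf x := by
    refine ((((((hasDerivAt_tanhScaled p x).fun_pow 2).const_mul _).const_sub _).mul
      (hasDerivAt_coshPow hp x)).const_mul _).congr_deriv ?_
    rw [soliton_rpow hp]
    simp
    ring
  hg x := by
    have h := coshPow_pos p x
    refine (((((hasDerivAt_tanhScaled p x).mul (hasDerivAt_coshPow hp x)).mul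
      (hasDerivAt_coshPowInt hp x)).const_mul _).sub
      ((hasDerivAt_coshPow hp x).fun_inv h.ne')).congr_deriv ?_
    simp only [Pi.mul_apply]
    field_simp
    ring
  hdg x := by
    have h := coshPow_pos p x
    refine (((((((hasDerivAt_tanhScaled p x).fun_pow 2).const_mul _).const_sub _).mul
      (hasDerivAt_coshPow hp x)).mul (hasDerivAt_coshPowInt hp x)).const_mul _ |>.add
      (((hasDerivAt_tanhScaled p x).const_mul _).mul
      ((hasDerivAt_coshPow hp x).fun_inv h.ne'))).congr_deriv ?_
    rw [soliton_rpow hp]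
    simp only [Pi.mul_apply]
    field_simp
    simp
    ring
  wronskian x := by
    have h := coshPow_pos p x
    have : p - 1 ≠ 0 := by linarith
    field_simp
    ring

/-- The substance is in the two lower bounds, which express nondegeneracy. By
`tendsto_coshPow_sq_mul_int` both `σ g` and `σ g'` tend to `(p - 1) / 4 > 0`, and `σ` is comparable
to `e ^ (-x)`. -/
lemma exists_solitonProfile_isBdd {p : ℝ} (hp : 1 < p) : ∃ C, (solitonProfile hp).IsBdd C := by
  have hp' : 0 < p - 1 := by linarith
  set κ : ℝ := 2 ^ (2 / (p - 1)) with hκ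
  have hκ0 : 0 < κ := Real.rpow_pos_of_pos two_pos _
  set A : ℝ := ((p + 1) / 2) ^ (1 / (p - 1)) with hA
  have hA0 : 0 < A := Real.rpow_pos_of_pos (by linarith) _
  have hK := tendsto_coshPow_sq_mul_int hp
  have ht := tendsto_tanhScaled hp
  have hg : Tendsto (fun x => (p + 3) / 2 * (tanhScaled p x * (coshPow p x ^ 2 * coshPowInt p x))
      - 1) atTop (nhds ((p + 3) / 2 * (1 * (1 / 2)) - 1)) :=
    ((ht.mul hK).const_mul _).sub_const 1
  have hdg : Tendsto (fun x => (p + 3) / 2 * (((p - 1) / 2 - (p + 1) / 2 * tanhScaled p x ^ 2) *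
      (coshPow p x ^ 2 * coshPowInt p x)) + (p + 1) / 2 * tanhScaled p x) atTop
      (nhds ((p + 3) / 2 * (((p - 1) / 2 - (p + 1) / 2 * 1 ^ 2) * (1 / 2)) + (p + 1) / 2 * 1)) :=
    ((((((ht.pow 2).const_mul _).const_sub _).mul hK).const_mul _).add (ht.const_mul _))
  -- The threshold `(p - 1) / 8` is half of the common limit `(p - 1) / 4`.
  obtain ⟨x₁, hx₁⟩ := eventually_atTop.1 (hg.eventually (lt_mem_nhds
    (show (p - 1) / 8 < _ by linarith)))
  obtain ⟨x₂, hx₂⟩ := eventually_atTop.1 (hdg.eventually (lt_mem_nhds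
    (show (p - 1) / 8 < _ by linarith)))
  have hσinv : ∀ x, 0 ≤ x → (coshPow p x)⁻¹ ≤ Real.exp x := fun x hx => by
    rw [← inv_inv (Real.exp x), ← Real.exp_neg]
    exact inv_anti₀ (Real.exp_pos _) (exp_neg_le_coshPow hp hx)
  have hσJ : ∀ x, 0 ≤ x → coshPow p x * coshPowInt p x ≤ κ * Real.exp x := fun x hx => by
    calc coshPow p x * coshPowInt p x
        ≤ (κ * Real.exp (-x)) * (Real.exp x * Real.exp x) :=
          mul_le_mul (coshPow_le_exp_neg hp x) (coshPowInt_le hp hx) (coshPowInt_nonneg hx)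
            (by positivity)
      _ = κ * Real.exp x := by
          have : Real.exp (-x) * Real.exp x = 1 := by rw [← Real.exp_add]; simp
          linear_combination κ * Real.exp x * this
  have hq : ∀ x, |(p - 1) / 2 - (p + 1) / 2 * tanhScaled p x ^ 2| ≤ p := fun x => by
    have h1 : tanhScaled p x ^ 2 ≤ 1 := by
      have := one_sub_tanhScaled_sq p x
      have h2 : 0 ≤ (Real.cosh ((p - 1) / 2 * x) ^ 2)⁻¹ := by positivity
      linarith
    have h2 := sq_nonneg (tanhScaled p x)
    rw [abs_le]
    constructor <;> nlinarith
  have hAκ : ∀ x, soliton p x ≤ A * κ * Real.exp (-x) := fun x => by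
    rw [soliton_eq, mul_assoc]
    exact mul_le_mul_of_nonneg_left (coshPow_le_exp_neg hp x) hA0.le
  have htu : ∀ x y : ℝ, |tanhScaled p x * y| ≤ |y| := fun x y => by
    rw [abs_mul]
    exact mul_le_of_le_one_left (abs_nonneg y) (abs_tanhScaled_le_one p x)
  have hlow : ∀ x y : ℝ, (p - 1) / 8 < coshPow p x * y → Real.exp x ≤ 8 * κ / (p - 1) * y :=
    fun x y hy => by
      have h0 := coshPow_pos p x
      have hy0 : 0 < y := by
        by_contra hn
        have : 0 < (p - 1) / 8 := by positivity
        nlinarith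
      have h1 : (p - 1) / 8 < κ * Real.exp (-x) * y :=
        hy.trans_le (mul_le_mul_of_nonneg_right (coshPow_le_exp_neg hp x) hy0.le)
      have h2 : Real.exp (-x) * Real.exp x = 1 := by rw [← Real.exp_add]; simp
      have h3 := mul_lt_mul_of_pos_right h1 (Real.exp_pos x)
      have h4 : κ * Real.exp (-x) * y * Real.exp x = κ * y := by linear_combination κ * y * h2
      rw [h4] at h3
      rw [div_mul_eq_mul_div, le_div_iff₀ hp']
      linarith
  have hS : ∀ x, coshPow p x * (coshPow p x)⁻¹ = 1 := fun x =>
    mul_inv_cancel₀ (coshPow_pos p x).ne'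
  -- The sum of the constants needed for the separate bounds, so that each of them is dominated by
  -- it.
  refine ⟨1 + A + A * κ + 2 / (p - 1) * (p * κ) + ((p + 3) / 2 * (p * κ) + (p + 1) / 2)
    + |x₁| + |x₂| + 8 * κ / (p - 1), ?_⟩
  have k1 : 0 < A * κ := by positivity
  have k2 : 0 < 2 / (p - 1) * (p * κ) := by positivity
  have k3 : 0 < (p + 3) / 2 * (p * κ) := by positivity
  have k4 : 0 < 8 * κ / (p - 1) := by positivity
  have k5 := abs_nonneg x₁
  have k6 := abs_nonneg x₂
  refine
  { one_le := by linarith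
    U_nonneg := fun x => (soliton_pos hp x).le
    U_le := fun x => ?_
    U_exp := fun x hx => ?_
    dU_exp := fun x hx => ?_
    f_exp := fun x hx => ?_
    df_exp := fun x hx => ?_
    g_exp := fun x hx => ?_
    dg_exp := fun x hx => ?_
    g_lower := fun x hx => ?_
    dg_lower := fun x hx => ?_ }
  · have : soliton p x ≤ A := by
      rw [soliton_eq]
      exact mul_le_of_le_one_right hA0.le (coshPow_le_one hp x)
    show soliton p x ≤ _
    linarith
  · show |soliton p x| ≤ _
    rw [abs_of_pos (soliton_pos hp x)]
    refine (hAκ x).trans (mul_le_mul_of_nonneg_right ?_ (Real.exp_nonneg _))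
    linarith
  · show |-(tanhScaled p x * soliton p x)| ≤ _
    rw [abs_neg]
    refine (htu x _).trans ?_
    rw [abs_of_pos (soliton_pos hp x)]
    refine (hAκ x).trans (mul_le_mul_of_nonneg_right ?_ (Real.exp_nonneg _))
    linarith
  · show |2 / (p - 1) * (tanhScaled p x * coshPow p x)| ≤ _
    rw [abs_mul, abs_of_pos (show 0 < 2 / (p - 1) by positivity)]
    calc 2 / (p - 1) * |tanhScaled p x * coshPow p x| ≤ 2 / (p - 1) * (κ * Real.exp (-x)) := by
          refine mul_le_mul_of_nonneg_left ((htu x _).trans ?_) (by positivity)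
          rw [abs_of_pos (coshPow_pos p x)]
          exact coshPow_le_exp_neg hp x
      _ ≤ 2 / (p - 1) * (p * κ) * Real.exp (-x) := by
          rw [mul_assoc, mul_assoc]
          refine mul_le_mul_of_nonneg_left ?_ (by positivity)
          exact le_mul_of_one_le_left (by positivity) hp.le
      _ ≤ _ := mul_le_mul_of_nonneg_right (by linarith) (Real.exp_nonneg _)
  · show |2 / (p - 1) * (((p - 1) / 2 - (p + 1) / 2 * tanhScaled p x ^ 2) * coshPow p x)| ≤ _
    rw [abs_mul, abs_of_pos (show 0 < 2 / (p - 1) by positivity), abs_mul,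
      abs_of_pos (coshPow_pos p x)]
    calc _ ≤ 2 / (p - 1) * (p * (κ * Real.exp (-x))) :=
          mul_le_mul_of_nonneg_left (mul_le_mul (hq x) (coshPow_le_exp_neg hp x)
            (coshPow_pos p x).le (by linarith)) (by positivity)
      _ = 2 / (p - 1) * (p * κ) * Real.exp (-x) := by ring
      _ ≤ _ := mul_le_mul_of_nonneg_right (by linarith) (Real.exp_nonneg _)
  · show |(p + 3) / 2 * (tanhScaled p x * coshPow p x * coshPowInt p x) - (coshPow p x)⁻¹| ≤ _
    have h1 := (htu x _).trans_eq (abs_of_nonneg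
      (mul_nonneg (coshPow_pos p x).le (coshPowInt_nonneg (p := p) hx)))
    rw [← mul_assoc] at h1
    have h2 := h1.trans (hσJ x hx)
    have h3 := hσinv x hx
    calc _ ≤ |(p + 3) / 2 * (tanhScaled p x * coshPow p x * coshPowInt p x)| +
          |(coshPow p x)⁻¹| := abs_sub _ _
      _ ≤ (p + 3) / 2 * (κ * Real.exp x) + Real.exp x := by
          rw [abs_mul, abs_of_pos (show 0 < (p + 3) / 2 by linarith),
            abs_of_pos (inv_pos.2 (coshPow_pos p x))]
          gcongr
      _ ≤ ((p + 3) / 2 * (p * κ) + 1) * Real.exp x := by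
          have := Real.exp_pos x
          have h5 : κ ≤ p * κ := le_mul_of_one_le_left hκ0.le hp.le
          have h6 : (p + 3) / 2 * κ ≤ (p + 3) / 2 * (p * κ) := by gcongr
          nlinarith
      _ ≤ _ := mul_le_mul_of_nonneg_right (by linarith) (Real.exp_nonneg _)
  · show |(p + 3) / 2 * (((p - 1) / 2 - (p + 1) / 2 * tanhScaled p x ^ 2) * coshPow p x *
      coshPowInt p x) + (p + 1) / 2 * tanhScaled p x * (coshPow p x)⁻¹| ≤ _
    have h3 := hσinv x hx
    have h1 := mul_le_mul (hq x) (hσJ x hx)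
      (mul_nonneg (coshPow_pos p x).le (coshPowInt_nonneg (p := p) hx)) (by linarith)
    have h2 := (htu x (coshPow p x)⁻¹).trans_eq (abs_of_pos (inv_pos.2 (coshPow_pos p x)))
    calc _ ≤ (p + 3) / 2 * (|(p - 1) / 2 - (p + 1) / 2 * tanhScaled p x ^ 2| * (coshPow p x *
          coshPowInt p x)) + (p + 1) / 2 * |tanhScaled p x * (coshPow p x)⁻¹| := by
          refine (abs_add_le _ _).trans_eq ?_
          rw [mul_assoc, mul_assoc ((p + 1) / 2), abs_mul, abs_mul ((p + 1) / 2), abs_mul (_ - _),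
            abs_of_pos (show 0 < (p + 3) / 2 by linarith),
            abs_of_pos (show 0 < (p + 1) / 2 by linarith), abs_of_nonneg
            (mul_nonneg (coshPow_pos p x).le (coshPowInt_nonneg (p := p) hx))]
      _ ≤ (p + 3) / 2 * (p * (κ * Real.exp x)) + (p + 1) / 2 * Real.exp x := by
          have := h2.trans h3
          gcongr
      _ = ((p + 3) / 2 * (p * κ) + (p + 1) / 2) * Real.exp x := by ring
      _ ≤ _ := mul_le_mul_of_nonneg_right (by linarith) (Real.exp_nonneg _)
  · have h1 := hx₁ x (by linarith [le_abs_self x₁])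
    have h2 := hlow x ((solitonProfile hp).g x) (by
      refine h1.trans_eq ?_
      simp only [solitonProfile]
      linear_combination hS x)
    have h3 : 0 < (solitonProfile hp).g x := by
      have := Real.exp_pos x
      by_contra hn
      nlinarith
    refine h2.trans (mul_le_mul_of_nonneg_right ?_ h3.le)
    linarith
  · have h1 := hx₂ x (by linarith [le_abs_self x₂])
    have h2 := hlow x ((solitonProfile hp).dg x) (by
      refine h1.trans_eq ?_
      simp only [solitonProfile]
      linear_combination (-((p + 1) / 2 * tanhScaled p x)) * hS x)
    have h3 : 0 < (solitonProfile hp).dg x := by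
      have := Real.exp_pos x
      by_contra hn
      nlinarith
    refine h2.trans (mul_le_mul_of_nonneg_right ?_ h3.le)
    linarith

/-! ### Variation of parameters on a half-edge. -/

namespace Profile

variable {p : ℝ} (P : Profile p)

lemma continuous_U : Continuous P.U := continuous_iff_continuousAt.2 fun x => (P.hU x).continuousAt
lemma continuous_dU : Continuous P.dU :=
  continuous_iff_continuousAt.2 fun x => (P.hdU x).continuousAt
lemma continuous_f : Continuous P.f := continuous_iff_continuousAt.2 fun x => (P.hf x).continuousAt
lemma continuous_g : Continuous P.g := continuous_iff_continuousAt.2 fun x => (P.hg x).continuousAt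

/-- Variation of parameters: the solution of the inhomogeneous linearised equation with right-hand
side `h` and with coefficients `A`, `Q` at the origin. -/
def resp (A Q : ℝ) (h : ℝ → ℝ) (x : ℝ) : ℝ :=
  P.f x * (A + ∫ y in (0 : ℝ)..x, P.g y * h y) + P.g x * (Q - ∫ y in (0 : ℝ)..x, P.f y * h y)

/-- The derivative of `resp`. -/
def dresp (A Q : ℝ) (h : ℝ → ℝ) (x : ℝ) : ℝ :=
  P.df x * (A + ∫ y in (0 : ℝ)..x, P.g y * h y) + P.dg x * (Q - ∫ y in (0 : ℝ)..x, P.f y * h y)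

lemma hasDerivAt_resp (A Q : ℝ) {h : ℝ → ℝ} (hh : Continuous h) (x : ℝ) :
    HasDerivAt (P.resp A Q h) (P.dresp A Q h x) x := by
  have h1 := ((P.continuous_g.mul hh).integral_hasStrictDerivAt 0 x).hasDerivAt
  have h2 := ((P.continuous_f.mul hh).integral_hasStrictDerivAt 0 x).hasDerivAt
  refine (((P.hf x).mul (h1.const_add A)).add ((P.hg x).mul (h2.const_sub Q))).congr_deriv ?_
  simp only [dresp, Pi.mul_apply]
  ring

lemma hasDerivAt_dresp (A Q : ℝ) {h : ℝ → ℝ} (hh : Continuous h) (x : ℝ) :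
    HasDerivAt (P.dresp A Q h) ((1 - p * |P.U x| ^ (p - 1)) * P.resp A Q h x - h x) x := by
  have h1 := ((P.continuous_g.mul hh).integral_hasStrictDerivAt 0 x).hasDerivAt
  have h2 := ((P.continuous_f.mul hh).integral_hasStrictDerivAt 0 x).hasDerivAt
  refine (((P.hdf x).mul (h1.const_add A)).add ((P.hdg x).mul (h2.const_sub Q))).congr_deriv ?_
  simp only [resp, Pi.mul_apply]
  linear_combination (-h x) * P.wronskian x

lemma continuous_resp (A Q : ℝ) {h : ℝ → ℝ} (hh : Continuous h) : Continuous (P.resp A Q h) :=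
  continuous_iff_continuousAt.2 fun x => (P.hasDerivAt_resp A Q hh x).continuousAt

/-- Joint linearity in the coefficients and the source: it turns bounds into Lipschitz estimates. -/
lemma resp_sub (A A' Q Q' : ℝ) {h h' : ℝ → ℝ} (hh : Continuous h) (hh' : Continuous h') (x : ℝ) :
    P.resp (A - A') (Q - Q') (h - h') x = P.resp A Q h x - P.resp A' Q' h' x := by
  have e1 := intervalIntegral.integral_sub (μ := volume)
    ((P.continuous_g.mul hh).intervalIntegrable 0 x)
    ((P.continuous_g.mul hh').intervalIntegrable 0 x)
  have e2 := intervalIntegral.integral_sub (μ := volume)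
    ((P.continuous_f.mul hh).intervalIntegrable 0 x)
    ((P.continuous_f.mul hh').intervalIntegrable 0 x)
  simp only [Pi.mul_apply] at e1 e2
  simp only [resp, Pi.sub_apply, mul_sub, e1, e2]
  ring

variable {P} {C : ℝ}

lemma IsBdd.pos (hP : P.IsBdd C) : 0 < C := one_pos.trans_le hP.one_le

lemma IsBdd.abs_integral_g_le (hP : P.IsBdd C) {h : ℝ → ℝ} {x ν : ℝ} (hx : 0 ≤ x)
    (hν : ∀ y ∈ Icc 0 x, |h y| ≤ ν) :
    |∫ y in (0 : ℝ)..x, P.g y * h y| ≤ C * Real.exp x * ν := by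
  have hν0 : 0 ≤ ν := (abs_nonneg _).trans (hν 0 ⟨le_rfl, hx⟩)
  have h1 : ‖∫ y in (0 : ℝ)..x, P.g y * h y‖ ≤ ∫ y in (0 : ℝ)..x, C * ν * Real.exp y := by
    refine intervalIntegral.norm_integral_le_of_norm_le hx (ae_of_all _ fun y hy => ?_)
      ((continuous_const.mul Real.continuous_exp).intervalIntegrable _ _)
    rw [norm_mul]
    calc _ ≤ C * Real.exp y * ν :=
        mul_le_mul (hP.g_exp y hy.1.le) (hν y ⟨hy.1.le, hy.2⟩) (abs_nonneg _)
          (mul_nonneg hP.pos.le (Real.exp_nonneg _))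
      _ = _ := by ring
  rw [intervalIntegral.integral_const_mul, integral_exp, Real.exp_zero] at h1
  have := mul_nonneg hP.pos.le hν0
  calc _ ≤ _ := h1
    _ ≤ _ := by nlinarith

lemma IsBdd.abs_integral_f_le (hP : P.IsBdd C) {h : ℝ → ℝ} {x M ν : ℝ} (hx : 0 ≤ x) (hM : x ≤ M)
    (hν : ∀ y ∈ Icc 0 M, |h y| ≤ ν) :
    |∫ y in x..M, P.f y * h y| ≤ C * Real.exp (-x) * ν := by
  have hν0 : 0 ≤ ν := (abs_nonneg _).trans (hν 0 ⟨le_rfl, hx.trans hM⟩)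
  have h1 : ‖∫ y in x..M, P.f y * h y‖ ≤ ∫ y in x..M, C * ν * Real.exp (-y) := by
    refine intervalIntegral.norm_integral_le_of_norm_le hM (ae_of_all _ fun y hy => ?_)
      ((by fun_prop : Continuous fun y => C * ν * Real.exp (-y)).intervalIntegrable _ _)
    have hy0 : 0 ≤ y := hx.trans hy.1.le
    rw [norm_mul]
    calc _ ≤ C * Real.exp (-y) * ν :=
        mul_le_mul (hP.f_exp y hy0) (hν y ⟨hy0, hy.2⟩) (abs_nonneg _)
          (mul_nonneg hP.pos.le (Real.exp_nonneg _))
      _ = _ := by ring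
  have h2 : ∫ y in x..M, Real.exp (-y) = Real.exp (-x) - Real.exp (-M) := by simp
  rw [intervalIntegral.integral_const_mul, h2] at h1
  have := mul_nonneg hP.pos.le hν0
  have := Real.exp_pos (-M)
  calc _ ≤ _ := h1
    _ ≤ _ := by nlinarith

lemma exp_neg_mul_exp (x : ℝ) : Real.exp (-x) * Real.exp x = 1 := by
  rw [← Real.exp_add]; simp

/-- Bounds for the coefficients in the variation of parameters formula. -/
lemma IsBdd.coeff_le (hP : P.IsBdd C) {h : ℝ → ℝ} (hh : Continuous h) {A B x M ν α β F G : ℝ}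
    (hx : 0 ≤ x) (hM : x ≤ M) (hν : ∀ y ∈ Icc 0 M, |h y| ≤ ν) (hA : |A| ≤ α) (hB : |B| ≤ β)
    (hF : |F| ≤ C * Real.exp (-x)) (hG : |G| ≤ C * Real.exp x) :
    |F * (A + ∫ y in (0 : ℝ)..x, P.g y * h y) + G * ((B * Real.exp (-M) +
      ∫ y in (0 : ℝ)..M, P.f y * h y) - ∫ y in (0 : ℝ)..x, P.f y * h y)|
      ≤ C * α + C * β + 2 * C ^ 2 * ν := by
  have hC := hP.pos
  have hα : 0 ≤ α := (abs_nonneg A).trans hA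
  have hβ : 0 ≤ β := (abs_nonneg B).trans hB
  have hν0 : 0 ≤ ν := (abs_nonneg _).trans (hν 0 ⟨le_rfl, hx.trans hM⟩)
  -- Parametrising the coefficient of `g` by its value at `M` leaves `B e ^ (-M) + ∫ f h` over `[x,
  -- M]`, of size `e ^ (-x)`, which balances the growth of `g x`.
  have hi := intervalIntegral.integral_interval_sub_left (μ := volume)
    ((P.continuous_f.mul hh).intervalIntegrable 0 M)
    ((P.continuous_f.mul hh).intervalIntegrable 0 x)
  simp only [Pi.mul_apply] at hi
  rw [add_sub_assoc, hi]
  have h1 := hP.abs_integral_g_le hx (fun y hy => hν y ⟨hy.1, hy.2.trans hM⟩)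
  have h2 := hP.abs_integral_f_le hx hM hν
  have ex := Real.exp_pos x
  have enx := Real.exp_pos (-x)
  have e0 := exp_neg_mul_exp x
  have e1 : Real.exp (-x) ≤ 1 := Real.exp_le_one_iff.2 (by linarith)
  have e2 : Real.exp (-M) * Real.exp x ≤ 1 := by
    rw [← Real.exp_add]; exact Real.exp_le_one_iff.2 (by linarith)
  have b1 : |A + ∫ y in (0 : ℝ)..x, P.g y * h y| ≤ α + C * Real.exp x * ν :=
    (abs_add_le _ _).trans (add_le_add hA h1)
  have b2 : |B * Real.exp (-M) + ∫ y in x..M, P.f y * h y| ≤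
      β * Real.exp (-M) + C * Real.exp (-x) * ν := by
    refine (abs_add_le _ _).trans (add_le_add ?_ h2)
    rw [abs_mul, Real.abs_exp]
    exact mul_le_mul_of_nonneg_right hB (Real.exp_nonneg _)
  refine (abs_add_le _ _).trans ?_
  rw [abs_mul, abs_mul]
  calc _ ≤ C * Real.exp (-x) * (α + C * Real.exp x * ν) +
        C * Real.exp x * (β * Real.exp (-M) + C * Real.exp (-x) * ν) :=
      add_le_add (mul_le_mul hF b1 (abs_nonneg _) (by positivity))
        (mul_le_mul hG b2 (abs_nonneg _) (by positivity))
    _ = C * α * Real.exp (-x) + C * β * (Real.exp (-M) * Real.exp x) + 2 * C ^ 2 * ν := by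
      linear_combination 2 * C ^ 2 * ν * e0
    _ ≤ C * α * 1 + C * β * 1 + 2 * C ^ 2 * ν := by gcongr
    _ = _ := by ring

end Profile

/-! ### The linear problem on half-edges: vertex and midpoint conditions. -/

/-- Half-edges of a graph, each with a profile; `bar` sends a half-edge to the other half of its
edge and `vert` to its vertex. -/
structure HalfEdges (p : ℝ) (H V : Type*) where
  P : H → Profile p
  bar : H → H
  vert : H → V
  peaked : H → Bool
  bar_bar : ∀ s, bar (bar s) = s
  not_peaked : ∀ s, peaked s = false → (P s).U 0 = 0 ∧ (P s).dU 0 = 0 ∧ (P s).f 0 = 1 ∧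
    (P s).df 0 = -1 ∧ (P s).g 0 = 1 / 2 ∧ (P s).dg 0 = 1 / 2
  neumann : ∀ s, peaked s = true → (P s).dU 0 = 0 ∧ (P s).dg 0 = 0
  unique : ∀ s s', peaked s = true → vert s' = vert s → s' = s

namespace HalfEdges

variable {p : ℝ} {H V : Type*} [Fintype H] [DecidableEq V] (S : HalfEdges p H V) (M : H → ℝ)

/-- The coefficient at the vertex of the growing solution. -/
def coeffQ (B : H → ℝ) (h : H → ℝ → ℝ) (s : H) : ℝ :=
  B s * Real.exp (-M s) + ∫ y in (0 : ℝ)..M s, (S.P s).f y * h s y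

/-- The coefficient at the midpoint of the decaying solution. -/
def coeffR (A : H → ℝ) (h : H → ℝ → ℝ) (s : H) : ℝ :=
  A s + ∫ y in (0 : ℝ)..M s, (S.P s).g y * h s y

/-- The average of `coeffQ` at a vertex. -/
def vertexMean (B : H → ℝ) (h : H → ℝ → ℝ) (v : V) : ℝ :=
  (∑ s with S.vert s = v, S.coeffQ M B h s) / (Finset.univ.filter fun s => S.vert s = v).card

/-- The coefficients determined by the vertex conditions. -/
def nextA (B : H → ℝ) (h : H → ℝ → ℝ) (s : H) : ℝ :=
  -- Where the profile is `0`, the value at the vertex is `A + Q / 2` and the derivative `Q / 2 -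
  -- A`. This choice makes them the mean and `Q` minus the mean, hence continuity and a zero sum. At
  -- a peak `dU` and `dg` vanish at `0`, so `A = 0` gives the Neumann condition.
  if S.peaked s then 0 else S.vertexMean M B h (S.vert s) - S.coeffQ M B h s / 2

/-- Value at the midpoint of the part known in advance. -/
def midVal (κ : ℝ) (A : H → ℝ) (h : H → ℝ → ℝ) (s : H) : ℝ :=
  κ * (S.P s).U (M s) + (S.P s).f (M s) * S.coeffR M A h s

/-- Derivative at the midpoint of the part known in advance. -/
def midDer (κ : ℝ) (A : H → ℝ) (h : H → ℝ → ℝ) (s : H) : ℝ :=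
  κ * (S.P s).dU (M s) + (S.P s).df (M s) * S.coeffR M A h s

/-- Normalised value of the growing solution at the midpoint. -/
def gMid (s : H) : ℝ := Real.exp (-M s) * (S.P s).g (M s)

/-- Normalised derivative of the growing solution at the midpoint. -/
def dgMid (s : H) : ℝ := Real.exp (-M s) * (S.P s).dg (M s)

/-- The determinant of the matching problem at the midpoint. -/
def midDet (s : H) : ℝ :=
  S.gMid M s * S.dgMid M (S.bar s) + S.gMid M (S.bar s) * S.dgMid M s

/-- The coefficients determined by the matching conditions at the midpoints. -/
def nextB (κ : ℝ) (A : H → ℝ) (h : H → ℝ → ℝ) (s : H) : ℝ :=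
  -- Cramer's rule for the two matching equations in the unknowns `B s` and `B (bar s)`. Derivatives
  -- must be opposite, since the two coordinates run in opposite directions.
  ((S.midVal M κ A h (S.bar s) - S.midVal M κ A h s) * S.dgMid M (S.bar s) -
    (S.midDer M κ A h s + S.midDer M κ A h (S.bar s)) * S.gMid M (S.bar s)) / S.midDet M s

/-- The correction on the half-edges. -/
def nextPhi (κ : ℝ) (A B : H → ℝ) (h : H → ℝ → ℝ) (s : H) (x : ℝ) : ℝ :=
  -- The updated coefficients are used: they carry the small factor, whereas a dependence on `A` and
  -- `B` themselves would not be contractive.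
  (S.P s).resp (S.nextA M B h s) (S.coeffQ M (S.nextB M κ A h) h s) (h s) x

variable {S M} {C m : ℝ} {A A' B B' : H → ℝ} {h h' : H → ℝ → ℝ}

omit [Fintype H] [DecidableEq V] in
lemma coeffQ_sub (hh : ∀ s, Continuous (h s)) (hh' : ∀ s, Continuous (h' s)) (s : H) :
    S.coeffQ M (B - B') (h - h') s = S.coeffQ M B h s - S.coeffQ M B' h' s := by
  have e := intervalIntegral.integral_sub (μ := volume)
    (((S.P s).continuous_f.mul (hh s)).intervalIntegrable 0 (M s))
    (((S.P s).continuous_f.mul (hh' s)).intervalIntegrable 0 (M s))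
  simp only [Pi.mul_apply] at e
  simp only [coeffQ, Pi.sub_apply, mul_sub, e]
  ring

omit [Fintype H] [DecidableEq V] in
lemma coeffR_sub (hh : ∀ s, Continuous (h s)) (hh' : ∀ s, Continuous (h' s)) (s : H) :
    S.coeffR M (A - A') (h - h') s = S.coeffR M A h s - S.coeffR M A' h' s := by
  have e := intervalIntegral.integral_sub (μ := volume)
    (((S.P s).continuous_g.mul (hh s)).intervalIntegrable 0 (M s))
    (((S.P s).continuous_g.mul (hh' s)).intervalIntegrable 0 (M s))
  simp only [Pi.mul_apply] at e
  simp only [coeffR, Pi.sub_apply, mul_sub, e]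
  ring

lemma nextA_sub (hh : ∀ s, Continuous (h s)) (hh' : ∀ s, Continuous (h' s)) (s : H) :
    S.nextA M (B - B') (h - h') s = S.nextA M B h s - S.nextA M B' h' s := by
  simp only [nextA, vertexMean, coeffQ_sub hh hh', Finset.sum_sub_distrib]
  split_ifs
  · simp
  · ring

omit [Fintype H] [DecidableEq V] in
lemma nextB_sub (κ κ' : ℝ) (hh : ∀ s, Continuous (h s)) (hh' : ∀ s, Continuous (h' s)) (s : H) :
    S.nextB M (κ - κ') (A - A') (h - h') s = S.nextB M κ A h s - S.nextB M κ' A' h' s := by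
  simp only [nextB, midVal, midDer, coeffR_sub hh hh']
  ring

lemma nextPhi_sub (κ κ' : ℝ) (hh : ∀ s, Continuous (h s)) (hh' : ∀ s, Continuous (h' s)) (s : H)
    (x : ℝ) : S.nextPhi M (κ - κ') (A - A') (B - B') (h - h') s x =
      S.nextPhi M κ A B h s x - S.nextPhi M κ' A' B' h' s x := by
  have e : S.nextB M (κ - κ') (A - A') (h - h') = S.nextB M κ A h - S.nextB M κ' A' h' :=
    funext fun s => nextB_sub κ κ' hh hh' s
  simp only [nextPhi, nextA_sub hh hh', e, coeffQ_sub hh hh']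
  exact (S.P s).resp_sub _ _ _ _ (hh s) (hh' s) x

omit [Fintype H] [DecidableEq V] in
lemma abs_coeffQ_le (hC : ∀ s, (S.P s).IsBdd C) (hm : 0 ≤ m) (hM : ∀ s, m ≤ M s) {β ν : ℝ}
    (hB : ∀ s, |B s| ≤ β) (hν : ∀ s, ∀ y ∈ Icc 0 (M s), |h s y| ≤ ν) (s : H) :
    |S.coeffQ M B h s| ≤ β * Real.exp (-m) + C * ν := by
  have h1 := (hC s).abs_integral_f_le le_rfl (hm.trans (hM s)) (hν s)
  rw [neg_zero, Real.exp_zero, mul_one] at h1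
  refine (abs_add_le _ _).trans (add_le_add ?_ h1)
  rw [abs_mul, Real.abs_exp]
  exact mul_le_mul (hB s) (Real.exp_le_exp.2 (neg_le_neg (hM s))) (Real.exp_nonneg _)
    ((abs_nonneg _).trans (hB s))

lemma abs_nextA_le (hC : ∀ s, (S.P s).IsBdd C) (hm : 0 ≤ m) (hM : ∀ s, m ≤ M s) {β ν : ℝ}
    (hB : ∀ s, |B s| ≤ β) (hν : ∀ s, ∀ y ∈ Icc 0 (M s), |h s y| ≤ ν) (s : H) :
    |S.nextA M B h s| ≤ 3 / 2 * (β * Real.exp (-m) + C * ν) := by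
  have hq := abs_coeffQ_le hC hm hM hB hν
  set q := β * Real.exp (-m) + C * ν
  have hq0 : 0 ≤ q := (abs_nonneg _).trans (hq s)
  unfold nextA
  split_ifs
  · simpa using hq0
  · have h1 : |S.vertexMean M B h (S.vert s)| ≤ q := by
      have hpos : 0 < (Finset.univ.filter fun s' => S.vert s' = S.vert s).card :=
        Finset.card_pos.2 ⟨s, by simp⟩
      unfold vertexMean
      rw [abs_div, Nat.abs_cast, div_le_iff₀ (by exact_mod_cast hpos)]
      refine (Finset.abs_sum_le_sum_abs _ _).trans ((Finset.sum_le_card_nsmul _ _ q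
        fun s' _ => hq s').trans_eq ?_)
      rw [nsmul_eq_mul, mul_comm]
    refine (abs_sub _ _).trans ?_
    rw [abs_div, abs_two]
    linarith [hq s]

omit [Fintype H] [DecidableEq V] in
-- Decay of `f` against growth of the integral of `g h` leaves a bounded multiple of `ν`, while `A`
-- and the profile arrive with a factor `e ^ (-m)`. The free numbers `u`, `f` serve for values and
-- for derivatives.
lemma abs_mid_le (hC : ∀ s, (S.P s).IsBdd C) (hm : 0 ≤ m) (hM : ∀ s, m ≤ M s) {κ α ν : ℝ}
    (hA : ∀ s, |A s| ≤ α) (hν : ∀ s, ∀ y ∈ Icc 0 (M s), |h s y| ≤ ν) (s : H) {u f : ℝ}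
    (hu : |u| ≤ C * Real.exp (-M s)) (hf : |f| ≤ C * Real.exp (-M s)) :
    |κ * u + f * S.coeffR M A h s| ≤ C * Real.exp (-m) * (|κ| + α) + C ^ 2 * ν := by
  have hC0 := (hC s).pos
  have hα : 0 ≤ α := (abs_nonneg _).trans (hA s)
  have hMs := hm.trans (hM s)
  have hexp : Real.exp (-M s) ≤ Real.exp (-m) := Real.exp_le_exp.2 (neg_le_neg (hM s))
  have hR : |S.coeffR M A h s| ≤ α + C * Real.exp (M s) * ν :=
    (abs_add_le _ _).trans (add_le_add (hA s) ((hC s).abs_integral_g_le hMs (hν s)))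
  refine (abs_add_le _ _).trans ?_
  rw [abs_mul, abs_mul]
  calc _ ≤ |κ| * (C * Real.exp (-M s)) + C * Real.exp (-M s) * (α + C * Real.exp (M s) * ν) :=
      add_le_add (mul_le_mul_of_nonneg_left hu (abs_nonneg κ))
        (mul_le_mul hf hR (abs_nonneg _) (by positivity))
    _ = C * Real.exp (-M s) * (|κ| + α) + C ^ 2 * ν := by
      linear_combination C ^ 2 * ν * Profile.exp_neg_mul_exp (M s)
    _ ≤ _ := by gcongr

omit [Fintype H] [DecidableEq V] in
lemma mid_bounds (hC : ∀ s, (S.P s).IsBdd C) (hm : C ≤ m) (hM : ∀ s, m ≤ M s) (s : H) :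
    C⁻¹ ≤ S.gMid M s ∧ S.gMid M s ≤ C ∧ C⁻¹ ≤ S.dgMid M s ∧ S.dgMid M s ≤ C := by
  have hC0 := (hC s).pos
  have hCM : C ≤ M s := hm.trans (hM s)
  have e := Profile.exp_neg_mul_exp (M s)
  have e' := Real.exp_pos (-M s)
  have hlow : ∀ y, Real.exp (M s) ≤ C * y → C⁻¹ ≤ Real.exp (-M s) * y := fun y hy => by
    rw [inv_le_iff_one_le_mul₀ hC0, ← e]
    nlinarith
  have hup : ∀ y, |y| ≤ C * Real.exp (M s) → Real.exp (-M s) * y ≤ C := fun y hy => by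
    calc _ ≤ Real.exp (-M s) * (C * Real.exp (M s)) :=
          mul_le_mul_of_nonneg_left ((le_abs_self y).trans hy) e'.le
      _ = C := by linear_combination C * e
  exact ⟨hlow _ ((hC s).g_lower _ hCM), hup _ ((hC s).g_exp _ (hC0.le.trans hCM)),
    hlow _ ((hC s).dg_lower _ hCM), hup _ ((hC s).dg_exp _ (hC0.le.trans hCM))⟩

omit [Fintype H] [DecidableEq V] in
-- All four factors are positive and bounded below by `mid_bounds`, so nothing cancels: midpoint
-- matching is uniformly solvable.
lemma midDet_ge (hC : ∀ s, (S.P s).IsBdd C) (hm : C ≤ m) (hM : ∀ s, m ≤ M s) (s : H) :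
    2 * (C⁻¹ * C⁻¹) ≤ S.midDet M s := by
  have hC0 : 0 < C⁻¹ := inv_pos.2 (hC s).pos
  obtain ⟨a1, -, a3, -⟩ := mid_bounds hC hm hM s
  obtain ⟨b1, -, b3, -⟩ := mid_bounds hC hm hM (S.bar s)
  have h1 := mul_le_mul a1 b3 hC0.le (hC0.le.trans a1)
  have h2 := mul_le_mul b1 a3 hC0.le (hC0.le.trans b1)
  unfold midDet
  linarith

omit [Fintype H] [DecidableEq V] in
lemma abs_nextB_le (hC : ∀ s, (S.P s).IsBdd C) (hm : C ≤ m) (hM : ∀ s, m ≤ M s) {κ α ν : ℝ}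
    (hA : ∀ s, |A s| ≤ α) (hν : ∀ s, ∀ y ∈ Icc 0 (M s), |h s y| ≤ ν) (s : H) :
    |S.nextB M κ A h s| ≤ 2 * C ^ 3 * (C * Real.exp (-m) * (|κ| + α) + C ^ 2 * ν) := by
  have hC0 := (hC s).pos
  have hm0 := hC0.le.trans hm
  have hv : ∀ s, |S.midVal M κ A h s| ≤ C * Real.exp (-m) * (|κ| + α) + C ^ 2 * ν := fun s =>
    abs_mid_le hC hm0 hM hA hν s ((hC s).U_exp _ (hm0.trans (hM s)))
      ((hC s).f_exp _ (hm0.trans (hM s)))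
  have hd : ∀ s, |S.midDer M κ A h s| ≤ C * Real.exp (-m) * (|κ| + α) + C ^ 2 * ν := fun s =>
    abs_mid_le hC hm0 hM hA hν s ((hC s).dU_exp _ (hm0.trans (hM s)))
      ((hC s).df_exp _ (hm0.trans (hM s)))
  set Y := C * Real.exp (-m) * (|κ| + α) + C ^ 2 * ν
  have hY : 0 ≤ Y := (abs_nonneg _).trans (hv s)
  obtain ⟨b1, b2, b3, b4⟩ := mid_bounds hC hm hM (S.bar s)
  have hCi : 0 < C⁻¹ := inv_pos.2 hC0
  have hD := midDet_ge hC hm hM s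
  have hD0 : 0 < S.midDet M s := lt_of_lt_of_le (by positivity) hD
  have hnum : |(S.midVal M κ A h (S.bar s) - S.midVal M κ A h s) * S.dgMid M (S.bar s) -
      (S.midDer M κ A h s + S.midDer M κ A h (S.bar s)) * S.gMid M (S.bar s)| ≤
      (Y + Y) * C + (Y + Y) * C := by
    refine (abs_sub _ _).trans ?_
    rw [abs_mul, abs_mul, abs_of_pos (hCi.trans_le b1), abs_of_pos (hCi.trans_le b3)]
    exact add_le_add
      (mul_le_mul ((abs_sub _ _).trans (add_le_add (hv _) (hv _))) b4 (hCi.le.trans b3)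
        (by positivity))
      (mul_le_mul ((abs_add_le _ _).trans (add_le_add (hd _) (hd _))) b2 (hCi.le.trans b1)
        (by positivity))
  unfold nextB
  rw [abs_div, abs_of_pos hD0, div_le_iff₀ hD0]
  refine hnum.trans ?_
  calc (Y + Y) * C + (Y + Y) * C = 2 * C ^ 3 * Y * (2 * (C⁻¹ * C⁻¹)) := by field_simp; ring
    _ ≤ _ := mul_le_mul_of_nonneg_left hD (by positivity)

/-- The central linear estimate. Data from the opposite end of a half-edge enter only with a factor
`e ^ (-m)`, and the source with a constant depending on `C` alone. The parameter `κ` weights the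
profile: `1` for the map itself, `0` for differences. -/
lemma next_le (hC : ∀ s, (S.P s).IsBdd C) (hm : C ≤ m) (hM : ∀ s, m ≤ M s)
    (hh : ∀ s, Continuous (h s)) {κ α ν : ℝ} (hA : ∀ s, |A s| ≤ α) (hB : ∀ s, |B s| ≤ α)
    (hν : ∀ s, ∀ y ∈ Icc 0 (M s), |h s y| ≤ ν) (s : H) :
    |S.nextA M B h s| ≤ 6 * C ^ 6 * (Real.exp (-m) * (|κ| + α) + ν) ∧
    |S.nextB M κ A h s| ≤ 6 * C ^ 6 * (Real.exp (-m) * (|κ| + α) + ν) ∧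
    ∀ x ∈ Icc 0 (M s), |S.nextPhi M κ A B h s x| ≤
      6 * C ^ 6 * (Real.exp (-m) * (|κ| + α) + ν) := by
  have hC1 := (hC s).one_le
  have hC0 := (hC s).pos
  have hm0 := hC0.le.trans hm
  have hα : 0 ≤ α := (abs_nonneg _).trans (hA s)
  have hν0 : 0 ≤ ν := (abs_nonneg _).trans (hν s 0 ⟨le_rfl, hm0.trans (hM s)⟩)
  have hκ := abs_nonneg κ
  have hE := Real.exp_pos (-m)
  have h1 := abs_nextA_le hC hm0 hM hB hν s
  have h2 := abs_nextB_le (κ := κ) hC hm hM hA hν s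
  set E := Real.exp (-m)
  set Z := E * (|κ| + α) + ν with hZ
  have hZ0 : 0 ≤ Z := by positivity
  have c2 : C ^ 2 ≤ C ^ 6 := pow_le_pow_right₀ hC1 (by norm_num)
  have c1 : C ≤ C ^ 6 := le_self_pow₀ hC1 (by norm_num)
  have c5 : C ^ 5 ≤ C ^ 6 := pow_le_pow_right₀ hC1 (by norm_num)
  have c12 : C ≤ C ^ 2 := le_self_pow₀ hC1 (by norm_num)
  have a1 : 3 / 2 * (α * E + C * ν) ≤ 3 / 2 * C * Z := by
    have t1 : α * E ≤ C * (E * (|κ| + α)) := by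
      calc α * E = 1 * (E * (0 + α)) := by ring
        _ ≤ _ := by gcongr
    rw [hZ]
    linarith
  have a2 : 2 * C ^ 3 * (C * E * (|κ| + α) + C ^ 2 * ν) ≤ 2 * C ^ 5 * Z := by
    calc 2 * C ^ 3 * (C * E * (|κ| + α) + C ^ 2 * ν)
        ≤ 2 * C ^ 3 * (C ^ 2 * E * (|κ| + α) + C ^ 2 * ν) := by gcongr
      _ = _ := by rw [hZ]; ring
  refine ⟨h1.trans (a1.trans ?_), h2.trans (a2.trans ?_), fun x hx => ?_⟩
  · exact mul_le_mul_of_nonneg_right (by linarith) hZ0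
  · exact mul_le_mul_of_nonneg_right (by linarith) hZ0
  · have h3 := (hC s).coeff_le (hh s) hx.1 hx.2 (hν s) (h1.trans a1) (h2.trans a2)
      ((hC s).f_exp x hx.1) ((hC s).g_exp x hx.1)
    refine h3.trans ?_
    have hνZ : ν ≤ Z := by rw [hZ]; have : 0 ≤ E * (|κ| + α) := by positivity
                           linarith
    calc C * (3 / 2 * C * Z) + C * (2 * C ^ 5 * Z) + 2 * C ^ 2 * ν
        ≤ C * (3 / 2 * C * Z) + C * (2 * C ^ 5 * Z) + 2 * C ^ 2 * Z := by gcongr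
      _ = (3 / 2 * C ^ 2 + 2 * C ^ 6 + 2 * C ^ 2) * Z := by ring
      _ ≤ _ := mul_le_mul_of_nonneg_right (by linarith) hZ0

end HalfEdges

/-! ### The nonlinear fixed point: truncation and contraction. -/

/-- Truncation to `[-r, r]`. -/
def trunc (r y : ℝ) : ℝ := max (-r) (min y r)

lemma continuous_trunc (r : ℝ) : Continuous (trunc r) := by unfold trunc; fun_prop

lemma abs_trunc_sub_le (r y z : ℝ) : |trunc r y - trunc r z| ≤ |y - z| := by
  refine (abs_max_sub_max_le_max _ _ _ _).trans ?_
  rw [sub_self, abs_zero]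
  refine max_le (abs_nonneg _) ((abs_min_sub_min_le_max _ _ _ _).trans ?_)
  rw [sub_self, abs_zero]
  exact max_le le_rfl (abs_nonneg _)

lemma abs_trunc_le {r : ℝ} (hr : 0 ≤ r) (y : ℝ) : |trunc r y| ≤ r :=
  abs_le.2 ⟨le_max_left _ _, max_le (by linarith) (min_le_right _ _)⟩

lemma trunc_eq {r y : ℝ} (hy : |y| ≤ r) : trunc r y = y := by
  obtain ⟨h1, h2⟩ := abs_le.1 hy
  rw [trunc, min_eq_left h2, max_eq_right h1]

/-- The bounded continuous function which agrees with `F` on `[0, M]` and is constant on either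
side. -/
def clampExt {F : ℝ → ℝ} (hF : Continuous F) {M : ℝ} (hM : 0 ≤ M) : BoundedContinuousFunction ℝ ℝ :=
  (BoundedContinuousFunction.mkOfCompact
    (⟨fun y : Icc (0 : ℝ) M => F y, hF.comp continuous_subtype_val⟩ : C(Icc (0 : ℝ) M, ℝ))).compContinuous
    ⟨projIcc 0 M hM, continuous_projIcc⟩

lemma clampExt_apply {F : ℝ → ℝ} (hF : Continuous F) {M : ℝ} (hM : 0 ≤ M) (x : ℝ) :
    clampExt hF hM x = F (projIcc 0 M hM x) := rfl

namespace HalfEdges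

variable {p : ℝ} {H V : Type*} [Fintype H] [DecidableEq V] (S : HalfEdges p H V)

/-- The truncated nonlinear remainder. -/
def source (r : ℝ) (φ : H → BoundedContinuousFunction ℝ ℝ) (s : H) (x : ℝ) : ℝ :=
  taylorRem p ((S.P s).U x) (trunc r (φ s x))

omit [Fintype H] [DecidableEq V] in
lemma continuous_source (hp : 1 < p) (r : ℝ) (φ : H → BoundedContinuousFunction ℝ ℝ) (s : H) :
    Continuous (S.source r φ s) := by
  have h1 := (S.P s).continuous_U
  have h2 := (continuous_trunc r).comp (φ s).continuous
  have h3 := continuous_powNL hp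
  have h4 : Continuous fun x => |(S.P s).U x| ^ (p - 1) :=
    h1.abs.rpow_const fun _ => Or.inr (by linarith)
  exact ((h3.comp (h1.add h2)).sub (h3.comp h1)).sub ((continuous_const.mul h4).mul h2)

omit [DecidableEq V] in
-- Truncation keeps both arguments where the remainder is `η`-Lipschitz, so the estimate is global
-- and no invariant ball is needed.
lemma source_sub_le {r η C : ℝ} (hr : 0 ≤ r) (hη : 0 ≤ η) (hC : ∀ s, (S.P s).IsBdd C)
    (H1 : ∀ c y z : ℝ, |c| ≤ C → |y| ≤ r → |z| ≤ r →
      |taylorRem p c y - taylorRem p c z| ≤ η * |y - z|)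
    (φ ψ : H → BoundedContinuousFunction ℝ ℝ) (s : H) (x : ℝ) :
    |S.source r φ s x - S.source r ψ s x| ≤ η * dist φ ψ := by
  refine (H1 _ _ _ ?_ (abs_trunc_le hr _) (abs_trunc_le hr _)).trans
    (mul_le_mul_of_nonneg_left ((abs_trunc_sub_le _ _ _).trans ?_) hη)
  · rw [abs_of_nonneg ((hC s).U_nonneg x)]; exact (hC s).U_le x
  · exact ((φ s).dist_coe_le_dist x).trans (dist_le_pi_dist φ ψ s)

lemma continuous_nextPhi (κ : ℝ) (M A B : H → ℝ) {h : H → ℝ → ℝ} (hh : ∀ s, Continuous (h s))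
    (s : H) : Continuous (S.nextPhi M κ A B h s) :=
  (S.P s).continuous_resp _ _ (hh s)

/-- The map whose fixed point gives the solution. -/
def step (hp : 1 < p) (r : ℝ) {M : H → ℝ} (hM : ∀ s, 0 ≤ M s)
    (z : (H → ℝ) × (H → ℝ) × (H → BoundedContinuousFunction ℝ ℝ)) :
    (H → ℝ) × (H → ℝ) × (H → BoundedContinuousFunction ℝ ℝ) :=
  (S.nextA M z.2.1 (S.source r z.2.2), S.nextB M 1 z.1 (S.source r z.2.2),
    fun s => clampExt (S.continuous_nextPhi 1 M z.1 z.2.1 (S.continuous_source hp r z.2.2) s) (hM s))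

/-- The map is affine in the coefficients and the source, so the profile terms cancel in a
difference and `next_le` applies with `κ = 1 - 1`. -/
lemma dist_step_le (hp : 1 < p) {r η C m : ℝ} (hr : 0 ≤ r) (hη : 0 ≤ η)
    (hC : ∀ s, (S.P s).IsBdd C)
    (H1 : ∀ c y z : ℝ, |c| ≤ C → |y| ≤ r → |z| ≤ r →
      |taylorRem p c y - taylorRem p c z| ≤ η * |y - z|)
    {M : H → ℝ} (hM0 : ∀ s, 0 ≤ M s) (hm : C ≤ m) (hM : ∀ s, m ≤ M s)
    (z w : (H → ℝ) × (H → ℝ) × (H → BoundedContinuousFunction ℝ ℝ)) :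
    dist (S.step hp r hM0 z) (S.step hp r hM0 w) ≤
      6 * C ^ 6 * (Real.exp (-m) + η) * dist z w := by
  have hR : 0 ≤ 6 * C ^ 6 * (Real.exp (-m) + η) * dist z w := by
    have : 0 ≤ C ^ 6 := by positivity
    positivity
  have hz := S.continuous_source hp r z.2.2
  have hw := S.continuous_source hp r w.2.2
  have hA : ∀ s, |(z.1 - w.1) s| ≤ dist z w := fun s =>
    (dist_le_pi_dist z.1 w.1 s).trans (le_max_left _ _)
  have h2 : dist z.2 w.2 ≤ dist z w := le_max_right _ _
  have hB : ∀ s, |(z.2.1 - w.2.1) s| ≤ dist z w := fun s =>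
    (dist_le_pi_dist z.2.1 w.2.1 s).trans ((le_max_left _ _).trans h2)
  have hφ : dist z.2.2 w.2.2 ≤ dist z w := (le_max_right _ _).trans h2
  have hν : ∀ s, ∀ y ∈ Icc 0 (M s),
      |(S.source r z.2.2 - S.source r w.2.2) s y| ≤ η * dist z w := fun s y _ =>
    (S.source_sub_le hr hη hC H1 z.2.2 w.2.2 s y).trans (mul_le_mul_of_nonneg_left hφ hη)
  have hsub : ∀ s, Continuous ((S.source r z.2.2 - S.source r w.2.2) s) := fun s =>
    (hz s).sub (hw s)
  have key := fun s => next_le (κ := 1 - 1) hC hm hM hsub hA hB hν s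
  have e : 6 * C ^ 6 * (Real.exp (-m) * (|(1 : ℝ) - 1| + dist z w) + η * dist z w) =
      6 * C ^ 6 * (Real.exp (-m) + η) * dist z w := by
    rw [sub_self, abs_zero]; ring
  rw [e] at key
  refine max_le ((dist_pi_le_iff hR).2 fun s => ?_) (max_le ((dist_pi_le_iff hR).2 fun s => ?_)
    ((dist_pi_le_iff hR).2 fun s => (BoundedContinuousFunction.dist_le hR).2 fun x => ?_))
  · have := (key s).1
    rwa [nextA_sub hz hw] at this
  · have := (key s).2.1
    rwa [nextB_sub 1 1 hz hw] at this
  · have := (key s).2.2 _ (projIcc 0 (M s) (hM0 s) x).2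
    rwa [nextPhi_sub 1 1 hz hw] at this

omit [Fintype H] [DecidableEq V] in
lemma source_zero (r : ℝ) (hr : 0 ≤ r) :
    S.source r (0 : H → BoundedContinuousFunction ℝ ℝ) = 0 := by
  ext s x
  simp [source, trunc_eq (show |(0 : ℝ)| ≤ r by simpa using hr), taylorRem_zero]

/-- The image of `0` only sees the mismatch of the profiles at the midpoints, which is exponentially
small. -/
lemma dist_step_zero_le (hp : 1 < p) {r C m : ℝ} (hr : 0 ≤ r)
    (hC : ∀ s, (S.P s).IsBdd C)
    {M : H → ℝ} (hM0 : ∀ s, 0 ≤ M s) (hm : C ≤ m) (hM : ∀ s, m ≤ M s) :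
    dist 0 (S.step hp r hM0 0) ≤ 6 * C ^ 6 * Real.exp (-m) := by
  have hR : 0 ≤ 6 * C ^ 6 * Real.exp (-m) := by positivity
  have h0 : S.source r (0 : H → BoundedContinuousFunction ℝ ℝ) = 0 := S.source_zero r hr
  have key := fun s => next_le (S := S) (M := M) (A := 0) (B := 0) (h := 0) (κ := 1) (α := 0)
    (ν := 0) hC hm hM (fun s => continuous_const) (by simp) (by simp) (by simp) s
  simp only [abs_one, add_zero, mul_one] at key
  rw [dist_comm]
  refine max_le ((dist_pi_le_iff hR).2 fun s => ?_) (max_le ((dist_pi_le_iff hR).2 fun s => ?_)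
    ((dist_pi_le_iff hR).2 fun s => (BoundedContinuousFunction.dist_le hR).2 fun x => ?_))
  · have := (key s).1
    simp only [step, Prod.snd_zero, Prod.fst_zero, h0]
    rw [Pi.zero_apply, Real.dist_0_eq_abs]
    exact this
  · have := (key s).2.1
    simp only [step, Prod.snd_zero, Prod.fst_zero, h0]
    rw [Pi.zero_apply, Real.dist_0_eq_abs]
    exact this
  · have := (key s).2.2 _ (projIcc 0 (M s) (hM0 s) x).2
    simp only [step, Prod.snd_zero, Prod.fst_zero]
    rw [clampExt_apply, Pi.zero_apply, BoundedContinuousFunction.coe_zero, Pi.zero_apply,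
      Real.dist_0_eq_abs, h0]
    exact this

omit [Fintype H] [DecidableEq V] in
/-- The matching conditions at a midpoint. -/
lemma matching {C m κ : ℝ} {M A : H → ℝ} {h : H → ℝ → ℝ} (hC : ∀ s, (S.P s).IsBdd C) (hm : C ≤ m)
    (hM : ∀ s, m ≤ M s) (s : H) :
    (S.midVal M κ A h s + S.nextB M κ A h s * S.gMid M s =
      S.midVal M κ A h (S.bar s) + S.nextB M κ A h (S.bar s) * S.gMid M (S.bar s)) ∧
    (S.midDer M κ A h s + S.nextB M κ A h s * S.dgMid M s =
      -(S.midDer M κ A h (S.bar s) + S.nextB M κ A h (S.bar s) * S.dgMid M (S.bar s))) := by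
  have hD : S.midDet M s ≠ 0 := by
    have := midDet_ge hC hm hM s
    have h2 : 0 < C⁻¹ := inv_pos.2 (hC s).pos
    have : 0 < 2 * (C⁻¹ * C⁻¹) := by positivity
    linarith
  have hD' : S.midDet M (S.bar s) = S.midDet M s := by simp only [midDet, S.bar_bar]; ring
  simp only [nextB, hD', S.bar_bar]
  constructor
  · field_simp
    simp only [midDet]
    ring
  · field_simp
    simp only [midDet]
    ring

/-- Banach's theorem for `step`. The fixed point has size `O(e ^ (-m))`, so the truncation is
inactive and the untruncated equation holds. `K` and `m₀` do not depend on the lengths, so they are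
uniform in `λ`. -/
theorem exists_solution (hp : 1 < p) {C : ℝ} (hC0 : 1 ≤ C) (hC : ∀ s, (S.P s).IsBdd C) :
    ∃ K m₀ : ℝ, 0 < K ∧ ∀ (M : H → ℝ) (m : ℝ), (∀ s, M (S.bar s) = M s) → m₀ ≤ m →
      (∀ s, m ≤ M s) → ∃ w dw : H → ℝ → ℝ,
        (∀ s x, HasDerivAt (w s) (dw s x) x) ∧
        (∀ s, ∀ x ∈ Icc 0 (M s), HasDerivAt (dw s) (w s x - powNL p (w s x)) x) ∧
        (∀ s s', S.vert s = S.vert s' → w s 0 = w s' 0) ∧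
        (∀ v, ∑ s with S.vert s = v, dw s 0 = 0) ∧
        (∀ s, w s (M s) = w (S.bar s) (M s) ∧ dw s (M s) = -dw (S.bar s) (M s)) ∧
        ∀ s, ∀ x ∈ Icc 0 (M s), |w s x - (S.P s).U x| ≤ K * Real.exp (-m) ∧
          |dw s x - (S.P s).dU x| ≤ K * Real.exp (-m) := by
  have hC00 : 0 < C := by linarith
  set L : ℝ := 6 * C ^ 6 with hL
  have hL0 : 0 < L := by positivity
  -- Once `e ^ (-m) < η`, the Lipschitz constant `L (e ^ (-m) + η)` of the map is at most `2 L η = 1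
  -- / 2`.
  set η : ℝ := 1 / (4 * L) with hη
  have hη0 : 0 < η := by positivity
  obtain ⟨r, hr, -, H1⟩ := exists_taylorRem_lipschitz hp C hη0
  have hE : Tendsto (fun m : ℝ => Real.exp (-m)) atTop (nhds 0) :=
    Real.tendsto_exp_neg_atTop_nhds_zero
  -- The second condition gives `2 L e ^ (-m) < r`, which bounds the fixed point below the
  -- truncation level.
  obtain ⟨m₁, hm₁⟩ := eventually_atTop.1 ((hE.eventually (gt_mem_nhds hη0)).and
    (hE.eventually (gt_mem_nhds (show 0 < r / (2 * L) by positivity))))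
  refine ⟨2 * L * (2 * C + 2 * C ^ 2 * η), max C m₁, by positivity,
    fun M m hbar hm hMm => ?_⟩
  have hmC : C ≤ m := (le_max_left _ _).trans hm
  obtain ⟨hE1, hE2⟩ := hm₁ m ((le_max_right _ _).trans hm)
  have hM0 : ∀ s, 0 ≤ M s := fun s => by linarith [hMm s]
  have hlip : ContractingWith (1 / 2 : NNReal) (S.step hp r hM0) := by
    refine ⟨by rw [← NNReal.coe_lt_coe]; norm_num, LipschitzWith.of_dist_le_mul fun z w => ?_⟩
    refine (S.dist_step_le hp hr.le hη0.le hC H1 hM0 hmC hMm z w).trans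
      (mul_le_mul_of_nonneg_right ?_ dist_nonneg)
    have : 6 * C ^ 6 * (η + η) = 1 / 2 := by rw [hη, ← hL]; field_simp; norm_num
    have h2 : 6 * C ^ 6 * (Real.exp (-m) + η) ≤ 6 * C ^ 6 * (η + η) := by gcongr
    refine (h2.trans_eq this).trans_eq ?_
    norm_num
  set z := ContractingWith.fixedPoint (S.step hp r hM0) hlip with hz
  have hfix : S.step hp r hM0 z = z := hlip.fixedPoint_isFixedPt
  have hz0 : dist 0 z ≤ 2 * L * Real.exp (-m) := by
    refine (hlip.dist_fixedPoint_le 0).trans ?_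
    have := S.dist_step_zero_le hp hr.le hC hM0 hmC hMm
    have e : 1 - ((1 / 2 : NNReal) : ℝ) = 1 / 2 := by norm_num
    rw [e, div_le_iff₀ (by norm_num)]
    rw [← hL] at this
    linarith
  have hzr : dist 0 z ≤ r := hz0.trans (by
    rw [lt_div_iff₀ (by positivity)] at hE2
    linarith)
  set A := z.1
  set B := z.2.1
  set φ := z.2.2
  set h := S.source r φ with hh
  have hhc : ∀ s, Continuous (h s) := S.continuous_source hp r φ
  have fA : S.nextA M B h = A := congrArg Prod.fst hfix
  have fB : S.nextB M 1 A h = B := congrArg (fun q => q.2.1) hfix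
  -- Outside `[0, M s]` the function `φ s` is a constant extension, so the equation is obtained on
  -- this interval only.
  have fφ : ∀ s, ∀ x ∈ Icc 0 (M s), φ s x = (S.P s).resp (A s) (S.coeffQ M B h s) (h s) x := by
    intro s x hx
    have h1 : (S.step hp r hM0 z).2.2 s x = φ s x :=
      congrArg (fun q : (H → ℝ) × (H → ℝ) × (H → BoundedContinuousFunction ℝ ℝ) => q.2.2 s x) hfix
    rw [← h1]
    simp only [step]
    rw [clampExt_apply, projIcc_of_mem (hM0 s) hx]
    change S.nextPhi M 1 A B h s x = _
    rw [nextPhi, fA, fB]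
  have d2 : dist 0 z.2 ≤ dist 0 z := le_max_right _ _
  have hA : ∀ s, |A s| ≤ 2 * L * Real.exp (-m) := fun s => by
    have := (dist_le_pi_dist (0 : H → ℝ) A s).trans (le_max_left _ _ : _ ≤ dist 0 z)
    rw [Pi.zero_apply, dist_comm, Real.dist_0_eq_abs] at this
    exact this.trans hz0
  have hB : ∀ s, |B s| ≤ 2 * L * Real.exp (-m) := fun s => by
    have := (dist_le_pi_dist (0 : H → ℝ) B s).trans ((le_max_left _ _ : _ ≤ dist 0 z.2).trans d2)
    rw [Pi.zero_apply, dist_comm, Real.dist_0_eq_abs] at this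
    exact this.trans hz0
  have dφ : dist 0 φ ≤ dist 0 z := (le_max_right _ _ : _ ≤ dist 0 z.2).trans d2
  have hφ : ∀ s x, |φ s x| ≤ dist 0 z := fun s x => by
    have h1 := (BoundedContinuousFunction.dist_coe_le_dist (f := (0 : BoundedContinuousFunction ℝ ℝ))
      (g := φ s) x).trans ((dist_le_pi_dist (0 : H → BoundedContinuousFunction ℝ ℝ) φ s).trans dφ)
    rw [BoundedContinuousFunction.coe_zero, Pi.zero_apply, dist_comm, Real.dist_0_eq_abs] at h1
    exact h1
  have hν : ∀ s, ∀ y ∈ Icc 0 (M s), |h s y| ≤ η * (2 * L * Real.exp (-m)) := fun s y _ => by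
    have h1 := S.source_sub_le hr.le hη0.le hC H1 φ 0 s y
    rw [S.source_zero r hr.le, Pi.zero_apply, Pi.zero_apply, sub_zero, dist_comm] at h1
    exact h1.trans (mul_le_mul_of_nonneg_left (dφ.trans hz0) hη0.le)
  refine ⟨fun s x => (S.P s).U x + (S.P s).resp (A s) (S.coeffQ M B h s) (h s) x,
    fun s x => (S.P s).dU x + (S.P s).dresp (A s) (S.coeffQ M B h s) (h s) x,
    fun s x => ((S.P s).hU x).add ((S.P s).hasDerivAt_resp _ _ (hhc s) x), ?_, ?_, ?_, ?_, ?_⟩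
  · intro s x hx
    refine (((S.P s).hdU x).add ((S.P s).hasDerivAt_dresp _ _ (hhc s) x)).congr_deriv ?_
    have e1 : h s x = taylorRem p ((S.P s).U x) (φ s x) := by
      simp only [hh, source]
      rw [trunc_eq ((hφ s x).trans hzr)]
    rw [e1, fφ s x hx, taylorRem]
    ring
  · intro s s' hss
    by_cases hs : S.peaked s = true
    · rw [S.unique s s' hs hss.symm]
    · by_cases hs' : S.peaked s' = true
      · rw [S.unique s' s hs' hss]
      · rw [Bool.not_eq_true] at hs hs'
        have key : ∀ s, S.peaked s = false → (S.P s).U 0 +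
            (S.P s).resp (A s) (S.coeffQ M B h s) (h s) 0 = S.vertexMean M B h (S.vert s) := by
          intro s hs
          obtain ⟨h1, h2, h3, h4, h5, h6⟩ := S.not_peaked s hs
          have : A s = S.vertexMean M B h (S.vert s) - S.coeffQ M B h s / 2 := by
            rw [← congrFun fA s]; simp [nextA, hs]
          simp only [Profile.resp, intervalIntegral.integral_same, h1, h3, h5, this]
          ring
        simp only [key s hs, key s' hs', hss]
  · intro v
    have hpk : ∀ s, S.peaked s = true → (S.P s).dU 0 +
        (S.P s).dresp (A s) (S.coeffQ M B h s) (h s) 0 = 0 := by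
      intro s hs
      obtain ⟨h1, h2⟩ := S.neumann s hs
      have : A s = 0 := by rw [← congrFun fA s]; simp [nextA, hs]
      simp [Profile.dresp, h1, h2, this]
    have hun : ∀ s, S.peaked s = false → (S.P s).dU 0 +
        (S.P s).dresp (A s) (S.coeffQ M B h s) (h s) 0 =
          S.coeffQ M B h s - S.vertexMean M B h (S.vert s) := by
      intro s hs
      obtain ⟨h1, h2, h3, h4, h5, h6⟩ := S.not_peaked s hs
      have : A s = S.vertexMean M B h (S.vert s) - S.coeffQ M B h s / 2 := by
        rw [← congrFun fA s]; simp [nextA, hs]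
      simp only [Profile.dresp, intervalIntegral.integral_same, h2, h4, h6, this]
      ring
    -- A peaked vertex carries a single half-edge, where the derivative vanishes; at any other
    -- vertex the deviations from the mean add up to `0`.
    by_cases hv : ∃ s, S.vert s = v ∧ S.peaked s = true
    · obtain ⟨s, hs, hs'⟩ := hv
      refine Finset.sum_eq_zero fun s' hs1 => ?_
      rw [S.unique s s' hs' ((Finset.mem_filter.1 hs1).2.trans hs.symm)]
      exact hpk s hs'
    · push Not at hv
      rw [Finset.sum_congr rfl fun s hs => hun s (by
        simpa using hv s (Finset.mem_filter.1 hs).2)]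
      have hmean : ∑ s with S.vert s = v, S.vertexMean M B h (S.vert s) =
          ∑ s with S.vert s = v, S.vertexMean M B h v :=
        Finset.sum_congr rfl fun s hs => by rw [(Finset.mem_filter.1 hs).2]
      rw [Finset.sum_sub_distrib, hmean, Finset.sum_const, nsmul_eq_mul]
      rcases (Finset.univ.filter fun s => S.vert s = v).eq_empty_or_nonempty with he | he
      · simp [he]
      · have : ((Finset.univ.filter fun s => S.vert s = v).card : ℝ) ≠ 0 := by
          exact_mod_cast he.card_pos.ne'
        rw [vertexMean]
        field_simp
        ring
  · intro s
    obtain ⟨e1, e2⟩ := S.matching (κ := 1) (A := A) (h := h) hC hmC hMm s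
    rw [fB] at e1 e2
    have v1 : ∀ s, (S.P s).U (M s) + (S.P s).resp (A s) (S.coeffQ M B h s) (h s) (M s) =
        S.midVal M 1 A h s + B s * S.gMid M s := fun s => by
      simp only [Profile.resp, coeffQ, midVal, coeffR, gMid]
      ring
    have v2 : ∀ s, (S.P s).dU (M s) + (S.P s).dresp (A s) (S.coeffQ M B h s) (h s) (M s) =
        S.midDer M 1 A h s + B s * S.dgMid M s := fun s => by
      simp only [Profile.dresp, coeffQ, midDer, coeffR, dgMid]
      ring
    have v1' := v1 (S.bar s)
    have v2' := v2 (S.bar s)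
    rw [hbar s] at v1' v2'
    exact ⟨(v1 s).trans (e1.trans v1'.symm), (v2 s).trans (e2.trans (congrArg Neg.neg v2'.symm))⟩
  · intro s x hx
    simp only [add_sub_cancel_left]
    have e : C * (2 * L * Real.exp (-m)) + C * (2 * L * Real.exp (-m)) +
        2 * C ^ 2 * (η * (2 * L * Real.exp (-m))) =
        2 * L * (2 * C + 2 * C ^ 2 * η) * Real.exp (-m) := by ring
    exact ⟨((hC s).coeff_le (hhc s) hx.1 hx.2 (hν s) (hA s) (hB s) ((hC s).f_exp x hx.1)
      ((hC s).g_exp x hx.1)).trans_eq e, ((hC s).coeff_le (hhc s) hx.1 hx.2 (hν s) (hA s) (hB s)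
      ((hC s).df_exp x hx.1) ((hC s).dg_exp x hx.1)).trans_eq e⟩

end HalfEdges

/-! ### Functions of class `C¹` and weak derivatives -/

lemma ContinuousOn.memLp_two_Icc {l : ℝ} {f : ℝ → ℝ} (hf : ContinuousOn f (Icc 0 l)) :
    MemLp f 2 (volume.restrict (Icc 0 l)) := by
  obtain ⟨K, hK⟩ := isCompact_Icc.exists_bound_of_continuousOn hf
  exact MemLp.of_bound (hf.aestronglyMeasurable measurableSet_Icc) K
    ((ae_restrict_iff' measurableSet_Icc).2 (ae_of_all _ hK))

lemma isWeakDeriv_of_hasDerivAt {l : ℝ} (hl : 0 ≤ l) {f f' : ℝ → ℝ}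
    (hf : ∀ x, HasDerivAt f (f' x) x) (hf' : ContinuousOn f' (Icc 0 l)) : IsWeakDeriv l f f' := by
  intro η hη _ hsupp
  have h0 : η 0 = 0 := image_eq_zero_of_notMem_tsupport fun h => lt_irrefl _ (hsupp h).1
  have h1 : η l = 0 := image_eq_zero_of_notMem_tsupport fun h => lt_irrefl _ (hsupp h).2
  have hd : ∀ x, HasDerivAt η (deriv η x) x := fun x =>
    (hη.differentiable (by simp) x).hasDerivAt
  rw [intervalIntegral.integral_mul_deriv_eq_deriv_mul (fun x _ => hf x) (fun x _ => hd x)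
    (ContinuousOn.intervalIntegrable (by rwa [uIcc_of_le hl]))
    ((hη.continuous_deriv (by simp)).intervalIntegrable _ _), h0, h1]
  ring

lemma memH1Interval_of_hasDerivAt {l : ℝ} (hl : 0 ≤ l) {f f' : ℝ → ℝ}
    (hf : ∀ x, HasDerivAt f (f' x) x) (hf' : ContinuousOn f' (Icc 0 l)) : MemH1Interval l f :=
  ⟨ContinuousOn.memLp_two_Icc fun x _ => (hf x).continuousAt.continuousWithinAt,
    f', hf'.memLp_two_Icc, isWeakDeriv_of_hasDerivAt hl hf hf'⟩

/-- The fundamental lemma of the calculus of variations. It identifies the chosen `weakDeriv` with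
the classical derivative in the norm. -/
lemma IsWeakDeriv.ae_eq {l : ℝ} (hl : 0 ≤ l) {f g g' : ℝ → ℝ} (h : IsWeakDeriv l f g)
    (h' : IsWeakDeriv l f g') (hg : MemLp g 2 (volume.restrict (Icc 0 l)))
    (hg' : MemLp g' 2 (volume.restrict (Icc 0 l))) :
    ∀ᵐ x, x ∈ Ioo 0 l → g x = g' x := by
  have hi : IntegrableOn g (Icc 0 l) := hg.integrable (by norm_num)
  have hi' : IntegrableOn g' (Icc 0 l) := hg'.integrable (by norm_num)
  have key := isOpen_Ioo.ae_eq_zero_of_integral_contDiff_smul_eq_zero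
    (f := g - g') (U := Ioo 0 l) (μ := volume)
    (((hi.sub hi').mono_set Ioo_subset_Icc_self).locallyIntegrableOn) ?_
  · filter_upwards [key] with x hx hxl
    exact sub_eq_zero.1 (hx hxl)
  · intro η hη hc hs
    have e1 := h η hη hc hs
    have e2 := h' η hη hc hs
    have hb : ∃ K, ∀ x, ‖η x‖ ≤ K := hc.exists_bound_of_continuous hη.continuous
    obtain ⟨K, hK⟩ := hb
    have hmul : ∀ w : ℝ → ℝ, IntegrableOn w (Icc 0 l) →
        IntervalIntegrable (fun x => w x * η x) volume 0 l := fun w hw => by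
      rw [intervalIntegrable_iff_integrableOn_Icc_of_le hl]
      exact Integrable.mul_bdd hw hη.continuous.aestronglyMeasurable (ae_of_all _ hK)
    have e3 : ∫ x in (0 : ℝ)..l, (g x * η x - g' x * η x) = 0 := by
      rw [intervalIntegral.integral_sub (hmul g hi) (hmul g' hi')]
      linarith
    have e4 : ∫ x, η x • (g - g') x = ∫ x in Ioc 0 l, η x • (g - g') x := by
      refine (setIntegral_eq_integral_of_forall_compl_eq_zero fun x hx => ?_).symm
      rw [image_eq_zero_of_notMem_tsupport fun h => hx ⟨(hs h).1, (hs h).2.le⟩, zero_smul]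
    rw [e4, ← intervalIntegral.integral_of_le hl]
    refine (intervalIntegral.integral_congr fun x _ => ?_).trans e3
    simp only [smul_eq_mul, Pi.sub_apply]
    ring

lemma weakDeriv_ae_eq {l : ℝ} (hl : 0 ≤ l) {f f' : ℝ → ℝ}
    (hf : ∀ x, HasDerivAt f (f' x) x) (hf' : ContinuousOn f' (Icc 0 l)) :
    ∀ᵐ x, x ∈ Ioo 0 l → weakDeriv l f x = f' x := by
  have h : HasL2WeakDeriv l f := (memH1Interval_of_hasDerivAt hl hf hf').2
  have e : weakDeriv l f = h.choose := by simp [weakDeriv, h]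
  rw [e]
  exact h.choose_spec.2.ae_eq hl (isWeakDeriv_of_hasDerivAt hl hf hf') h.choose_spec.1
    hf'.memLp_two_Icc

lemma integral_weakDeriv_mul_self {l : ℝ} (hl : 0 ≤ l) {f f' : ℝ → ℝ}
    (hf : ∀ x, HasDerivAt f (f' x) x) (hf' : ContinuousOn f' (Icc 0 l)) :
    ∫ x in (0 : ℝ)..l, weakDeriv l f x * weakDeriv l f x = ∫ x in (0 : ℝ)..l, f' x * f' x := by
  refine intervalIntegral.integral_congr_ae ?_
  have hne : ∀ᵐ x : ℝ, x ≠ l := by simp [ae_iff, measure_singleton]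
  filter_upwards [weakDeriv_ae_eq hl hf hf', hne] with x hx hxl hm
  rw [uIoc_of_le hl] at hm
  rw [hx ⟨hm.1, lt_of_le_of_ne hm.2 hxl⟩]

/-! ### One-dimensional lemmas for the positivity of solutions -/

lemma nonneg_of_hasDerivAt_of_min_left {f : ℝ → ℝ} {d a b : ℝ} (hab : a < b)
    (hf : HasDerivAt f d a) (hmin : ∀ x ∈ Icc a b, f a ≤ f x) : 0 ≤ d := by
  have h := (hasDerivWithinAt_iff_tendsto_slope' (s := Ioi a) (by simp)).1 hf.hasDerivWithinAt
  refine ge_of_tendsto h ?_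
  filter_upwards [Ioo_mem_nhdsGT hab] with x hx
  rw [slope_def_field]
  exact div_nonneg (sub_nonneg.2 (hmin x ⟨hx.1.le, hx.2.le⟩)) (sub_nonneg.2 hx.1.le)

lemma hasDerivAt_comp_neg {f : ℝ → ℝ} {d x : ℝ} (hf : HasDerivAt f d (-x)) :
    HasDerivAt (fun y => f (-y)) (-d) x := by
  exact (hf.comp x (hasDerivAt_neg x)).congr_deriv (by ring)

lemma nonpos_of_hasDerivAt_of_min_right {f : ℝ → ℝ} {d a b : ℝ} (hab : a < b)
    (hf : HasDerivAt f d b) (hmin : ∀ x ∈ Icc a b, f b ≤ f x) : d ≤ 0 := by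
  have h : HasDerivAt (fun y => f (-y)) (-d) (-b) := hasDerivAt_comp_neg (by rwa [neg_neg])
  have := nonneg_of_hasDerivAt_of_min_left (neg_lt_neg hab) h fun x hx => by
    rw [neg_neg]
    exact hmin (-x) ⟨by linarith [hx.2], by linarith [hx.1]⟩
  linarith

/-- At a one-sided minimum where the derivative vanishes the second derivative is nonnegative. -/
lemma second_deriv_nonneg_of_min_left {f f' : ℝ → ℝ} {c a b : ℝ} (hab : a < b)
    (hf : ∀ x, HasDerivAt f (f' x) x) (h0 : f' a = 0) (hf' : HasDerivAt f' c a)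
    (hmin : ∀ x ∈ Icc a b, f a ≤ f x) : 0 ≤ c := by
  by_contra! hc
  have h := (hasDerivWithinAt_iff_tendsto_slope' (s := Ioi a) (by simp)).1 hf'.hasDerivWithinAt
  have h1 := h.eventually (gt_mem_nhds hc)
  obtain ⟨d, hd, hsub⟩ := mem_nhdsGT_iff_exists_Ioo_subset.1 h1
  have had : a < min b d := lt_min hab hd
  obtain ⟨y, hy, hy'⟩ := exists_hasDerivAt_eq_slope f f' had
    (fun x _ => (hf x).continuousAt.continuousWithinAt) fun x _ => hf x
  have h2 : slope f' a y < 0 := hsub ⟨hy.1, hy.2.trans_le (min_le_right _ _)⟩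
  rw [slope_def_field, h0, sub_zero] at h2
  have h3 : f' y < 0 := by
    rcases div_neg_iff.1 h2 with h | h
    · linarith [hy.1, h.2]
    · exact h.1
  rw [hy', div_neg_iff] at h3
  have h4 := hmin (min b d) ⟨had.le, min_le_left _ _⟩
  rcases h3 with h | h <;> linarith [h.1, h.2]

lemma second_deriv_nonneg_of_min {f f' : ℝ → ℝ} {c a b x : ℝ} (hab : a < b) (hx : x ∈ Icc a b)
    (hf : ∀ x, HasDerivAt f (f' x) x) (h0 : f' x = 0) (hf' : HasDerivAt f' c x)
    (hmin : ∀ y ∈ Icc a b, f x ≤ f y) : 0 ≤ c := by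
  rcases hx.2.lt_or_eq with h | h
  · exact second_deriv_nonneg_of_min_left h hf h0 hf' fun y hy => hmin y ⟨hx.1.trans hy.1, hy.2⟩
  -- At the right endpoint there is nothing to the right, so the reflected function is used.
  · subst h
    refine second_deriv_nonneg_of_min_left (f := fun y => f (-y)) (f' := fun y => -f' (-y))
      (neg_lt_neg hab) (fun y => hasDerivAt_comp_neg (hf (-y))) (by simp [h0]) ?_ fun y hy => ?_
    · have := (hasDerivAt_comp_neg (f := f') (d := c) (x := -x) (by rwa [neg_neg])).fun_neg
      simpa using this
    · simp only [neg_neg]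
      exact hmin (-y) ⟨by linarith [hy.2], by linarith [hy.1]⟩

/-- Uniqueness for a linear differential inequality. -/
lemma eq_zero_of_norm_deriv_le {y y' : ℝ → ℝ × ℝ} {a b x₀ K : ℝ} (hx₀ : x₀ ∈ Icc a b)
    (hy : ∀ x ∈ Icc a b, HasDerivAt y (y' x) x) (hb : ∀ x ∈ Icc a b, ‖y' x‖ ≤ K * ‖y x‖)
    (h0 : y x₀ = 0) : ∀ x ∈ Icc a b, y x = 0 := by
  intro x hx
  rcases le_total x₀ x with h | h
  · exact eq_zero_of_abs_deriv_le_mul_abs_self_of_eq_zero_right (a := x₀) (b := b) (K := K)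
      (fun z hz => (hy z ⟨hx₀.1.trans hz.1, hz.2⟩).continuousAt.continuousWithinAt)
      (fun z hz => (hy z ⟨hx₀.1.trans hz.1, hz.2.le⟩).hasDerivWithinAt) h0
      (fun z hz => hb z ⟨hx₀.1.trans hz.1, hz.2.le⟩) x ⟨h, hx.2⟩
  · have hd : ∀ z ∈ Icc (-x₀) (-a), HasDerivAt (fun z => y (-z)) (-y' (-z)) z := fun z hz => by
      exact ((hy (-z) ⟨by linarith [hz.2], by linarith [hz.1, hx₀.2]⟩).scomp z
        (hasDerivAt_neg z)).congr_deriv (by simp)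
    have := eq_zero_of_abs_deriv_le_mul_abs_self_of_eq_zero_right (a := -x₀) (b := -a) (K := K)
      (f := fun z => y (-z)) (f' := fun z => -y' (-z))
      (fun z hz => (hd z hz).continuousAt.continuousWithinAt)
      (fun z hz => (hd z ⟨hz.1, hz.2.le⟩).hasDerivWithinAt) (by simpa using h0)
      (fun z hz => by
        rw [norm_neg]
        exact hb (-z) ⟨by linarith [hz.2], by linarith [hz.1, hx₀.2]⟩) (-x)
      ⟨by linarith, by linarith [hx.1]⟩
    simpa using this

/-! ### Minimum principle and positivity on the graph. -/

namespace MetricGraph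

variable {V E : Type*} [DecidableEq V] [Fintype E] (G : MetricGraph V E)

/-- At a point where a function on the graph with Kirchhoff conditions attains a lower bound, its
derivative vanishes. -/
lemma deriv_eq_zero_of_min {u v : E → ℝ → ℝ} {c : V → ℝ} {μ : ℝ}
    (hu : ∀ e x, HasDerivAt (u e) (v e x) x)
    (hc : ∀ e, u e 0 = c (G.src e) ∧ u e (G.len e) = c (G.tgt e))
    (hK : ∀ w, ∑ e, ((if G.src e = w then v e 0 else 0) +
      (if G.tgt e = w then -v e (G.len e) else 0)) = 0)
    (hμ : ∀ e, ∀ x ∈ Icc 0 (G.len e), μ ≤ u e x) {e : E} {x : ℝ} (hx : x ∈ Icc 0 (G.len e))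
    (hux : u e x = μ) : v e x = 0 := by
  -- At a minimising vertex every outgoing derivative is nonnegative; the Kirchhoff sum being zero,
  -- each of them vanishes.
  have hl : ∀ e w, c w = μ → 0 ≤ (if G.src e = w then v e 0 else 0) := fun e w hw => by
    split_ifs with h
    · refine nonneg_of_hasDerivAt_of_min_left (G.len_pos e) (hu e 0) fun y hy => ?_
      rw [(hc e).1, h, hw]
      exact hμ e y hy
    · exact le_rfl
  have hr : ∀ e w, c w = μ → 0 ≤ (if G.tgt e = w then -v e (G.len e) else 0) := fun e w hw => by
    split_ifs with h
    · refine neg_nonneg.2 (nonpos_of_hasDerivAt_of_min_right (G.len_pos e) (hu e _) fun y hy => ?_)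
      rw [(hc e).2, h, hw]
      exact hμ e y hy
    · exact le_rfl
  have hz : ∀ w, c w = μ → (if G.src e = w then v e 0 else 0) = 0 ∧
      (if G.tgt e = w then -v e (G.len e) else 0) = 0 := fun w hw => by
    have h1 := (Finset.sum_eq_zero_iff_of_nonneg fun e _ => add_nonneg (hl e w hw) (hr e w hw)).1
      (hK w) e (Finset.mem_univ e)
    have h2 := hl e w hw
    have h3 := hr e w hw
    constructor <;> linarith
  rcases hx.1.eq_or_lt with h | h
  · subst h
    simpa using (hz (G.src e) ((hc e).1.symm.trans hux)).1
  rcases hx.2.eq_or_lt with h' | h'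
  · subst h'
    simpa using (hz (G.tgt e) ((hc e).2.symm.trans hux)).2
  · have hmin : IsLocalMin (u e) x := by
      filter_upwards [Icc_mem_nhds h h'] with y hy
      rw [hux]
      exact hμ e y hy
    exact hmin.hasDerivAt_eq_zero (hu e x)

/-- Positivity of the solutions whose negative part is small. -/
theorem pos_of_solution (hG : G.Connected) {u v : E → ℝ → ℝ} {c : V → ℝ} {lam p : ℝ} (hp : 1 < p)
    (hu : ∀ e x, HasDerivAt (u e) (v e x) x)
    (hv : ∀ e, ∀ x ∈ Icc 0 (G.len e), HasDerivAt (v e) (lam * u e x - powNL p (u e x)) x)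
    (hc : ∀ e, u e 0 = c (G.src e) ∧ u e (G.len e) = c (G.tgt e))
    (hK : ∀ w, ∑ e, ((if G.src e = w then v e 0 else 0) +
      (if G.tgt e = w then -v e (G.len e) else 0)) = 0)
    (hsmall : ∀ e, ∀ x ∈ Icc 0 (G.len e), u e x < 0 → |u e x| ^ (p - 1) < lam)
    (hne : ∃ e, ∃ x ∈ Icc 0 (G.len e), u e x ≠ 0) :
    ∀ e, ∀ x ∈ Icc 0 (G.len e), 0 < u e x := by
  have hnn : ∀ e, ∀ x ∈ Icc 0 (G.len e), 0 ≤ u e x := by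
    have hne' : Nonempty E := ⟨hne.choose⟩
    have hmin : ∀ e, ∃ x ∈ Icc 0 (G.len e), ∀ y ∈ Icc 0 (G.len e), u e x ≤ u e y := fun e =>
      isCompact_Icc.exists_isMinOn (nonempty_Icc.2 (G.len_pos e).le)
        fun x _ => (hu e x).continuousAt.continuousWithinAt
    choose x hx hxm using hmin
    obtain ⟨e₀, he₀⟩ := Finite.exists_min fun e => u e (x e)
    have hμ : ∀ e, ∀ y ∈ Icc 0 (G.len e), u e₀ (x e₀) ≤ u e y := fun e y hy =>
      (he₀ e).trans (hxm e y hy)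
    by_contra! hcon
    obtain ⟨e, y, hy, hneg⟩ := hcon
    have hneg' : u e₀ (x e₀) < 0 := (hμ e y hy).trans_lt hneg
    have h0 := G.deriv_eq_zero_of_min hu hc hK hμ (hx e₀) rfl
    have h1 := second_deriv_nonneg_of_min (G.len_pos e₀) (hx e₀) (hu e₀) h0
      (hv e₀ _ (hx e₀)) (hμ e₀)
    -- At a negative minimum `u'' = (λ - |u| ^ (p - 1)) u < 0`, contradicting the second-order
    -- condition.
    have h2 := hsmall e₀ _ (hx e₀) hneg'
    simp only [powNL] at h1
    nlinarith
  -- A zero is now a minimum, hence a double zero, and uniqueness for the first-order system spreads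
  -- it over the edge; connectedness then spreads it over the graph.
  have hzero : ∀ e, ∀ x ∈ Icc 0 (G.len e), u e x = 0 → ∀ y ∈ Icc 0 (G.len e), u e y = 0 := by
    intro e x hx h0 y hy
    have hv0 := G.deriv_eq_zero_of_min hu hc hK hnn hx h0
    obtain ⟨K, hK⟩ := isCompact_Icc.exists_bound_of_continuousOn (s := Icc 0 (G.len e))
      (f := fun x => lam - |u e x| ^ (p - 1)) fun x _ =>
        (continuousAt_const.sub ((hu e x).continuousAt.abs.rpow_const
          (Or.inr (by linarith)))).continuousWithinAt
    have := eq_zero_of_norm_deriv_le (y := fun x => (u e x, v e x))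
      (y' := fun x => (v e x, lam * u e x - powNL p (u e x))) (K := max 1 K) hx
      (fun x hx => (hu e x).prodMk (hv e x hx)) (fun x hx => ?_) (by simp [h0, hv0]) y hy
    · exact congrArg Prod.fst this
    · rw [Prod.norm_def, Prod.norm_def]
      simp only
      have hm : 0 ≤ max 1 K := zero_le_one.trans (le_max_left _ _)
      refine max_le ?_ ?_
      · calc ‖v e x‖ = 1 * ‖v e x‖ := (one_mul _).symm
          _ ≤ _ := mul_le_mul (le_max_left _ _) (le_max_right _ _) (norm_nonneg _) hm
      · calc ‖lam * u e x - powNL p (u e x)‖ = ‖lam - |u e x| ^ (p - 1)‖ * ‖u e x‖ := by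
              rw [← norm_mul, powNL]; congr 1; ring
          _ ≤ _ := mul_le_mul ((hK x hx).trans (le_max_right _ _)) (le_max_left _ _)
            (norm_nonneg _) hm
  have h0mem : ∀ e, (0 : ℝ) ∈ Icc 0 (G.len e) := fun e => ⟨le_rfl, (G.len_pos e).le⟩
  have hlmem : ∀ e, G.len e ∈ Icc 0 (G.len e) := fun e => ⟨(G.len_pos e).le, le_rfl⟩
  intro e x hx
  refine (hnn e x hx).lt_of_ne fun hx0 => ?_
  have hc0 : c (G.src e) = 0 := (hc e).1.symm.trans (hzero e x hx hx0.symm 0 (h0mem e))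
  have hadj : ∀ w w', (SimpleGraph.fromRel fun v w : V => ∃ e, G.src e = v ∧ G.tgt e = w).Adj w w' →
      c w = 0 → c w' = 0 := by
    intro w w' h hw
    rw [SimpleGraph.fromRel_adj] at h
    rcases h.2 with ⟨e, h1, h2⟩ | ⟨e, h1, h2⟩
    · rw [← h2, ← (hc e).2]
      exact hzero e 0 (h0mem e) (by rw [(hc e).1, h1, hw]) _ (hlmem e)
    · rw [← h1, ← (hc e).1]
      exact hzero e _ (hlmem e) (by rw [(hc e).2, h2, hw]) _ (h0mem e)
  have hall : ∀ w, c w = 0 := fun w => by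
    obtain ⟨walk⟩ := hG.preconnected (G.src e) w
    revert hc0
    generalize G.src e = w₀ at walk
    intro hc0
    induction walk with
    | nil => exact hc0
    | cons h _ ih => exact ih (hadj _ _ h hc0)
  obtain ⟨e', y, hy, hy'⟩ := hne
  exact hy' (hzero e' 0 (h0mem e') (by rw [(hc e').1, hall]) y hy)

end MetricGraph

/-! ### From half-edges to the graph: gluing and rescaling. -/

lemma hasDerivAt_ite_le {f g f' g' : ℝ → ℝ} {m x : ℝ} (hf : x ≤ m → HasDerivAt f (f' x) x)
    (hg : m ≤ x → HasDerivAt g (g' x) x) (h : f m = g m) (h' : f' m = g' m) :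
    HasDerivAt (fun x => if x ≤ m then f x else g x) (if x ≤ m then f' x else g' x) x := by
  rcases lt_trichotomy x m with hx | hx | hx
  · rw [if_pos hx.le]
    refine (hf hx.le).congr_of_eventuallyEq ?_
    filter_upwards [Iio_mem_nhds hx] with y hy
    rw [if_pos (le_of_lt hy)]
  · subst hx
    rw [if_pos le_rfl, ← hasDerivWithinAt_univ, ← Iic_union_Ici (a := x)]
    refine HasDerivWithinAt.union ((hf le_rfl).hasDerivWithinAt.congr (fun y hy => if_pos hy)
      (if_pos le_rfl)) ?_
    have hg' : HasDerivWithinAt g (f' x) (Ici x) x := by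
      rw [h']; exact (hg le_rfl).hasDerivWithinAt
    refine hg'.congr (fun y hy => ?_) (by simp [h])
    rcases (show x ≤ y from hy).eq_or_lt with e | e
    · subst e; simp [h]
    · rw [if_neg (not_le.2 e)]
  · rw [if_neg (not_le.2 hx)]
    refine (hg hx.le).congr_of_eventuallyEq ?_
    filter_upwards [Ioi_mem_nhds hx] with y hy
    rw [if_neg (not_le.2 hy)]

namespace MetricGraph

variable {V E : Type*} (G : MetricGraph V E)

/-- The vertex of a half-edge. -/
def halfVert (s : E × Bool) : V := if s.2 then G.tgt s.1 else G.src s.1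

/-- A vertex of degree one carries a single half-edge. -/
lemma eq_of_degree_eq_one [Finite E] {w : V} (h : G.degree w = 1) {s s' : E × Bool}
    (hs : G.halfVert s = w) (hs' : G.halfVert s' = w) : s' = s := by
  obtain ⟨e, b⟩ := s
  obtain ⟨e', b'⟩ := s'
  unfold degree at h
  have hsub : ∀ (q : E → V) (e e' : E), q e = w → q e' = w → Nat.card {e : E // q e = w} ≤ 1 →
      e' = e := fun q e e' he he' hq => by
    have := Finite.card_le_one_iff_subsingleton.1 hq
    exact congrArg Subtype.val (Subsingleton.elim (⟨e', he'⟩ : {e : E // q e = w}) ⟨e, he⟩)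
  have hpos : ∀ (q : E → V) (e : E), q e = w → 0 < Nat.card {e : E // q e = w} := fun q e he => by
    have : Nonempty {e : E // q e = w} := ⟨⟨e, he⟩⟩
    exact Nat.card_pos
  cases b <;> cases b' <;> simp only [halfVert, Bool.false_eq_true, if_true, if_false] at hs hs'
  · rw [hsub _ _ _ hs hs' (by omega)]
  · have := hpos _ _ hs
    have := hpos _ _ hs'
    omega
  · have := hpos _ _ hs
    have := hpos _ _ hs'
    omega
  · rw [hsub _ _ _ hs hs' (by omega)]

/-- Degree counts half-edges: this gives each peak a half-edge and counts the solitons in the mass.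
-/
lemma sum_halfVert_eq_degree [Fintype E] [DecidableEq V] (w : V) (J : ℝ) :
    ∑ s : E × Bool, (if G.halfVert s = w then J else 0) = G.degree w * J := by
  rw [Fintype.sum_prod_type]
  simp only [Fintype.sum_bool, halfVert, if_true, Bool.false_eq_true, if_false]
  rw [Finset.sum_add_distrib, ← Finset.sum_filter, ← Finset.sum_filter, Finset.sum_const,
    Finset.sum_const, degree, Nat.card_eq_fintype_card, Nat.card_eq_fintype_card,
    Fintype.card_subtype, Fintype.card_subtype]
  push_cast [nsmul_eq_mul]
  ring

/-- The profile at a half-edge: the soliton at the vertices `v i`. -/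
def halfProfile [DecidableEq V] {p : ℝ} (hp : 1 < p) {k : ℕ} (v : Fin k → V) (s : E × Bool) :
    Profile p :=
  if ∃ i, v i = G.halfVert s then solitonProfile hp else zeroProfile hp

/-- The half-edges of a metric graph, with solitons at the vertices `v i` of degree one. -/
def halfEdges [Finite E] [DecidableEq V] {p : ℝ} (hp : 1 < p) {k : ℕ} (v : Fin k → V)
    (hdeg : ∀ i, G.degree (v i) = 1) : HalfEdges p (E × Bool) V where
  P := G.halfProfile hp v
  bar s := (s.1, !s.2)
  vert := G.halfVert
  peaked s := decide (∃ i, v i = G.halfVert s)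
  bar_bar s := by simp
  not_peaked s hs := by
    rw [halfProfile, if_neg (of_decide_eq_false hs)]
    simp [zeroProfile]
  neumann s hs := by
    rw [halfProfile, if_pos (of_decide_eq_true hs)]
    simp [solitonProfile, tanhScaled_zero, coshPowInt]
  unique s s' hs hss := by
    obtain ⟨i, hi⟩ := of_decide_eq_true hs
    exact G.eq_of_degree_eq_one (hdeg i) hi.symm (hss.trans hi.symm)

lemma exists_halfProfile_isBdd [DecidableEq V] {p : ℝ} (hp : 1 < p) {k : ℕ} (v : Fin k → V) :
    ∃ C, 1 ≤ C ∧ ∀ s, (G.halfProfile hp v s).IsBdd C := by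
  obtain ⟨C, hC⟩ := exists_solitonProfile_isBdd hp
  refine ⟨max C 2, hC.one_le.trans (le_max_left _ _), fun s => ?_⟩
  unfold halfProfile
  split_ifs
  · exact hC.mono (le_max_left _ _)
  · exact (zeroProfile_isBdd hp).mono (le_max_right _ _)

/-- The function on the graph made of functions on the (rescaled) half-edges. -/
def glue (Λ μ : ℝ) (w : E × Bool → ℝ → ℝ) (e : E) (x : ℝ) : ℝ :=
  if x ≤ G.len e / 2 then Λ * w (e, false) (μ * x) else Λ * w (e, true) (μ * (G.len e - x))

/-- The derivative of `glue`. -/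
def dglue (Λ μ : ℝ) (dw : E × Bool → ℝ → ℝ) (e : E) (x : ℝ) : ℝ :=
  if x ≤ G.len e / 2 then Λ * (μ * dw (e, false) (μ * x))
  else -(Λ * (μ * dw (e, true) (μ * (G.len e - x))))

variable {G} {Λ μ : ℝ} {w dw : E × Bool → ℝ → ℝ}

lemma hasDerivAt_rescale {f : ℝ → ℝ} {d x : ℝ} (μ : ℝ) (h : HasDerivAt f d (μ * x)) :
    HasDerivAt (fun y => f (μ * y)) (μ * d) x := by
  have h1 : HasDerivAt (fun y : ℝ => μ * y) μ x := by simpa using (hasDerivAt_id x).const_mul μ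
  exact (h.comp x h1).congr_deriv (mul_comm _ _)

lemma hasDerivAt_reflect {f : ℝ → ℝ} {d x : ℝ} (l : ℝ) (h : HasDerivAt f d (l - x)) :
    HasDerivAt (fun y => f (l - y)) (-d) x := by
  have h1 : HasDerivAt (fun y : ℝ => l - y) (-1) x := (hasDerivAt_id x).const_sub l
  exact (h.comp x h1).congr_deriv (by ring)

lemma hasDerivAt_glue (hw : ∀ s x, HasDerivAt (w s) (dw s x) x)
    (hmid : ∀ e, w (e, false) (μ * (G.len e / 2)) = w (e, true) (μ * (G.len e / 2)) ∧
      dw (e, false) (μ * (G.len e / 2)) = -dw (e, true) (μ * (G.len e / 2))) (e : E) (x : ℝ) :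
    HasDerivAt (G.glue Λ μ w e) (G.dglue Λ μ dw e x) x := by
  have hm : G.len e - G.len e / 2 = G.len e / 2 := by ring
  refine hasDerivAt_ite_le (f := fun x => Λ * w (e, false) (μ * x))
    (g := fun x => Λ * w (e, true) (μ * (G.len e - x)))
    (f' := fun x => Λ * (μ * dw (e, false) (μ * x)))
    (g' := fun x => -(Λ * (μ * dw (e, true) (μ * (G.len e - x)))))
    (fun _ => (hasDerivAt_rescale μ (hw _ _)).const_mul Λ) (fun _ => ?_) ?_ ?_
  · exact ((hasDerivAt_reflect (G.len e) (hasDerivAt_rescale μ (hw (e, true) _))).const_mul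
      Λ).congr_deriv (by ring)
  · simp only [hm, (hmid e).1]
  · simp only [hm, (hmid e).2]
    ring

/-- The scalings `Λ ^ (p - 1) = λ = μ²` give both terms the same factor. Second derivatives match at
the midpoint because the values do, through the equation. -/
lemma hasDerivAt_dglue {p lam : ℝ} (hΛ : 0 ≤ Λ) (hμ : 0 ≤ μ) (hΛp : Λ ^ (p - 1) = lam)
    (hμl : μ * μ = lam)
    (hdw : ∀ s : E × Bool, ∀ x ∈ Icc 0 (μ * (G.len s.1 / 2)),
      HasDerivAt (dw s) (w s x - powNL p (w s x)) x)
    (hmid : ∀ e, w (e, false) (μ * (G.len e / 2)) = w (e, true) (μ * (G.len e / 2)) ∧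
      dw (e, false) (μ * (G.len e / 2)) = -dw (e, true) (μ * (G.len e / 2))) (e : E) {x : ℝ}
    (hx : x ∈ Icc 0 (G.len e)) :
    HasDerivAt (G.dglue Λ μ dw e) (lam * G.glue Λ μ w e x - powNL p (G.glue Λ μ w e x)) x := by
  have hm : G.len e - G.len e / 2 = G.len e / 2 := by ring
  have key : lam * G.glue Λ μ w e x - powNL p (G.glue Λ μ w e x) =
      if x ≤ G.len e / 2 then
        Λ * (μ * (μ * (w (e, false) (μ * x) - powNL p (w (e, false) (μ * x)))))
      else Λ * (μ * (μ * (w (e, true) (μ * (G.len e - x)) -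
        powNL p (w (e, true) (μ * (G.len e - x)))))) := by
    unfold glue
    split_ifs
    all_goals
      rw [powNL_mul hΛ, hΛp, ← hμl]
      ring
  rw [key]
  refine hasDerivAt_ite_le (f := fun x => Λ * (μ * dw (e, false) (μ * x)))
    (g := fun x => -(Λ * (μ * dw (e, true) (μ * (G.len e - x)))))
    (f' := fun x => Λ * (μ * (μ * (w (e, false) (μ * x) - powNL p (w (e, false) (μ * x))))))
    (g' := fun x => Λ * (μ * (μ * (w (e, true) (μ * (G.len e - x)) -
        powNL p (w (e, true) (μ * (G.len e - x)))))))
    (fun h => ?_) (fun h => ?_) ?_ ?_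
  · exact ((hasDerivAt_rescale μ (hdw (e, false) _ ⟨mul_nonneg hμ hx.1,
      mul_le_mul_of_nonneg_left h hμ⟩)).const_mul μ).const_mul Λ
  · have h1 := hdw (e, true) (μ * (G.len e - x)) ⟨mul_nonneg hμ (by linarith [hx.2]),
      mul_le_mul_of_nonneg_left (by simp only; linarith) hμ⟩
    exact (((hasDerivAt_reflect (G.len e) (hasDerivAt_rescale μ h1)).const_mul
      μ).const_mul Λ).neg.congr_deriv (by ring)
  · simp only [hm, (hmid e).2]
    ring
  · simp only [hm, (hmid e).1]

variable (G) in
/-- Existence of solutions close to the profiles, in rescaled coordinates on the half-edges. -/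
theorem exists_halfEdge_solution [Fintype E] [DecidableEq V] {p : ℝ} (hp : 1 < p) {k : ℕ}
    (v : Fin k → V) (hdeg : ∀ i, G.degree (v i) = 1) {d : ℝ} (hd0 : 0 < d)
    (hd : ∀ e, d ≤ G.len e / 2) :
    ∃ K μ₀ : ℝ, 0 < K ∧ ∀ μ : ℝ, μ₀ ≤ μ → 0 < μ → ∃ w dw : E × Bool → ℝ → ℝ,
      (∀ s x, HasDerivAt (w s) (dw s x) x) ∧
      (∀ s, ∀ x ∈ Icc 0 (μ * (G.len s.1 / 2)), HasDerivAt (dw s) (w s x - powNL p (w s x)) x) ∧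
      (∀ s s', G.halfVert s = G.halfVert s' → w s 0 = w s' 0) ∧
      (∀ v, ∑ s with G.halfVert s = v, dw s 0 = 0) ∧
      (∀ e, w (e, false) (μ * (G.len e / 2)) = w (e, true) (μ * (G.len e / 2)) ∧
        dw (e, false) (μ * (G.len e / 2)) = -dw (e, true) (μ * (G.len e / 2))) ∧
      ∀ s, ∀ x ∈ Icc 0 (μ * (G.len s.1 / 2)),
        |w s x - (G.halfProfile hp v s).U x| ≤ K * Real.exp (-(d * μ)) ∧
        |dw s x - (G.halfProfile hp v s).dU x| ≤ K * Real.exp (-(d * μ)) := by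
  obtain ⟨C, hC1, hC⟩ := G.exists_halfProfile_isBdd hp v
  obtain ⟨K, m₀, hK, H⟩ := (G.halfEdges hp v hdeg).exists_solution hp hC1 hC
  refine ⟨K, m₀ / d, hK, fun μ hμ hμ0 => ?_⟩
  obtain ⟨w, dw, h1, h2, h3, h4, h5, h6⟩ := H (fun s => μ * (G.len s.1 / 2)) (d * μ)
    (fun s => rfl) (by rw [div_le_iff₀ hd0] at hμ; linarith)
    (fun s => by rw [mul_comm]; exact mul_le_mul_of_nonneg_left (hd s.1) hμ0.le)
  exact ⟨w, dw, h1, h2, h3, h4, fun e => h5 (e, false), h6⟩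

end MetricGraph

/-! ### Cut-off errors and the approximate solution. -/

lemma IsCutoff.hasDerivAt {δ : ℝ} {χ : ℝ → ℝ} (hχ : IsCutoff δ χ) (x : ℝ) :
    HasDerivAt χ (deriv χ x) x :=
  (hχ.1.differentiable (by simp) x).hasDerivAt

/-- Nothing is known of `χ` at negative arguments, so at `x = 0` the derivative is read from the
right. -/
lemma IsCutoff.deriv_eq_zero {δ : ℝ} {χ : ℝ → ℝ} (hχ : IsCutoff δ χ) {x : ℝ} (h0 : 0 ≤ x)
    (hx : x < δ / 2) : deriv χ x = 0 := by
  have h1 : HasDerivWithinAt χ 0 (Icc x (δ / 2)) x :=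
    (hasDerivWithinAt_const x _ (1 : ℝ)).congr (fun y hy => hχ.2.1 y (h0.trans hy.1) hy.2)
      (hχ.2.1 x h0 hx.le)
  exact (uniqueDiffOn_Icc hx x ⟨le_rfl, hx.le⟩).eq_deriv _ (hχ.hasDerivAt x).hasDerivWithinAt h1

/-- Cutting off a decaying profile produces an exponentially small error. -/
lemma IsCutoff.exists_error_le {δ p C : ℝ} {χ : ℝ → ℝ} (hχ : IsCutoff δ χ)
    {P : Profile p} (hP : P.IsBdd C) (L : ℝ) :
    ∃ K, 0 ≤ K ∧ ∀ μ, 1 ≤ μ → ∀ x ∈ Icc 0 L,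
      |χ x * P.U (μ * x) - P.U (μ * x)| ≤ K * Real.exp (-(δ / 2 * μ)) ∧
      |deriv χ x * P.U (μ * x) + χ x * (μ * P.dU (μ * x)) - μ * P.dU (μ * x)| ≤
        K * (μ * Real.exp (-(δ / 2 * μ))) := by
  obtain ⟨K₁, hK₁⟩ := (isCompact_Icc (a := 0) (b := L)).exists_bound_of_continuousOn
    hχ.1.continuous.continuousOn
  obtain ⟨K₂, hK₂⟩ := (isCompact_Icc (a := 0) (b := L)).exists_bound_of_continuousOn
    (hχ.1.continuous_deriv (by simp)).continuousOn
  have hC := hP.pos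
  refine ⟨(|K₁| + 1 + |K₂|) * C, by positivity, fun μ hμ x hx => ?_⟩
  have hμ0 : 0 < μ := by linarith
  -- Before `δ / 2` the cut-off changes nothing; beyond it the profile is already of size `e ^ (-δ μ
  -- / 2)`.
  rcases lt_or_ge x (δ / 2) with h | h
  · rw [hχ.2.1 x hx.1 h.le, hχ.deriv_eq_zero hx.1 h]
    simp only [one_mul, sub_self, abs_zero, zero_mul, zero_add]
    constructor <;> positivity
  · have hexp : Real.exp (-(μ * x)) ≤ Real.exp (-(δ / 2 * μ)) := by
      apply Real.exp_le_exp.2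
      nlinarith
    have hU := hP.U_exp (μ * x) (mul_nonneg hμ0.le hx.1)
    have hdU := hP.dU_exp (μ * x) (mul_nonneg hμ0.le hx.1)
    set ε := Real.exp (-(δ / 2 * μ))
    have hε : 0 < ε := Real.exp_pos _
    have hU' : |P.U (μ * x)| ≤ C * ε := hU.trans (by gcongr)
    have hdU' : |P.dU (μ * x)| ≤ C * ε := hdU.trans (by gcongr)
    have k0 : |χ x| ≤ |K₁| := (hK₁ x hx).trans (le_abs_self K₁)
    have k1 : |χ x - 1| ≤ |K₁| + 1 := (abs_sub _ _).trans (by rw [abs_one]; linarith)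
    have k2 : |deriv χ x| ≤ |K₂| := (hK₂ x hx).trans (le_abs_self K₂)
    have p1 := abs_nonneg K₁
    have p2 := abs_nonneg K₂
    constructor
    · calc |χ x * P.U (μ * x) - P.U (μ * x)| = |χ x - 1| * |P.U (μ * x)| := by
            rw [← abs_mul]; ring_nf
        _ ≤ (|K₁| + 1) * (C * ε) := mul_le_mul k1 hU' (abs_nonneg _) (by positivity)
        _ ≤ (|K₁| + 1 + |K₂|) * (C * ε) :=
            mul_le_mul_of_nonneg_right (by linarith) (by positivity)
        _ = _ := by ring
    · calc |deriv χ x * P.U (μ * x) + χ x * (μ * P.dU (μ * x)) - μ * P.dU (μ * x)|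
          = |deriv χ x * P.U (μ * x) + (χ x - 1) * (μ * P.dU (μ * x))| := by ring_nf
        _ ≤ |deriv χ x| * |P.U (μ * x)| + |χ x - 1| * (μ * |P.dU (μ * x)|) := by
            refine (abs_add_le _ _).trans_eq ?_
            rw [abs_mul, abs_mul, abs_mul, abs_of_pos hμ0]
        _ ≤ |K₂| * (C * ε) + (|K₁| + 1) * (μ * (C * ε)) := by gcongr
        _ ≤ |K₂| * (μ * (C * ε)) + (|K₁| + 1) * (μ * (C * ε)) := by
            have : C * ε ≤ μ * (C * ε) := le_mul_of_one_le_left (by positivity) hμ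
            gcongr
        _ = _ := by ring

namespace MetricGraph

variable {V E : Type*} [DecidableEq V] (G : MetricGraph V E) {k : ℕ}

/-- The cut-off function used on a half-edge. -/
def cutoffSum (v : Fin k → V) (χ : Fin k → ℝ → ℝ) (s : E × Bool) (x : ℝ) : ℝ :=
  ∑ i, if G.halfVert s = v i then χ i x else 0

/-- The derivative of `cutoffSum`. -/
def dcutoffSum (v : Fin k → V) (χ : Fin k → ℝ → ℝ) (s : E × Bool) (x : ℝ) : ℝ :=
  ∑ i, if G.halfVert s = v i then deriv (χ i) x else 0

/-- The sum of the peaks. -/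
def approx (p Λ μ : ℝ) (v : Fin k → V) (χ : Fin k → ℝ → ℝ) (e : E) (x : ℝ) : ℝ :=
  Λ * (G.cutoffSum v χ (e, false) x * soliton p (μ * x)) +
    Λ * (G.cutoffSum v χ (e, true) (G.len e - x) * soliton p (μ * (G.len e - x)))

/-- The derivative of the sum of the peaks. -/
def dapprox {p : ℝ} (hp : 1 < p) (Λ μ : ℝ) (v : Fin k → V) (χ : Fin k → ℝ → ℝ) (e : E) (x : ℝ) :
    ℝ :=
  Λ * (G.dcutoffSum v χ (e, false) x * soliton p (μ * x) +
    G.cutoffSum v χ (e, false) x * (μ * (solitonProfile hp).dU (μ * x))) -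
  Λ * (G.dcutoffSum v χ (e, true) (G.len e - x) * soliton p (μ * (G.len e - x)) +
    G.cutoffSum v χ (e, true) (G.len e - x) *
      (μ * (solitonProfile hp).dU (μ * (G.len e - x))))

variable {p δ : ℝ} {v : Fin k → V} {χ : Fin k → ℝ → ℝ}

lemma sum_peak_eq (lam : ℝ) (e : E) (x : ℝ) :
    ∑ i, G.peak p lam (χ i) (v i) e x = G.approx p (lam ^ (1 / (p - 1))) (Real.sqrt lam) v χ e x := by
  simp only [peak, approx, cutoffSum, scaledSoliton, halfVert, Finset.sum_add_distrib,
    Finset.sum_mul, Finset.mul_sum, ite_mul, zero_mul, mul_ite, mul_zero, if_true,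
    Bool.false_eq_true, if_false]
  congr 1
  all_goals
    refine Finset.sum_congr rfl fun i _ => ?_
    split_ifs
    · ring
    · rfl

lemma hasDerivAt_cutoffSum (hχ : ∀ i, IsCutoff δ (χ i)) (s : E × Bool) (x : ℝ) :
    HasDerivAt (G.cutoffSum v χ s) (G.dcutoffSum v χ s x) x := by
  refine HasDerivAt.fun_sum fun i _ => ?_
  split_ifs
  · exact (hχ i).hasDerivAt x
  · exact hasDerivAt_const x 0

lemma continuous_dcutoffSum (hχ : ∀ i, IsCutoff δ (χ i)) (s : E × Bool) :
    Continuous (G.dcutoffSum v χ s) := by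
  refine continuous_finsetSum _ fun i _ => ?_
  split_ifs
  · exact (hχ i).1.continuous_deriv (by simp)
  · exact continuous_const

lemma hasDerivAt_approx (hp : 1 < p) (hχ : ∀ i, IsCutoff δ (χ i)) (Λ μ : ℝ) (e : E) (x : ℝ) :
    HasDerivAt (G.approx p Λ μ v χ e) (G.dapprox hp Λ μ v χ e x) x := by
  have h : ∀ s y, HasDerivAt (fun y => G.cutoffSum v χ s y * soliton p (μ * y))
      (G.dcutoffSum v χ s y * soliton p (μ * y) +
        G.cutoffSum v χ s y * (μ * (solitonProfile hp).dU (μ * y))) y := fun s y =>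
    (G.hasDerivAt_cutoffSum hχ s y).mul (hasDerivAt_rescale μ ((solitonProfile hp).hU (μ * y)))
  refine (((h (e, false) x).const_mul Λ).add ((hasDerivAt_reflect (G.len e)
    (h (e, true) (G.len e - x))).const_mul Λ)).congr_deriv ?_
  rw [dapprox]
  ring

lemma continuous_dapprox (hp : 1 < p) (hχ : ∀ i, IsCutoff δ (χ i)) (Λ μ : ℝ) (e : E) :
    Continuous (G.dapprox hp Λ μ v χ e) := by
  have h1 := fun s => G.continuous_dcutoffSum (v := v) hχ s
  have h2 : ∀ s, Continuous (G.cutoffSum v χ s) := fun s =>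
    continuous_iff_continuousAt.2 fun x => (G.hasDerivAt_cutoffSum hχ s x).continuousAt
  have h3 : Continuous (soliton p) := (solitonProfile hp).continuous_U
  have h4 := (solitonProfile hp).continuous_dU
  have h5 : ∀ s, Continuous fun y => G.dcutoffSum v χ s y * soliton p (μ * y) +
      G.cutoffSum v χ s y * (μ * (solitonProfile hp).dU (μ * y)) := fun s =>
    ((h1 s).mul (h3.comp (continuous_const_mul μ))).add
      ((h2 s).mul (continuous_const.mul (h4.comp (continuous_const_mul μ))))
  exact (continuous_const.mul (h5 _)).sub
    (continuous_const.mul ((h5 (e, true)).comp (continuous_const.sub continuous_id)))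

/-- Since `δ` is less than the length of a terminal edge, a peak vanishes at the far end, and a
vertex sees only peaks centred at it. -/
lemma approx_vertex (hχ : ∀ i, IsCutoff δ (χ i)) (hδ : 0 < δ)
    (hδl : ∀ i e, G.src e = v i ∨ G.tgt e = v i → δ < G.len e) (Λ μ : ℝ) :
    ∃ c : V → ℝ, ∀ e, G.approx p Λ μ v χ e 0 = c (G.src e) ∧
      G.approx p Λ μ v χ e (G.len e) = c (G.tgt e) := by
  have h1 : ∀ s, G.cutoffSum v χ s 0 = ∑ i, if G.halfVert s = v i then 1 else 0 := fun s =>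
    Finset.sum_congr rfl fun i _ => by rw [(hχ i).2.1 0 le_rfl (by positivity)]
  have h2 : ∀ s, G.cutoffSum v χ s (G.len s.1) = 0 := fun s =>
    Finset.sum_eq_zero fun i _ => by
      split_ifs with h
      · refine (hχ i).2.2 _ (hδl i s.1 ?_).le
        unfold halfVert at h
        split_ifs at h
        · exact Or.inr h
        · exact Or.inl h
      · rfl
  refine ⟨fun w => Λ * ((∑ i, if w = v i then 1 else 0) * soliton p 0), fun e => ?_⟩
  have h3 := h2 (e, true)
  have h4 := h2 (e, false)
  simp only at h3 h4
  simp only [approx, sub_zero, sub_self, mul_zero, h1, h3, h4]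
  simp [halfVert]

lemma exists_cutoffSum_error_le [Fintype E] (hp : 1 < p) (hv : Function.Injective v)
    (hχ : ∀ i, IsCutoff δ (χ i)) :
    ∃ K, 0 ≤ K ∧ ∀ μ, 1 ≤ μ → ∀ s, ∀ x ∈ Icc 0 (G.len s.1),
      |G.cutoffSum v χ s x * soliton p (μ * x) - (G.halfProfile hp v s).U (μ * x)| ≤
        K * Real.exp (-(δ / 2 * μ)) ∧
      |G.dcutoffSum v χ s x * soliton p (μ * x) +
        G.cutoffSum v χ s x * (μ * (solitonProfile hp).dU (μ * x)) -
          μ * (G.halfProfile hp v s).dU (μ * x)| ≤ K * (μ * Real.exp (-(δ / 2 * μ))) := by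
  obtain ⟨C, hC⟩ := exists_solitonProfile_isBdd hp
  -- The total length bounds every edge, so one constant per cut-off serves all edges.
  choose K hK0 hK using fun i => (hχ i).exists_error_le hC (∑ e, G.len e)
  refine ⟨∑ i, K i, Finset.sum_nonneg fun i _ => hK0 i, fun μ hμ s x hx => ?_⟩
  have hμ0 : 0 < μ := by linarith
  by_cases h : ∃ i, v i = G.halfVert s
  · obtain ⟨i, hi⟩ := h
    have hP : G.halfProfile hp v s = solitonProfile hp := if_pos ⟨i, hi⟩
    have hne : ∀ j, j ≠ i → ¬ G.halfVert s = v j := fun j hj h => hj (hv (h.symm.trans hi.symm))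
    have h1 : ∀ (ψ : Fin k → ℝ), (∑ j, if G.halfVert s = v j then ψ j else 0) = ψ i := fun ψ => by
      rw [Finset.sum_eq_single i (fun j _ hj => if_neg (hne j hj)) (by simp), if_pos hi.symm]
    have hX : G.cutoffSum v χ s x = χ i x := h1 _
    have hdX : G.dcutoffSum v χ s x = deriv (χ i) x := h1 _
    have hle : K i ≤ ∑ i, K i := Finset.single_le_sum (fun i _ => hK0 i) (Finset.mem_univ i)
    have hL : G.len s.1 ≤ ∑ e, G.len e :=
      Finset.single_le_sum (fun e _ => (G.len_pos e).le) (Finset.mem_univ s.1)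
    obtain ⟨e1, e2⟩ := hK i μ hμ x ⟨hx.1, hx.2.trans hL⟩
    rw [hP, hX, hdX]
    exact ⟨e1.trans (by gcongr), e2.trans (by gcongr)⟩
  · have hP : G.halfProfile hp v s = zeroProfile hp := if_neg h
    push Not at h
    have hX : G.cutoffSum v χ s x = 0 :=
      Finset.sum_eq_zero fun j _ => if_neg fun hj => h j hj.symm
    have hdX : G.dcutoffSum v χ s x = 0 :=
      Finset.sum_eq_zero fun j _ => if_neg fun hj => h j hj.symm
    have := Finset.sum_nonneg (s := Finset.univ) fun i _ => hK0 i
    rw [hP, hX, hdX]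
    simp only [zeroProfile, zero_mul, Pi.zero_apply, sub_zero, abs_zero, mul_zero, add_zero]
    constructor <;> positivity

/-- Functions on the half-edges close to the profiles give a function on the graph close to the
sum of the peaks. -/
lemma exists_glue_sub_approx_le [Fintype E] (hp : 1 < p) (hv : Function.Injective v)
    (hχ : ∀ i, IsCutoff δ (χ i)) {d : ℝ} (hdδ : d ≤ δ / 2)
    (hd : ∀ e, d ≤ G.len e / 2) {K : ℝ} (hK : 0 < K) :
    ∃ K', 0 < K' ∧ ∀ (Λ μ : ℝ) (w dw : E × Bool → ℝ → ℝ), 0 ≤ Λ → 1 ≤ μ →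
      (∀ s, ∀ x ∈ Icc 0 (μ * (G.len s.1 / 2)),
        |w s x - (G.halfProfile hp v s).U x| ≤ K * Real.exp (-(d * μ)) ∧
        |dw s x - (G.halfProfile hp v s).dU x| ≤ K * Real.exp (-(d * μ))) →
      ∀ e, ∀ x ∈ Icc 0 (G.len e),
        |G.glue Λ μ w e x - G.approx p Λ μ v χ e x| ≤ K' * (Λ * Real.exp (-(d * μ))) ∧
        |G.dglue Λ μ dw e x - G.dapprox hp Λ μ v χ e x| ≤
          K' * (Λ * (μ * Real.exp (-(d * μ)))) := by
  obtain ⟨C, hC1, hC⟩ := G.exists_halfProfile_isBdd hp v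
  obtain ⟨K₁, hK₁, H₁⟩ := G.exists_cutoffSum_error_le hp hv hχ
  refine ⟨K + 2 * K₁ + C, by linarith, fun Λ μ w dw hΛ hμ hw e x hx => ?_⟩
  have hμ0 : 0 < μ := by linarith
  set ε := Real.exp (-(d * μ)) with hε
  have hε0 : 0 < ε := Real.exp_pos _
  have hεδ : Real.exp (-(δ / 2 * μ)) ≤ ε := Real.exp_le_exp.2 (by nlinarith)
  have cut : ∀ s : E × Bool, ∀ y ∈ Icc 0 (G.len s.1),
      |G.cutoffSum v χ s y * soliton p (μ * y) - (G.halfProfile hp v s).U (μ * y)| ≤ K₁ * ε ∧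
      |G.dcutoffSum v χ s y * soliton p (μ * y) +
        G.cutoffSum v χ s y * (μ * (solitonProfile hp).dU (μ * y)) -
          μ * (G.halfProfile hp v s).dU (μ * y)| ≤ K₁ * (μ * ε) := fun s y hy => by
    obtain ⟨e1, e2⟩ := H₁ μ hμ s y hy
    exact ⟨e1.trans (by gcongr), e2.trans (by gcongr)⟩
  -- The sum of peaks adds contributions from both ends of an edge, the glued function uses only the
  -- nearer one; beyond the midpoint the other profile is negligible.
  have far : ∀ s : E × Bool, ∀ y, G.len s.1 / 2 ≤ y → |(G.halfProfile hp v s).U (μ * y)| ≤ C * ε ∧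
      |μ * (G.halfProfile hp v s).dU (μ * y)| ≤ C * (μ * ε) := fun s y hy => by
    have hy0 : 0 ≤ y := le_trans (by have := G.len_pos s.1; linarith) hy
    have hexp : Real.exp (-(μ * y)) ≤ ε := Real.exp_le_exp.2 (by
      have := hd s.1
      nlinarith)
    have h1 := (hC s).U_exp (μ * y) (mul_nonneg hμ0.le hy0)
    have h2 := (hC s).dU_exp (μ * y) (mul_nonneg hμ0.le hy0)
    have hC0 : 0 ≤ C := by linarith
    refine ⟨h1.trans (by gcongr), ?_⟩
    rw [abs_mul, abs_of_pos hμ0]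
    calc _ ≤ μ * (C * ε) := by
          refine mul_le_mul_of_nonneg_left (h2.trans ?_) hμ0.le
          gcongr
      _ = _ := by ring
  have near : ∀ s : E × Bool, ∀ y, 0 ≤ y → y ≤ G.len s.1 / 2 →
      |w s (μ * y) - (G.halfProfile hp v s).U (μ * y)| ≤ K * ε ∧
      |μ * dw s (μ * y) - μ * (G.halfProfile hp v s).dU (μ * y)| ≤ K * (μ * ε) :=
    fun s y hy hy' => by
      obtain ⟨h1, h2⟩ := hw s (μ * y) ⟨mul_nonneg hμ0.le hy, by gcongr⟩
      refine ⟨h1, ?_⟩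
      rw [← mul_sub, abs_mul, abs_of_pos hμ0]
      calc _ ≤ μ * (K * ε) := by gcongr
        _ = _ := by ring
  have hx' : G.len e - x ∈ Icc 0 (G.len e) := ⟨by linarith [hx.2], by linarith [hx.1]⟩
  -- Triangle inequality, shared by values and derivatives: `a` is the glued function, `b` and `e`
  -- the near and far profiles, `c` and `d` their cut-off versions.
  have comb : ∀ {a b c d e f K₁ K₂ K₃ t : ℝ}, |a - b| ≤ K₁ * t → |c - b| ≤ K₂ * t →
      |d - e| ≤ K₂ * t → |e| ≤ K₃ * t → f = a - (c + d) → |Λ * f| ≤ (K₁ + 2 * K₂ + K₃) * (Λ * t) := by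
    intro a b c d e f K₁ K₂ K₃ t h1 h2 h3 h4 h5
    rw [abs_mul, abs_of_nonneg hΛ, h5]
    have : |a - (c + d)| ≤ (K₁ + 2 * K₂ + K₃) * t := by
      rw [abs_le] at *
      constructor <;> linarith [h1.1, h1.2, h2.1, h2.2, h3.1, h3.2, h4.1, h4.2]
    calc _ ≤ Λ * ((K₁ + 2 * K₂ + K₃) * t) := mul_le_mul_of_nonneg_left this hΛ
      _ = _ := by ring
  obtain ⟨c1, c2⟩ := cut (e, false) x hx
  obtain ⟨c3, c4⟩ := cut (e, true) (G.len e - x) hx'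
  by_cases h : x ≤ G.len e / 2
  · obtain ⟨n1, n2⟩ := near (e, false) x hx.1 h
    obtain ⟨f1, f2⟩ := far (e, true) (G.len e - x) (by simp only; linarith)
    constructor
    · have := comb n1 c1 c3 f1 rfl
      refine le_trans (le_of_eq ?_) this
      rw [glue, if_pos h, approx]
      congr 1
      ring
    · rw [← abs_neg] at c4 f2
      have := comb n2 c2 (by rw [neg_sub] at c4; rw [sub_neg_eq_add, neg_add_eq_sub]; exact c4)
        f2 rfl
      refine le_trans (le_of_eq ?_) this
      rw [dglue, if_pos h, dapprox]
      congr 1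
      ring
  · obtain ⟨n1, n2⟩ := near (e, true) (G.len e - x) hx'.1 (by simp only; linarith)
    obtain ⟨f1, f2⟩ := far (e, false) x (by simp only; linarith)
    constructor
    · have := comb n1 c3 c1 f1 rfl
      refine le_trans (le_of_eq ?_) this
      rw [glue, if_neg h, approx]
      congr 1
      ring
    · rw [← abs_neg] at c2 f2
      have := comb n2 c4 (by rw [neg_sub] at c2; rw [sub_neg_eq_add, neg_add_eq_sub]; exact c2)
        f2 rfl
      refine le_trans (le_of_eq ?_) this
      rw [dglue, if_neg h, dapprox, ← abs_neg]
      congr 1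
      ring

end MetricGraph

/-! ### Regularity, decay rates and norms. -/

lemma contDiffOn_two_of_hasDerivAt {f f' f'' : ℝ → ℝ} {a b : ℝ} (hab : a < b)
    (hf : ∀ x ∈ Icc a b, HasDerivAt f (f' x) x) (hf' : ∀ x ∈ Icc a b, HasDerivAt f' (f'' x) x)
    (hf'' : ContinuousOn f'' (Icc a b)) : ContDiffOn ℝ 2 f (Icc a b) := by
  have hU := uniqueDiffOn_Icc hab
  have hd : ∀ {g g' : ℝ → ℝ}, (∀ x ∈ Icc a b, HasDerivAt g (g' x) x) →
      ∀ x ∈ Icc a b, derivWithin g (Icc a b) x = g' x := fun hg x hx =>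
    (hg x hx).hasDerivWithinAt.derivWithin (hU x hx)
  have h1 : ContDiffOn ℝ 1 f' (Icc a b) := by
    rw [show (1 : WithTop ℕ∞) = 0 + 1 by norm_num, contDiffOn_succ_iff_derivWithin hU]
    exact ⟨fun x hx => (hf' x hx).differentiableAt.differentiableWithinAt, by simp,
      (contDiffOn_zero.2 hf'').congr (hd hf')⟩
  rw [show (2 : WithTop ℕ∞) = 1 + 1 by norm_num, contDiffOn_succ_iff_derivWithin hU]
  exact ⟨fun x hx => (hf x hx).differentiableAt.differentiableWithinAt, by simp, h1.congr (hd hf)⟩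

/-- Exponential decay in `√λ` beats every power; the exponent doubles because `λ = (√λ)²`. -/
lemma rpow_mul_exp_neg_sqrt_isBigO {d : ℝ} (hd : 0 < d) (α β : ℝ) :
    (fun lam : ℝ => lam ^ β * Real.exp (-(d * Real.sqrt lam))) =O[atTop]
      fun lam : ℝ => lam ^ (-α) := by
  have h := (isLittleO_exp_neg_mul_rpow_atTop hd (2 * (-α - β))).comp_tendsto
    Real.tendsto_sqrt_atTop
  have h2 := (isBigO_refl (fun lam : ℝ => lam ^ β) atTop).mul h.isBigO
  refine (h2.congr' ?_ ?_)
  · filter_upwards with lam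
    simp
  · filter_upwards [eventually_gt_atTop 0] with lam hlam
    simp only [Function.comp]
    rw [Real.sqrt_eq_rpow, ← Real.rpow_mul hlam.le, ← Real.rpow_add hlam]
    congr 1
    ring

lemma integrableOn_soliton_sq {p : ℝ} (hp : 1 < p) :
    IntegrableOn (fun x => soliton p x ^ 2) (Ioi 0) := by
  obtain ⟨C, hC⟩ := exists_solitonProfile_isBdd hp
  have hc : Continuous (soliton p) := (solitonProfile hp).continuous_U
  refine Integrable.mono' ((exp_neg_integrableOn_Ioi 0 (b := 1) one_pos).const_mul (C * C))
    (hc.pow 2).aestronglyMeasurable ?_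
  refine (ae_restrict_iff' measurableSet_Ioi).2 (ae_of_all _ fun x hx => ?_)
  have hx0 : 0 ≤ x := le_of_lt hx
  have h1 := hC.U_exp x hx0
  have h2 := hC.U_le x
  have h3 := hC.U_nonneg x
  rw [abs_of_nonneg h3] at h1
  change ‖(solitonProfile hp).U x ^ 2‖ ≤ _
  rw [Real.norm_of_nonneg (by positivity), sq]
  calc _ ≤ C * (C * Real.exp (-x)) := mul_le_mul h2 h1 h3 hC.pos.le
    _ = _ := by rw [neg_one_mul]; ring

lemma integral_soliton_sq_pos {p : ℝ} (hp : 1 < p) : 0 < ∫ x in Ioi (0 : ℝ), soliton p x ^ 2 := by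
  rw [integral_pos_iff_support_of_nonneg (fun x => sq_nonneg _) (integrableOn_soliton_sq hp)]
  have : Function.support (fun x => soliton p x ^ 2) = univ := by
    ext x
    simp [(soliton_pos hp x).ne']
  rw [this, Measure.restrict_apply_univ]
  simp

/-! ### Energy norm, positive solution and mass on the graph. -/

namespace MetricGraph

variable {V E : Type*} [DecidableEq V] [Fintype E] (G : MetricGraph V E) {k : ℕ}

omit [DecidableEq V] in
-- Sup bounds suffice, because the total length is finite and only powers of `λ` are lost. The
-- factor `2` counts the gradient and the mass term, each at most `(μ D)²` times the length.
lemma normLam_le {lam μ D : ℝ} (hμ : 0 ≤ μ) (hlam : μ * μ = lam) (hD : 0 ≤ D) {φ φ' : E → ℝ → ℝ}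
    (hφ : ∀ e x, HasDerivAt (φ e) (φ' e x) x) (hφ' : ∀ e, ContinuousOn (φ' e) (Icc 0 (G.len e)))
    (h : ∀ e, ∀ x ∈ Icc 0 (G.len e), |φ e x| ≤ D ∧ |φ' e x| ≤ μ * D) :
    G.normLam lam φ ≤ Real.sqrt (2 * ∑ e, G.len e) * (μ * D) := by
  have hL : 0 ≤ ∑ e, G.len e := Finset.sum_nonneg fun e _ => (G.len_pos e).le
  have hb : ∀ (e : E) (f : ℝ → ℝ) (K : ℝ), (∀ x ∈ Icc 0 (G.len e), |f x| ≤ K) →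
      ∫ x in (0 : ℝ)..G.len e, f x * f x ≤ K * K * G.len e := fun e f K hf => by
    refine (Real.le_norm_self _).trans ((intervalIntegral.norm_integral_le_of_norm_le_const
      (C := K * K) fun x hx => ?_).trans_eq ?_)
    · rw [uIoc_of_le (G.len_pos e).le] at hx
      have := hf x ⟨hx.1.le, hx.2⟩
      rw [norm_mul]
      exact mul_le_mul this this (abs_nonneg _) ((abs_nonneg _).trans this)
    · rw [sub_zero, abs_of_pos (G.len_pos e)]
  have h1 : ∑ e, ∫ x in (0 : ℝ)..G.len e, weakDeriv (G.len e) (φ e) x * weakDeriv (G.len e) (φ e) x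
      ≤ (μ * D) * (μ * D) * ∑ e, G.len e := by
    rw [Finset.mul_sum]
    refine Finset.sum_le_sum fun e _ => ?_
    rw [integral_weakDeriv_mul_self (G.len_pos e).le (hφ e) (hφ' e)]
    exact hb e _ _ fun x hx => (h e x hx).2
  have h2 : ∑ e, ∫ x in (0 : ℝ)..G.len e, φ e x * φ e x ≤ D * D * ∑ e, G.len e := by
    rw [Finset.mul_sum]
    exact Finset.sum_le_sum fun e _ => hb e _ _ fun x hx => (h e x hx).1
  have hμD : 0 ≤ μ * D := mul_nonneg hμ hD
  have h3 := mul_le_mul_of_nonneg_left h2 (mul_nonneg hμ hμ)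
  calc G.normLam lam φ ≤ Real.sqrt (2 * (∑ e, G.len e) * (μ * D * (μ * D))) := by
        refine Real.sqrt_le_sqrt ?_
        rw [innerLam, ← hlam]
        linarith
    _ = _ := by rw [Real.sqrt_mul (by positivity), Real.sqrt_mul_self hμD]

variable {G}

omit [DecidableEq V] [Fintype E] in
lemma glue_zero (Λ μ : ℝ) (w : E × Bool → ℝ → ℝ) (e : E) : G.glue Λ μ w e 0 = Λ * w (e, false) 0 := by
  have := G.len_pos e
  rw [glue, if_pos (by linarith), mul_zero]

omit [DecidableEq V] [Fintype E] in
lemma glue_len (Λ μ : ℝ) (w : E × Bool → ℝ → ℝ) (e : E) :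
    G.glue Λ μ w e (G.len e) = Λ * w (e, true) 0 := by
  have := G.len_pos e
  rw [glue, if_neg (by linarith), sub_self, mul_zero]

omit [DecidableEq V] [Fintype E] in
lemma dglue_zero (Λ μ : ℝ) (dw : E × Bool → ℝ → ℝ) (e : E) :
    G.dglue Λ μ dw e 0 = Λ * (μ * dw (e, false) 0) := by
  have := G.len_pos e
  rw [dglue, if_pos (by linarith), mul_zero]

omit [DecidableEq V] [Fintype E] in
lemma dglue_len (Λ μ : ℝ) (dw : E × Bool → ℝ → ℝ) (e : E) :
    G.dglue Λ μ dw e (G.len e) = -(Λ * (μ * dw (e, true) 0)) := by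
  have := G.len_pos e
  rw [dglue, if_neg (by linarith), sub_self, mul_zero]

omit [DecidableEq V] [Fintype E] in
lemma glue_vertex {Λ μ : ℝ} {w : E × Bool → ℝ → ℝ}
    (hw : ∀ s s', G.halfVert s = G.halfVert s' → w s 0 = w s' 0) :
    ∃ c : V → ℝ, ∀ e, G.glue Λ μ w e 0 = c (G.src e) ∧ G.glue Λ μ w e (G.len e) = c (G.tgt e) := by
  classical
  refine ⟨fun x => if h : ∃ s, G.halfVert s = x then Λ * w h.choose 0 else 0, fun e => ?_⟩
  have key : ∀ s : E × Bool, (if h : ∃ s', G.halfVert s' = G.halfVert s then Λ * w h.choose 0 else 0)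
      = Λ * w s 0 := fun s => by
    have h : ∃ s', G.halfVert s' = G.halfVert s := ⟨s, rfl⟩
    rw [dif_pos h, hw _ _ h.choose_spec]
  rw [glue_zero, glue_len]
  exact ⟨(key (e, false)).symm, (key (e, true)).symm⟩

lemma dglue_kirchhoff {Λ μ : ℝ} {dw : E × Bool → ℝ → ℝ}
    (hdw : ∀ v, ∑ s with G.halfVert s = v, dw s 0 = 0) (x : V) :
    ∑ e, ((if G.src e = x then G.dglue Λ μ dw e 0 else 0) +
      (if G.tgt e = x then -G.dglue Λ μ dw e (G.len e) else 0)) = 0 := by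
  have h := hdw x
  rw [Finset.sum_filter, Fintype.sum_prod_type] at h
  simp only [Fintype.sum_bool, halfVert, if_true, Bool.false_eq_true, if_false] at h
  simp only [dglue_zero, dglue_len, neg_neg]
  have h2 := congrArg (fun t => Λ * (μ * t)) h
  simp only [Finset.mul_sum, mul_zero] at h2
  refine (Finset.sum_congr rfl fun e _ => ?_).trans h2
  split_ifs <;> ring

/-- Functions on the half-edges close to the profiles give a positive solution on the graph. -/
theorem isPositiveSolution_glue (hG : G.Connected) {p lam Λ μ K ε : ℝ} (hp : 1 < p)
    {v : Fin k → V} (hk : 1 ≤ k) (hdeg : ∀ i, G.degree (v i) = 1) (hΛ : 0 < Λ) (hμ : 0 < μ)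
    (hΛp : Λ ^ (p - 1) = lam) (hμl : μ * μ = lam) {w dw : E × Bool → ℝ → ℝ}
    (h1 : ∀ s x, HasDerivAt (w s) (dw s x) x)
    (h2 : ∀ s : E × Bool, ∀ x ∈ Icc 0 (μ * (G.len s.1 / 2)),
      HasDerivAt (dw s) (w s x - powNL p (w s x)) x)
    (h3 : ∀ s s', G.halfVert s = G.halfVert s' → w s 0 = w s' 0)
    (h4 : ∀ v, ∑ s with G.halfVert s = v, dw s 0 = 0)
    (h5 : ∀ e, w (e, false) (μ * (G.len e / 2)) = w (e, true) (μ * (G.len e / 2)) ∧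
        dw (e, false) (μ * (G.len e / 2)) = -dw (e, true) (μ * (G.len e / 2)))
    (h6 : ∀ s : E × Bool, ∀ x ∈ Icc 0 (μ * (G.len s.1 / 2)),
        |w s x - (G.halfProfile hp v s).U x| ≤ K * ε)
    (hε1 : K * ε < 1) (hε2 : K * ε < soliton p 0) :
    0 < G.l2Norm (G.glue Λ μ w) ∧
      G.IsPositiveSolution p lam (G.l2Norm (G.glue Λ μ w)) (G.glue Λ μ w) := by
  obtain ⟨C, -, hC⟩ := G.exists_halfProfile_isBdd hp v
  have hu := hasDerivAt_glue (G := G) (Λ := Λ) h1 h5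
  have hv := fun e x hx => hasDerivAt_dglue (G := G) hΛ.le hμ.le hΛp hμl h2 h5 e (x := x) hx
  have hKir := dglue_kirchhoff (G := G) (Λ := Λ) (μ := μ) h4
  obtain ⟨c, hc⟩ := glue_vertex (G := G) (Λ := Λ) (μ := μ) h3
  have hcont : ∀ e, Continuous (G.glue Λ μ w e) := fun e =>
    continuous_iff_continuousAt.2 fun x => (hu e x).continuousAt
  -- The profiles are nonnegative and the error is below `1`; as `Λ ^ (p - 1) = λ`, this is the
  -- smallness required of the negative part.
  have hlow : ∀ e, ∀ x ∈ Icc 0 (G.len e), -Λ < G.glue Λ μ w e x := fun e x hx => by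
    have key : ∀ s : E × Bool, ∀ y ∈ Icc 0 (μ * (G.len s.1 / 2)), -Λ < Λ * w s y := fun s y hy => by
      have a1 := (abs_le.1 (h6 s y hy)).1
      have a2 := (hC s).U_nonneg y
      nlinarith
    unfold glue
    split_ifs with h
    · exact key (e, false) _ ⟨mul_nonneg hμ.le hx.1, mul_le_mul_of_nonneg_left h hμ.le⟩
    · exact key (e, true) _ ⟨mul_nonneg hμ.le (by linarith [hx.2]),
        mul_le_mul_of_nonneg_left (by simp only; linarith) hμ.le⟩
  have hsmall : ∀ e, ∀ x ∈ Icc 0 (G.len e), G.glue Λ μ w e x < 0 →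
      |G.glue Λ μ w e x| ^ (p - 1) < lam := fun e x hx hneg => by
    rw [← hΛp]
    refine Real.rpow_lt_rpow (abs_nonneg _) ?_ (by linarith)
    rw [abs_of_neg hneg]
    linarith [hlow e x hx]
  have hs : ∃ s : E × Bool, ∃ i, v i = G.halfVert s := by
    by_contra! hcon
    have h := G.sum_halfVert_eq_degree (v ⟨0, hk⟩) 1
    rw [hdeg, Finset.sum_eq_zero fun s _ => if_neg fun hs => hcon s _ hs.symm] at h
    norm_num at h
  obtain ⟨s, hs⟩ := hs
  -- The error is smaller than the height of the soliton at a peak, so the solution is not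
  -- identically zero.
  have hws : w s 0 ≠ 0 := by
    have := G.len_pos s.1
    have a1 := (abs_le.1 (h6 s 0 ⟨le_rfl, by positivity⟩)).1
    rw [halfProfile, if_pos hs] at a1
    change -(K * ε) ≤ w s 0 - soliton p 0 at a1
    intro h0
    linarith
  have hne : ∃ e, ∃ x ∈ Icc 0 (G.len e), G.glue Λ μ w e x ≠ 0 := by
    obtain ⟨e, b⟩ := s
    refine ⟨e, ?_⟩
    cases b
    · exact ⟨0, ⟨le_rfl, (G.len_pos e).le⟩, by rw [glue_zero]; exact mul_ne_zero hΛ.ne' hws⟩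
    · exact ⟨G.len e, ⟨(G.len_pos e).le, le_rfl⟩, by rw [glue_len]; exact mul_ne_zero hΛ.ne' hws⟩
  have hpos := G.pos_of_solution hG hp hu hv hc hKir hsmall hne
  refine ⟨?_, ?_⟩
  · refine Real.sqrt_pos.2 (Finset.sum_pos (fun e _ => ?_) ⟨s.1, Finset.mem_univ _⟩)
    exact intervalIntegral.intervalIntegral_pos_of_pos_on
      (((hcont e).pow 2).intervalIntegrable _ _)
      (fun x hx => pow_pos (hpos e x ⟨hx.1.le, hx.2.le⟩) 2) (G.len_pos e)
  · have hU := fun e => uniqueDiffOn_Icc (G.len_pos e)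
    refine
    { memH1 := ⟨⟨fun e => (hcont e).continuousOn, c, hc⟩, fun e =>
        memH1Interval_of_hasDerivAt (G.len_pos e).le (hu e)
          fun x hx => (hv e x hx).continuousAt.continuousWithinAt⟩
      contDiffOn := fun e => contDiffOn_two_of_hasDerivAt (G.len_pos e) (fun x _ => hu e x) (hv e)
        ((continuous_const.mul (hcont e)).sub
          ((continuous_powNL hp).comp (hcont e))).continuousOn
      equation := fun e x hx => ?_
      kirchhoff := fun x => ?_
      mass := rfl
      pos := hpos }
    · have : deriv (G.glue Λ μ w e) = G.dglue Λ μ dw e := funext fun y => (hu e y).deriv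
      rw [this, (hv e x ⟨hx.1.le, hx.2.le⟩).deriv, powNL]
      ring
    · rw [Kirchhoff]
      refine (Finset.sum_congr rfl fun e _ => ?_).trans (hKir x)
      rw [(hu e 0).hasDerivWithinAt.derivWithin (hU e 0 ⟨le_rfl, (G.len_pos e).le⟩),
        (hu e _).hasDerivWithinAt.derivWithin (hU e _ ⟨(G.len_pos e).le, le_rfl⟩)]

omit [DecidableEq V] in
-- Splitting at the midpoint and changing variables isolates the power of `λ` in the mass as `Λ² /
-- μ`.
lemma l2Norm_glue_sq {Λ μ : ℝ} (hμ : 0 < μ) {w : E × Bool → ℝ → ℝ} (hw : ∀ s, Continuous (w s))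
    (hmid : ∀ e, w (e, false) (μ * (G.len e / 2)) = w (e, true) (μ * (G.len e / 2))) :
    G.l2Norm (G.glue Λ μ w) ^ 2 =
      Λ ^ 2 / μ * ∑ s : E × Bool, ∫ x in (0 : ℝ)..μ * (G.len s.1 / 2), w s x ^ 2 := by
  have hnn : 0 ≤ ∑ e, ∫ x in (0 : ℝ)..G.len e, G.glue Λ μ w e x ^ 2 :=
    Finset.sum_nonneg fun e _ =>
      intervalIntegral.integral_nonneg (G.len_pos e).le fun x _ => sq_nonneg _
  rw [l2Norm, Real.sq_sqrt hnn, Finset.mul_sum, Fintype.sum_prod_type]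
  refine Finset.sum_congr rfl fun e _ => ?_
  have hl := G.len_pos e
  have hm : G.len e - G.len e / 2 = G.len e / 2 := by ring
  have hF : Continuous fun x => Λ * w (e, false) (μ * x) :=
    continuous_const.mul ((hw _).comp (continuous_const_mul μ))
  have hT : Continuous fun x => Λ * w (e, true) (μ * (G.len e - x)) :=
    continuous_const.mul ((hw _).comp (continuous_const.mul (continuous_const.sub continuous_id)))
  have hg : Continuous (G.glue Λ μ w e) :=
    hF.if_le hT continuous_id continuous_const fun x hx => by rw [hx, hmid e, hm]
  have hi : ∀ a b, IntervalIntegrable (fun x => G.glue Λ μ w e x ^ 2) volume a b := fun a b =>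
    (hg.pow 2).intervalIntegrable a b
  have half : ∀ b, ∫ x in (0 : ℝ)..G.len e / 2, (Λ * w (e, b) (μ * x)) ^ 2 =
      Λ ^ 2 / μ * ∫ x in (0 : ℝ)..μ * (G.len e / 2), w (e, b) x ^ 2 := fun b => by
    simp only [mul_pow Λ]
    rw [intervalIntegral.integral_const_mul,
      intervalIntegral.integral_comp_mul_left (fun y => w (e, b) y ^ 2) hμ.ne', mul_zero,
      smul_eq_mul]
    ring
  rw [Fintype.sum_bool, ← intervalIntegral.integral_add_adjacent_intervals (hi 0 (G.len e / 2))
    (hi _ _), add_comm]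
  congr 1
  · rw [← half true]
    have e1 : ∫ x in (G.len e / 2)..G.len e, G.glue Λ μ w e x ^ 2 =
        ∫ x in (G.len e / 2)..G.len e, (Λ * w (e, true) (μ * (G.len e - x))) ^ 2 := by
      refine intervalIntegral.integral_congr fun x hx => ?_
      rw [uIcc_of_le (by linarith)] at hx
      rcases hx.1.eq_or_lt with h | h
      · rw [glue, if_pos h.ge, ← h, hmid e, hm]
      · rw [glue, if_neg (not_le.2 h)]
    rw [e1, intervalIntegral.integral_comp_sub_left (fun y => (Λ * w (e, true) (μ * y)) ^ 2),
      sub_self, hm]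
  · rw [← half false]
    refine intervalIntegral.integral_congr fun x hx => ?_
    rw [uIcc_of_le (by linarith)] at hx
    rw [glue, if_pos hx.2]

/-- Convergence of the rescaled mass. -/
lemma tendsto_mass {p K d : ℝ} (hp : 1 < p) {v : Fin k → V} (hv : Function.Injective v)
    (hdeg : ∀ i, G.degree (v i) = 1) (hd : 0 < d) {W : ℝ → E × Bool → ℝ → ℝ}
    (hW : ∀ᶠ μ in atTop, ∀ s : E × Bool, Continuous (W μ s) ∧
      ∀ x ∈ Icc 0 (μ * (G.len s.1 / 2)),
        |W μ s x - (G.halfProfile hp v s).U x| ≤ K * Real.exp (-(d * μ))) :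
    Tendsto (fun μ => ∑ s : E × Bool, ∫ x in (0 : ℝ)..μ * (G.len s.1 / 2), W μ s x ^ 2) atTop
      (nhds (k * ∫ x in Ioi (0 : ℝ), soliton p x ^ 2)) := by
  obtain ⟨C, hC1, hC⟩ := G.exists_halfProfile_isBdd hp v
  set J := ∫ x in Ioi (0 : ℝ), soliton p x ^ 2 with hJ
  -- The `v i` are distinct and of degree one, so exactly `k` half-edges carry a soliton.
  have hsum : ∑ s : E × Bool, (if ∃ i, v i = G.halfVert s then J else 0) = k * J := by
    have : ∀ s : E × Bool, (if ∃ i, v i = G.halfVert s then J else 0) =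
        ∑ i, if G.halfVert s = v i then J else 0 := fun s => by
      split_ifs with h
      · obtain ⟨i, hi⟩ := h
        rw [Finset.sum_eq_single i (fun j _ hj => if_neg fun h => hj (hv (h.symm.trans hi.symm)))
          (by simp), if_pos hi.symm]
      · push Not at h
        exact (Finset.sum_eq_zero fun i _ => if_neg fun hi => h i hi.symm).symm
    rw [Finset.sum_congr rfl fun s _ => this s, Finset.sum_comm,
      Finset.sum_congr rfl fun i _ => G.sum_halfVert_eq_degree (v i) J]
    simp [hdeg]
  rw [← hsum]
  refine tendsto_finsetSum _ fun s _ => ?_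
  have hl : 0 < G.len s.1 / 2 := half_pos (G.len_pos s.1)
  have hM : Tendsto (fun μ : ℝ => μ * (G.len s.1 / 2)) atTop atTop :=
    tendsto_id.atTop_mul_const hl
  have hlim : Tendsto (fun μ : ℝ => ∫ x in (0 : ℝ)..μ * (G.len s.1 / 2),
      (G.halfProfile hp v s).U x ^ 2) atTop
      (nhds (if ∃ i, v i = G.halfVert s then J else 0)) := by
    unfold halfProfile
    split_ifs with h
    · exact intervalIntegral_tendsto_integral_Ioi 0 (integrableOn_soliton_sq hp) hM
    · simp [zeroProfile]
  have hexp : Tendsto (fun μ : ℝ => Real.exp (-(d * μ))) atTop (nhds 0) :=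
    Real.tendsto_exp_neg_atTop_nhds_zero.comp (tendsto_id.const_mul_atTop hd)
  have hμexp : Tendsto (fun μ : ℝ => μ * Real.exp (-(d * μ))) atTop (nhds 0) := by
    have := tendsto_rpow_mul_exp_neg_mul_atTop_nhds_zero 1 d hd
    simpa using this
  have hdiff : Tendsto (fun μ : ℝ => (∫ x in (0 : ℝ)..μ * (G.len s.1 / 2), W μ s x ^ 2) -
      ∫ x in (0 : ℝ)..μ * (G.len s.1 / 2), (G.halfProfile hp v s).U x ^ 2) atTop (nhds 0) := by
    -- The intervals grow linearly in `μ`, but the pointwise difference of the squares decays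
    -- exponentially.
    have hb : Tendsto (fun μ : ℝ => K * (μ * Real.exp (-(d * μ))) *
        (K * Real.exp (-(d * μ)) + 2 * C) * (G.len s.1 / 2)) atTop (nhds 0) := by
      simpa using ((hμexp.const_mul K).mul ((hexp.const_mul K).add_const (2 * C))).mul_const
        (G.len s.1 / 2)
    refine squeeze_zero_norm' ?_ hb
    filter_upwards [hW, eventually_ge_atTop 0] with μ hμ hμ0
    have hM0 : 0 ≤ μ * (G.len s.1 / 2) := mul_nonneg hμ0 hl.le
    rw [← intervalIntegral.integral_sub (f := fun x => W μ s x ^ 2)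
      (g := fun x => (G.halfProfile hp v s).U x ^ 2) (((hμ s).1.pow 2).intervalIntegrable _ _)
      (((G.halfProfile hp v s).continuous_U.pow 2).intervalIntegrable _ _)]
    refine (intervalIntegral.norm_integral_le_of_norm_le_const
      (C := K * Real.exp (-(d * μ)) * (K * Real.exp (-(d * μ)) + 2 * C)) fun x hx => ?_).trans_eq ?_
    · rw [uIoc_of_le hM0] at hx
      have a1 := (hμ s).2 x ⟨hx.1.le, hx.2⟩
      have a2 := (hC s).U_nonneg x
      have a3 := (hC s).U_le x
      set D := K * Real.exp (-(d * μ))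
      have a4 : |W μ s x + (G.halfProfile hp v s).U x| ≤ D + 2 * C := by
        rw [abs_le] at a1 ⊢
        constructor <;> linarith [a1.1, a1.2]
      calc _ = |W μ s x - (G.halfProfile hp v s).U x| * |W μ s x + (G.halfProfile hp v s).U x| := by
            rw [← abs_mul, Real.norm_eq_abs]; ring_nf
        _ ≤ _ := mul_le_mul a1 a4 (abs_nonneg _) ((abs_nonneg _).trans a1)
    · rw [sub_zero, abs_of_nonneg hM0]
      ring
  simpa using hdiff.add hlim

end MetricGraph

end

/-! ### The main theorem. -/

theorem mainTheorem4 {V E : Type*} [Fintype V] [DecidableEq V] [Fintype E]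
    (G : MetricGraph V E) (hG : G.Connected) (p : ℝ) (hp : 1 < p)
    (k : ℕ) (hk : 1 ≤ k) (v : Fin k → V) (hv : Function.Injective v)
    (hdeg : ∀ i, G.degree (v i) = 1)
    (δ : ℝ) (hδ : 0 < δ)
    (hδl : ∀ i e, G.src e = v i ∨ G.tgt e = v i → δ < G.len e)
    (χ : Fin k → ℝ → ℝ) (hχ : ∀ i, IsCutoff δ (χ i)) :
    ∃ lam₀ : ℝ, 0 < lam₀ ∧ ∃ (u φ : ℝ → E → ℝ → ℝ) (ρ : ℝ → ℝ),
      (∀ lam : ℝ, lam₀ < lam →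
        0 < ρ lam ∧
        G.IsPositiveSolution p lam (ρ lam) (u lam) ∧
        G.MemH1 (φ lam) ∧
        ∀ e, ∀ x ∈ Icc 0 (G.len e),
          u lam e x = (∑ i, G.peak p lam (χ i) (v i) e x) + φ lam e x) ∧
      (∀ α : ℝ, 0 < α →
        (fun lam : ℝ => G.normLam lam (φ lam)) =O[atTop] fun lam : ℝ => lam ^ (-α)) ∧
      ∃ C : ℝ, 0 < C ∧ C = k * ∫ x in Ioi (0 : ℝ), soliton p x ^ 2 ∧
        (fun lam : ℝ => ρ lam ^ 2 - C * lam ^ ((5 - p) / (2 * (p - 1)))) =o[atTop]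
          fun lam : ℝ => lam ^ ((5 - p) / (2 * (p - 1))) := by
  have hp' : 0 < p - 1 := by linarith
  -- The common decay rate: `δ / 2` is where the cut-off starts to act, half the shortest length
  -- where half-edges meet.
  obtain ⟨d, hd0, hdδ, hd⟩ : ∃ d : ℝ, 0 < d ∧ d ≤ δ / 2 ∧ ∀ e, d ≤ G.len e / 2 := by
    rcases isEmpty_or_nonempty E with h | h
    · exact ⟨δ / 2, by positivity, le_rfl, fun e => isEmptyElim e⟩
    · obtain ⟨e₀, he₀⟩ := Finite.exists_min G.len
      exact ⟨min (δ / 2) (G.len e₀ / 2), lt_min (by positivity) (half_pos (G.len_pos e₀)),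
        min_le_left _ _, fun e => (min_le_right _ _).trans (by linarith [he₀ e])⟩
  obtain ⟨K, μ₀, hK, hex⟩ := G.exists_halfEdge_solution hp v hdeg hd0 hd
  obtain ⟨K', hK', herr⟩ := G.exists_glue_sub_approx_le hp hv hχ hdδ hd hK
  have hexp : Tendsto (fun μ : ℝ => K * Real.exp (-(d * μ))) atTop (nhds 0) := by
    simpa using (Real.tendsto_exp_neg_atTop_nhds_zero.comp
      (tendsto_id.const_mul_atTop hd0)).const_mul K
  obtain ⟨μ₁, hμ₁⟩ := eventually_atTop.1 (hexp.eventually (gt_mem_nhds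
    (lt_min one_pos (soliton_pos hp 0))))
  -- Threshold for `√λ`: above it the half-edge solution exists and its error is below both `1` and
  -- the height of the soliton, as positivity requires.
  set m := max (max 1 μ₀) μ₁ with hm
  have hm1 : 1 ≤ m := (le_max_left _ _).trans (le_max_left _ _)
  choose! w dw h1 h2 h3 h4 h5 h6 using fun (μ : ℝ) (h : m ≤ μ) =>
    hex μ (((le_max_right _ _).trans (le_max_left _ _)).trans h) (by linarith)
  have hsqrt : ∀ lam : ℝ, m ^ 2 < lam → m ≤ Real.sqrt lam := fun lam h =>
    Real.le_sqrt_of_sq_le h.le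
  set Λ : ℝ → ℝ := fun lam => lam ^ (1 / (p - 1)) with hΛ
  set u : ℝ → E → ℝ → ℝ := fun lam => G.glue (Λ lam) (Real.sqrt lam) (w (Real.sqrt lam)) with hu
  set φ : ℝ → E → ℝ → ℝ := fun lam e x =>
    u lam e x - G.approx p (Λ lam) (Real.sqrt lam) v χ e x with hφ
  set dφ : ℝ → E → ℝ → ℝ := fun lam e x =>
    G.dglue (Λ lam) (Real.sqrt lam) (dw (Real.sqrt lam)) e x -
      G.dapprox hp (Λ lam) (Real.sqrt lam) v χ e x with hdφ
  have hΛ0 : ∀ lam, m ^ 2 < lam → 0 < Λ lam := fun lam h =>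
    Real.rpow_pos_of_pos (lt_trans (by positivity) h) _
  have hpos : ∀ lam, m ^ 2 < lam → 0 < lam := fun lam h => lt_trans (by positivity) h
  have hΛp : ∀ lam, m ^ 2 < lam → Λ lam ^ (p - 1) = lam := fun lam h => by
    simp only [hΛ]
    rw [← Real.rpow_mul (hpos lam h).le, one_div, inv_mul_cancel₀ hp'.ne', Real.rpow_one]
  have hφd : ∀ lam, m ^ 2 < lam → ∀ e x, HasDerivAt (φ lam e) (dφ lam e x) x := fun lam h e x =>
    (MetricGraph.hasDerivAt_glue (h1 _ (hsqrt lam h)) (h5 _ (hsqrt lam h)) e x).sub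
      (G.hasDerivAt_approx hp hχ _ _ e x)
  have hdφc : ∀ lam, m ^ 2 < lam → ∀ e, ContinuousOn (dφ lam e) (Icc 0 (G.len e)) :=
    fun lam h e => ContinuousOn.sub (fun x hx => (MetricGraph.hasDerivAt_dglue (hΛ0 lam h).le
      (Real.sqrt_nonneg lam) (hΛp lam h) (Real.mul_self_sqrt (hpos lam h).le) (h2 _ (hsqrt lam h))
      (h5 _ (hsqrt lam h)) e hx).continuousAt.continuousWithinAt)
      (G.continuous_dapprox hp hχ _ _ e).continuousOn
  refine ⟨m ^ 2, by positivity, u, φ, fun lam => G.l2Norm (u lam), fun lam h => ?_, fun α _ => ?_,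
    k * ∫ x in Ioi (0 : ℝ), soliton p x ^ 2, ?_, rfl, ?_⟩
  · have hs := hsqrt lam h
    have hsmall := hμ₁ _ ((le_max_right _ _).trans hs)
    obtain ⟨a1, a2⟩ := MetricGraph.isPositiveSolution_glue hG hp hk hdeg (hΛ0 lam h)
      (show 0 < Real.sqrt lam by linarith) (hΛp lam h) (Real.mul_self_sqrt (hpos lam h).le)
      (h1 _ hs) (h2 _ hs) (h3 _ hs) (h4 _ hs) (h5 _ hs) (fun s x hx => (h6 _ hs s x hx).1)
      (hsmall.trans_le (min_le_left _ _)) (hsmall.trans_le (min_le_right _ _))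
    refine ⟨a1, a2, ⟨⟨fun e x _ => (hφd lam h e x).continuousAt.continuousWithinAt, ?_⟩, fun e =>
      memH1Interval_of_hasDerivAt (G.len_pos e).le (hφd lam h e) (hdφc lam h e)⟩, fun e x _ => ?_⟩
    · obtain ⟨c, hc⟩ := MetricGraph.glue_vertex (G := G) (Λ := Λ lam) (μ := Real.sqrt lam)
        (h3 _ hs)
      obtain ⟨c', hc'⟩ := G.approx_vertex (p := p) hχ hδ hδl (Λ lam) (Real.sqrt lam)
      refine ⟨c - c', fun e => ?_⟩
      simp only [hφ, hu, hc e, hc' e, Pi.sub_apply, and_self]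
    · rw [MetricGraph.sum_peak_eq]
      simp only [hφ, hΛ]
      ring
  -- The power of `λ` is the amplitude `λ ^ (1 / (p - 1))` times the factor `√λ` of the energy norm.
  · have hb : (fun lam => G.normLam lam (φ lam)) =O[atTop] fun lam : ℝ =>
        lam ^ (1 / (p - 1) + 1 / 2) * Real.exp (-(d * Real.sqrt lam)) := by
      refine IsBigO.of_bound (Real.sqrt (2 * ∑ e, G.len e) * K') ?_
      filter_upwards [eventually_gt_atTop (m ^ 2)] with lam h
      have hs := hsqrt lam h
      have hl := hpos lam h
      have hΛl := hΛ0 lam h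
      have hle := G.normLam_le (Real.sqrt_nonneg lam) (Real.mul_self_sqrt hl.le)
        (D := K' * (Λ lam * Real.exp (-(d * Real.sqrt lam)))) (by positivity) (hφd lam h)
        (hdφc lam h) fun e x hx => by
          obtain ⟨e1, e2⟩ := herr (Λ lam) (Real.sqrt lam) _ _ hΛl.le (hm1.trans hs) (h6 _ hs) e x hx
          exact ⟨e1, e2.trans_eq (by ring)⟩
      have hn : 0 ≤ G.normLam lam (φ lam) := Real.sqrt_nonneg _
      rw [Real.norm_of_nonneg hn, Real.norm_of_nonneg (by positivity),
        Real.rpow_add hl, ← Real.sqrt_eq_rpow]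
      exact hle.trans_eq (by simp only [hΛ]; ring)
    exact hb.trans (rpow_mul_exp_neg_sqrt_isBigO hd0 α _)
  · exact mul_pos (by exact_mod_cast hk) (integral_soliton_sq_pos hp)
  · have hmass := (MetricGraph.tendsto_mass (G := G) hp hv hdeg hd0 (W := w) (K := K) (by
      filter_upwards [eventually_ge_atTop m] with μ h s
      exact ⟨continuous_iff_continuousAt.2 fun x => (h1 μ h s x).continuousAt,
        fun x hx => (h6 μ h s x hx).1⟩)).comp Real.tendsto_sqrt_atTop
    set C := k * ∫ x in Ioi (0 : ℝ), soliton p x ^ 2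
    have h0 := (isLittleO_one_iff ℝ).2 (tendsto_sub_nhds_zero_iff.2 hmass)
    have h7 := (isBigO_refl (fun lam : ℝ => lam ^ ((5 - p) / (2 * (p - 1)))) atTop).mul_isLittleO h0
    refine h7.congr' ?_ (Eventually.of_forall fun lam => mul_one _)
    filter_upwards [eventually_gt_atTop (m ^ 2)] with lam h
    have hs := hsqrt lam h
    have hl := hpos lam h
    -- `2 / (p - 1) - 1 / 2 = (5 - p) / (2 (p - 1))`.
    have e1 : lam ^ ((5 - p) / (2 * (p - 1))) = Λ lam ^ 2 / Real.sqrt lam := by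
      simp only [hΛ]
      rw [Real.sqrt_eq_rpow, ← Real.rpow_natCast, ← Real.rpow_mul hl.le, ← Real.rpow_sub hl]
      congr 1
      push_cast
      field_simp
      ring
    rw [MetricGraph.l2Norm_glue_sq (show 0 < Real.sqrt lam by linarith)
      (fun s => continuous_iff_continuousAt.2 fun x => (h1 _ hs s x).continuousAt)
      (fun e => (h5 _ hs e).1), ← e1]
    simp only [Function.comp]
    ring
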